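/- **Model.** Fix a horizon $T$, a service rate $\mu>0$, an integer $\Delta\ge 1$, a bounded measurable arrival rate $\lambda:[0,T]\to[0,\infty)$ with offered load $\rho=\lambda/\mu$, and $\alpha_n\in(0,1)$ for $n\ge 1$. For each $n\ge1$ consider $n$ infinite-server pools; let $q_n(t,i)$ be the fraction of pools with at least $i$ tasks at time $t$ and $\ell_n(t)$ the threshold, a non-negative multiple of $\Delta$. All systems are defined on one probability space from independent unit-rate Poisson processes $\{\mathcal N_i\}_{i\ge0}$, i.i.d. uniform variables $\{U_k\}_{k\ge1}$ on $[0,1)$ and random initial conditions $(q_n(0),\ell_n(0))_{n\ge1}$, these three families being independent, as follows. The number of arrivals during $[0,t]$ is $\mathcal N_n^\lambda(t)=\mathcal N_0\big(n\int_0^t\lambda(s)\,ds\big)$, with jump times $\tau_{n,k}$, and, almost surely, $(q_n,\ell_n)$ is càdlàg on $[0,T]$, $q_n(t,\cdot)$ is a non-increasing sequence in $[0,1]$ with $q_n(t,0)=1$, and for all $i\ge1$ and $t\in[0,T]$ $$q_n(t,i)=q_n(0,i)+\frac1n\sum_{k=1}^{\mathcal N_n^\lambda(t)} r_{i,k}-\frac1n\mathcal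 N_i\Big(n\int_0^t\mu i\,[q_n(s,i)-q_n(s,i+1)]\,ds\Big),$$ $$\ell_n(t)=\ell_n(0)+\Delta\sum_{k=1}^{\mathcal N_n^\lambda(t)}\Big[\mathbf 1\{q_n(\tau_{n,k}^-,\ell_n(\tau_{n,k}^-)+\Delta)\ge 1-\tfrac1n\}-\mathbf 1\{q_n(\tau_{n,k}^-,\ell_n(\tau_{n,k}^-))\le\alpha_n\}\Big].$$ Here $r_{i,k}$ is the indicator that the $k$-th task is dispatched to a pool with exactly $i-1$ tasks: with $q=q_n(\tau_{n,k}^-)$, $\ell=\ell_n(\tau_{n,k}^-)$, $h=\ell+\Delta$, $I_i=[1-q(i-1),1-q(i))$ and $J_i(j)=\big[\frac{1-q(i-1)}{1-q(j)},\frac{1-q(i)}{1-q(j)}\big)$ (empty if $q(j)=1$), $r_{i,k}$ equals $\mathbf 1\{U_k\in J_i(\ell)\}$ if $i-1<\ell$, $\mathbf 1\{q(\ell)=1,\,U_k\in J_i(h)\}$ if $\ell\le i-1<h$, and $\mathbf 1\{q(h)=1,\,U_k\in I_i\}$ if $i-1\ge h$. (So a task goes to a uniformly chosen pool with fewer than $\ell$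 tasks if there is one, otherwise to a uniformly chosen pool with fewer than $h$ tasks if there is one, and otherwise to a uniformly chosen pool.) Assume that almost surely, for every $n\ge1$, the numbers $n\,q_n(0,i)$ are integers, $\ell_n(0)$ is a multiple of $\Delta$, and $q_n(0,B+1)=0$ and $\ell_n(0)\le B$, where $B\in\mathbb N$ is a constant; and that almost surely $q_n(0,i)\to q(0,i)$ for every $i$, where $q(0,\cdot)$ is a deterministic non-increasing sequence in $[0,1]$ with $q(0,0)=1$. Define $$u(t)=e^{-\mu t}\sum_{i\ge1}q(0,i)+\int_0^t\rho(s)\,\mu\,e^{-\mu(t-s)}\,ds,\qquad t\in[0,T].$$ Let $m\ge0$ be an integer and $[a,b]\subset[0,T]$, and put $\rho_{\min}=\inf_{[a,b]}\rho$, $\rho_{\max}=\sup_{[a,b]}\rho$. The offered load is *$(m,\Delta)$-bounded* on $[a,b]$ if $m\Delta<\rho_{\min}\le\rho_{\max}<(m+1)\Delta$ and $b-a>\sigma(a,b,m,\Delta)$, where $$\sigma(a,b,m,\Delta)=\frac1\mu\log\frac{\rho_{\min}}{\rho_{\min}-m\Delta}+\begin{cases}\frac1\mu\Big[\log\frac{u(a)-\rho_{\max}}{(m+1)\Delta-\rho_{\max}}\Big]^+&\text{if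 }u(a)>\rho_{\max},\\0&\text{if }u(a)\le\rho_{\max}.\end{cases}$$ **Theorem 1.** Suppose there is $\gamma_0\in(0,1/2)$ such that $\lim_{n\to\infty}\alpha_n=1$ and $\liminf_{n\to\infty}n^{\gamma_0}(1-\alpha_n)>0$. If the offered load is $(m,\Delta)$-bounded on $[a,b]$ and $\sigma(a,b,m,\Delta)<\sigma<b-a$, then there exists $c>0$, which can be taken equal to $u(a+\sigma)$, such that with probability one $$\lim_{n\to\infty}\sup_{t\in[a+\sigma,b]}|\ell_n(t)-m\Delta|=0,$$ $$\lim_{n\to\infty}\sup_{t\in[a+\sigma,b]}|1-q_n(t,i)|=0\quad\text{for all } i\le m\Delta,$$ $$\limsup_{n\to\infty}\sup_{t\in[a+\sigma,b]}|q_n(t,i)|\,e^{\mu[t-(a+\sigma)]}\le c\quad\text{for all } i>(m+1)\Delta.$$ -/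

import Mathlib

open MeasureTheory ProbabilityTheory Filter Topology Set
open scoped NNReal ENNReal

noncomputable section

namespace LoadBalancing

/-- A Poisson process of unit rate, indexed by `[0, ∞)`: a counting process with right-continuous
paths that starts at zero and has independent increments, the increment over `[s, t]` being
Poisson distributed with mean `t - s`. -/
structure IsUnitPoissonProcess {Ω : Type*} [MeasurableSpace Ω]
    (N : ℝ≥0 → Ω → ℕ) (P : Measure Ω) : Prop where
  measurable : ∀ t, Measurable (N t)
  zero : ∀ ω, N 0 ω = 0
  mono : ∀ ω, Monotone fun t => N t ω
  rightCts : ∀ ω t, ContinuousWithinAt (fun s => N s ω) (Ici t) t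
  indepIncrements : HasIndepIncrements N P
  law : ∀ s t : ℝ≥0, s ≤ t → HasLaw (fun ω => N t ω - N s ω) (poissonMeasure (t - s)) P

/-- The set `Q` of occupancy states; `q i` is the fraction of server pools with at least `i`
tasks. -/
def occupancyStates : Set (ℕ → ℝ) :=
  {q | q 0 = 1 ∧ ∀ i, q (i + 1) ≤ q i ∧ 0 ≤ q i ∧ q i ≤ 1}

/-- `f` is càdlàg on `[0, T]`: right-continuous on `[0, T)` with left limits on `(0, T]`. -/
def IsCadlagOn {E : Type*} [TopologicalSpace E] (T : ℝ) (f : ℝ → E) : Prop :=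
  (∀ t ∈ Ico 0 T, ContinuousWithinAt f (Ici t) t) ∧
    ∀ t ∈ Ioc 0 T, ∃ l, Tendsto f (𝓝[<] t) (𝓝 l)

/-- The interval `[1 - q i, 1 - q (i + 1))`, whose length is the fraction of server pools with
exactly `i` tasks. -/
def poolInterval (q : ℕ → ℝ) (i : ℕ) : Set ℝ :=
  Ico (1 - q i) (1 - q (i + 1))

/-- The interval `[(1 - q i) / (1 - q j), (1 - q (i + 1)) / (1 - q j))`, understood to be empty if
`q j = 1`. For `i < j` its length is the fraction of server pools with exactly `i` tasks among
those with fewer than `j` tasks. -/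
def poolIntervalBelow (q : ℕ → ℝ) (j i : ℕ) : Set ℝ :=
  {x | q j < 1 ∧ x ∈ Ico ((1 - q i) / (1 - q j)) ((1 - q (i + 1)) / (1 - q j))}

/-- The dispatching rule: in occupancy state `q` with threshold `ℓ`, an incoming task whose
selection variable is `x` is sent to a server pool with exactly `i` tasks if and only if
`x ∈ dispatchSet Δ q ℓ i`. -/
def dispatchSet (Δ : ℕ) (q : ℕ → ℝ) (ℓ i : ℕ) : Set ℝ :=
  if i < ℓ then poolIntervalBelow q ℓ i
  else if i < ℓ + Δ then {x | q ℓ = 1 ∧ x ∈ poolIntervalBelow q (ℓ + Δ) i}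
  else {x | q (ℓ + Δ) = 1 ∧ x ∈ poolInterval q i}

/-- The number of arrivals during `[0, t]` to the system with `n` server pools, obtained by
evaluating the path `N₀` at `n ∫₀ᵗ lam(s) ds`. -/
def arrivalCount (n : ℕ) (lam : ℝ → ℝ) (N₀ : ℝ≥0 → ℕ) (t : ℝ) : ℕ :=
  N₀ (Real.toNNReal (n * ∫ s in (0 : ℝ)..t, lam s))

/-- The time of the `k`-th arrival to the system with `n` server pools, for `k ≥ 1`. -/
def arrivalTime (n : ℕ) (lam : ℝ → ℝ) (N₀ : ℝ≥0 → ℕ) (k : ℕ) : ℝ :=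
  sInf {t : ℝ | 0 ≤ t ∧ k ≤ arrivalCount n lam N₀ t}

/-- Normalized number of tasks sent during `[0, t]` to a server pool that had exactly `i` tasks
right before the arrival. The `(k + 1)`-th arrival is dispatched with the selection variable
`U k`. -/
def arrivalProcess (n Δ : ℕ) (lam : ℝ → ℝ) (N₀ : ℝ≥0 → ℕ) (U : ℕ → ℝ)
    (q : ℝ → ℕ → ℝ) (ℓ : ℝ → ℕ) (t : ℝ) (i : ℕ) : ℝ :=
  (1 / (n : ℝ)) * ∑ k ∈ Finset.range (arrivalCount n lam N₀ t),
    (dispatchSet Δ (Function.leftLim q (arrivalTime n lam N₀ (k + 1)))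
      (Function.leftLim ℓ (arrivalTime n lam N₀ (k + 1))) i).indicator (fun _ => (1 : ℝ)) (U k)

/-- Normalized number of departures during `[0, t]` from server pools with exactly `i` tasks;
`Nᵢ` is the driving path of these departures. -/
def departureProcess (n : ℕ) (μ : ℝ) (Nᵢ : ℝ≥0 → ℕ) (q : ℝ → ℕ → ℝ) (t : ℝ) (i : ℕ) : ℝ :=
  (1 / (n : ℝ)) *
    (Nᵢ (Real.toNNReal (n * ∫ s in (0 : ℝ)..t, μ * i * (q s i - q s (i + 1)))) : ℝ)

/-- Net change of the threshold during `[0, t]`. At each arrival the threshold increases by `Δ` if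
right before the arrival at least `n - 1` server pools have at least `ℓ + Δ` tasks, and it
decreases by `Δ` if right before the arrival the fraction of server pools with at least `ℓ` tasks
is at most `α`. -/
def thresholdChange (n Δ : ℕ) (α : ℝ) (lam : ℝ → ℝ) (N₀ : ℝ≥0 → ℕ)
    (q : ℝ → ℕ → ℝ) (ℓ : ℝ → ℕ) (t : ℝ) : ℤ :=
  ∑ k ∈ Finset.range (arrivalCount n lam N₀ t),
    (Δ : ℤ) *
      ((if Function.leftLim q (arrivalTime n lam N₀ (k + 1))
            (Function.leftLim ℓ (arrivalTime n lam N₀ (k + 1)) + Δ) ≥ 1 - 1 / (n : ℝ)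
          then 1 else 0) -
        (if Function.leftLim q (arrivalTime n lam N₀ (k + 1))
            (Function.leftLim ℓ (arrivalTime n lam N₀ (k + 1))) ≤ α
          then 1 else 0))

/-- `(q, ℓ)` is a sample path on `[0, T]` of the occupancy state and the threshold of the system
with `n` server pools, driven by the counting paths `N 0` (arrivals) and `N i`, `i ≥ 1`
(departures from server pools with exactly `i` tasks), and by the selection variables `U`. -/
structure IsSamplePath (n Δ : ℕ) (μ α T : ℝ) (lam : ℝ → ℝ) (N : ℕ → ℝ≥0 → ℕ) (U : ℕ → ℝ)
    (q : ℝ → ℕ → ℝ) (ℓ : ℝ → ℕ) : Prop where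
  mem_states : ∀ t ∈ Icc 0 T, q t ∈ occupancyStates
  cadlag_occupancy : IsCadlagOn T q
  cadlag_threshold : IsCadlagOn T ℓ
  occupancy_eq : ∀ t ∈ Icc 0 T, ∀ i : ℕ,
    q t (i + 1) = q 0 (i + 1) + arrivalProcess n Δ lam (N 0) U q ℓ t i
      - departureProcess n μ (N (i + 1)) q t (i + 1)
  threshold_eq : ∀ t ∈ Icc 0 T,
    (ℓ t : ℤ) = (ℓ 0 : ℤ) + thresholdChange n Δ α lam (N 0) q ℓ t

/-- `u(t) = u(0) e^{-μ t} + ∫₀ᵗ ρ(s) μ e^{-μ (t - s)} ds`, where `u(0) = ∑_{i ≥ 1} q₀(i)` and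
`ρ = lam / μ`. -/
def totalMass (μ : ℝ) (lam : ℝ → ℝ) (q₀ : ℕ → ℝ) (t : ℝ) : ℝ :=
  (∑' i : ℕ, q₀ (i + 1)) * Real.exp (-μ * t) +
    ∫ s in (0 : ℝ)..t, lam s / μ * μ * Real.exp (-μ * (t - s))

/-- The infimum over `[a, b]` of the offered load `ρ = lam / μ`. -/
def rhoMin (μ : ℝ) (lam : ℝ → ℝ) (a b : ℝ) : ℝ := sInf ((fun t => lam t / μ) '' Icc a b)

/-- The supremum over `[a, b]` of the offered load `ρ = lam / μ`. -/
def rhoMax (μ : ℝ) (lam : ℝ → ℝ) (a b : ℝ) : ℝ := sSup ((fun t => lam t / μ) '' Icc a b)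

/-- The constant `σ(a, b, m, Δ)`. -/
def settlingTime (μ : ℝ) (lam : ℝ → ℝ) (q₀ : ℕ → ℝ) (a b : ℝ) (m Δ : ℕ) : ℝ :=
  if rhoMax μ lam a b < totalMass μ lam q₀ a then
    1 / μ * Real.log (rhoMin μ lam a b / (rhoMin μ lam a b - m * Δ)) +
      1 / μ * max (Real.log ((totalMass μ lam q₀ a - rhoMax μ lam a b) /
        ((m + 1) * Δ - rhoMax μ lam a b))) 0
  else 1 / μ * Real.log (rhoMin μ lam a b / (rhoMin μ lam a b - m * Δ))

/-- The offered load `ρ = lam / μ` is `(m, Δ)`-bounded on `[a, b] ⊆ [0, T]`. -/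
structure IsLoadBounded (T μ : ℝ) (lam : ℝ → ℝ) (q₀ : ℕ → ℝ) (m Δ : ℕ) (a b : ℝ) : Prop where
  nonneg_left : 0 ≤ a
  le : a ≤ b
  right_le : b ≤ T
  lt_rhoMin : (m : ℝ) * Δ < rhoMin μ lam a b
  rhoMax_lt : rhoMax μ lam a b < ((m : ℝ) + 1) * Δ
  settlingTime_lt : settlingTime μ lam q₀ a b m Δ < b - a

end LoadBalancing

end

/-! ### Law of large numbers with a rate, and unit jumps, for the driving Poisson paths -/

namespace LoadBalancing

/-! Probability enters only through the driving paths. Almost surely each `N i` satisfies `|N i (n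
x) / n - x| ≤ ε n ^ (-γ₀)` for large `n`, uniformly for `x` in compact sets
(`IsUnitPoissonProcess.ae_hasUniformRate`: Chernoff and Borel–Cantelli, which is where `γ₀ < 1/2`
matters), and `N 0` has jumps of size one, so that arrivals can be numbered. The rest is
deterministic, along a fixed outcome.

Upper bound. Each arrival adds at most one task and tasks leave at rate `μ` each, so the number of
tasks per pool is asymptotically at most `u` (`eventually_weightedMass_le`). Once `u` is below `(m +
1) Δ - ε₀`, Markov's inequality keeps the fraction of pools with `(m + 1) Δ` tasks below `1 - ε₁`. A
threshold above `m Δ` then drops at every arrival and never exceeds `m Δ` again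
(`thresholdAfter_le_of_capped`).

Lower bound. The threshold rises to a level `L ≤ m Δ` only if at least `n - 1` pools hold `L` tasks.
While it stays at `L`, every arrival that finds a pool below `L` goes below `L`; the inflow `lam ≥ μ
L` beats the outflow, at most `μ L`, so the occupancy of `L` stays above `1 - O(1/n + e)`, where `e`
is the Poisson error (`le_occupancy_of_full`). Since `1 - α n` is at least of order `n ^ (-γ₀)`,
this exceeds `α n` and the threshold cannot drop after its first rise: at most `m` rises occur
(`sum_increase_le`). If the threshold were never at `m Δ` with all pools holding `m Δ` tasks, every
arrival would land below `m Δ` or cause one of those rises, and the first `m Δ` levels would fill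
beyond capacity (`exists_full`). After such an arrival the threshold is locked
(`thresholdAfter_eq_of_full`).

Decay. With the threshold locked, nothing is sent to levels above `(m + 1) Δ`; their content starts
from at most about `u(a + σ)` and decays like `exp (-μ t)` (`weightedMass_le_exp_decay`). All rate
comparisons go through the single integral inequality `le_max_add_of_sub_le_integral`. -/

theorem hasSum_exp_mul_poisson (r : ℝ≥0) (θ : ℝ) :
    HasSum (fun n : ℕ => Real.exp (-r) * r ^ n / n.factorial * Real.exp (θ * n))
      (Real.exp (r * (Real.exp θ - 1))) := by
  have h := (NormedSpace.expSeries_div_hasSum_exp ((r : ℝ) * Real.exp θ)).mul_left (Real.exp (-r))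
  rw [← Real.exp_eq_exp_ℝ, ← Real.exp_add] at h
  convert! h using 1
  · funext n
    rw [mul_comm θ, Real.exp_nat_mul, mul_pow]
    ring
  · congr 1; ring

theorem integrable_exp_mul_poisson (r : ℝ≥0) (θ : ℝ) :
    Integrable (fun n : ℕ => Real.exp (θ * n)) (poissonMeasure r) := by
  rw [integrable_poissonMeasure_iff]
  simpa [abs_of_pos (Real.exp_pos _)] using (hasSum_exp_mul_poisson r θ).summable

theorem mgf_poissonMeasure (r : ℝ≥0) (θ : ℝ) :
    mgf (fun n : ℕ => (n : ℝ)) (poissonMeasure r) θ = Real.exp (r * (Real.exp θ - 1)) := by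
  rw [mgf, integral_poissonMeasure]
  exact (hasSum_exp_mul_poisson r θ).tsum_eq

/-- Chernoff bound for the deviations of a Poisson variable from its mean. -/
theorem poissonMeasure_deviation_le (r : ℝ≥0) (hr : 0 < r) (x : ℝ) (hx : 0 ≤ x) (hxr : x ≤ 2 * r) :
    (poissonMeasure r).real {n : ℕ | x ≤ |(n : ℝ) - r|} ≤ 2 * Real.exp (-(x ^ 2 / (4 * r))) := by
  have hr' : (0 : ℝ) < r := hr
  -- This `θ` minimises `-θ x + r θ ^ 2`, the Chernoff exponent after `exp s - 1 ≤ s + s ^ 2`. That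
  -- bound needs `|s| ≤ 1`, hence the hypothesis `x ≤ 2 r`.
  set θ : ℝ := x / (2 * r) with hθ
  have hθ0 : 0 ≤ θ := by positivity
  have hθ1 : θ ≤ 1 := by rw [hθ, div_le_one (by positivity)]; exact hxr
  have key : ∀ s : ℝ, |s| = θ → r * (Real.exp s - 1) ≤ r * (s + θ ^ 2) := by
    intro s hs
    have := Real.abs_exp_sub_one_sub_id_le (x := s) (by rw [hs]; exact hθ1)
    have h2 := (abs_le.1 this).2
    rw [← sq_abs s, hs] at h2
    gcongr
    linarith
  have hval : -θ * x + r * θ ^ 2 = -(x ^ 2 / (4 * r)) := by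
    rw [hθ]; field_simp; ring
  have h1 : (poissonMeasure r).real {n : ℕ | r + x ≤ (n : ℝ)} ≤ Real.exp (-(x ^ 2 / (4 * r))) := by
    refine (measure_ge_le_exp_mul_mgf (μ := poissonMeasure r) (X := fun n : ℕ => (n : ℝ)) (r + x) hθ0
      (integrable_exp_mul_poisson r θ)).trans ?_
    rw [mgf_poissonMeasure, ← Real.exp_add, ← hval]
    refine Real.exp_le_exp.2 ?_
    have := key θ (abs_of_nonneg hθ0)
    linarith
  have h2 : (poissonMeasure r).real {n : ℕ | (n : ℝ) ≤ r - x} ≤ Real.exp (-(x ^ 2 / (4 * r))) := by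
    refine (measure_le_le_exp_mul_mgf (μ := poissonMeasure r) (X := fun n : ℕ => (n : ℝ)) (r - x)
      (neg_nonpos.2 hθ0) (integrable_exp_mul_poisson r (-θ))).trans ?_
    rw [mgf_poissonMeasure, ← Real.exp_add, ← hval]
    refine Real.exp_le_exp.2 ?_
    have := key (-θ) (by rw [abs_neg, abs_of_nonneg hθ0])
    linarith
  calc (poissonMeasure r).real {n : ℕ | x ≤ |(n : ℝ) - r|}
      ≤ (poissonMeasure r).real ({n : ℕ | r + x ≤ (n : ℝ)} ∪ {n : ℕ | (n : ℝ) ≤ r - x}) := by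
        refine measureReal_mono ?_
        intro n hn
        rcases le_abs.1 (show x ≤ |(n : ℝ) - r| from hn) with h | h
        · left; simp only [mem_ofPred_eq]; linarith
        · right; simp only [mem_ofPred_eq]; linarith
    _ ≤ _ := (measureReal_union_le _ _).trans (by linarith)

theorem summable_exp_neg_rpow (c δ : ℝ) (hc : 0 < c) (hδ : 0 < δ) :
    Summable fun k : ℕ => Real.exp (-(c * (k : ℝ) ^ δ)) := by
  refine summable_of_isBigO_nat (Real.summable_one_div_nat_rpow.2 one_lt_two) ?_
  have h := (isLittleO_exp_neg_mul_rpow_atTop hc (-(2 / δ))).isBigO.comp_tendsto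
    ((tendsto_rpow_atTop hδ).comp tendsto_natCast_atTop_atTop)
  refine h.congr' (Eventually.of_forall fun k => ?_) (Eventually.of_forall fun k => ?_)
  · simp
  · simp only [Function.comp]
    rw [← Real.rpow_mul (Nat.cast_nonneg k), one_div, ← Real.rpow_neg (Nat.cast_nonneg k)]
    congr 1
    field_simp

variable {Ω : Type*} [MeasurableSpace Ω] {P : Measure Ω}

theorem IsUnitPoissonProcess.hasLaw [IsProbabilityMeasure P] {N : ℝ≥0 → Ω → ℕ}
    (hN : IsUnitPoissonProcess N P) (t : ℝ≥0) :
    HasLaw (N t) (poissonMeasure t) P := by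
  have h := hN.law 0 t (zero_le)
  simpa [hN.zero] using h

/-- Borel–Cantelli: the Chernoff bound at `x = k ^ (1 - γ)` has exponent `-k ^ (1 - 2γ) / 4`, which
is summable because `γ < 1/2`. -/
theorem IsUnitPoissonProcess.ae_eventually_deviation_lt [IsProbabilityMeasure P]
    {N : ℝ≥0 → Ω → ℕ} (hN : IsUnitPoissonProcess N P) (γ : ℝ) (hγ0 : 0 < γ) (hγ : γ < 1 / 2) :
    ∀ᵐ ω ∂P, ∀ᶠ k : ℕ in atTop, |(N k ω : ℝ) - k| < (k : ℝ) ^ (1 - γ) := by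
  have hbound : ∀ k : ℕ, 1 ≤ k → P.real {ω | (k : ℝ) ^ (1 - γ) ≤ |(N k ω : ℝ) - k|} ≤
      2 * Real.exp (-(1 / 4 * (k : ℝ) ^ (1 - 2 * γ))) := by
    intro k hk
    have hk0 : (0 : ℝ) < k := by exact_mod_cast hk
    have hk1 : (1 : ℝ) ≤ k := by exact_mod_cast hk
    have hle : (k : ℝ) ^ (1 - γ) ≤ 2 * ((k : ℝ≥0) : ℝ) := by
      have : (k : ℝ) ^ (1 - γ) ≤ (k : ℝ) ^ (1 : ℝ) :=
        Real.rpow_le_rpow_of_exponent_le hk1 (by linarith)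
      rw [Real.rpow_one] at this
      push_cast
      linarith
    have h := poissonMeasure_deviation_le (k : ℝ≥0) (by exact_mod_cast hk) ((k : ℝ) ^ (1 - γ))
      (by positivity) hle
    have hmeas := (hN.hasLaw (k : ℝ≥0)).measureReal_eq
      (p := fun n : ℕ => (k : ℝ) ^ (1 - γ) ≤ |(n : ℝ) - ((k : ℝ≥0) : ℝ)|) (MeasurableSet.of_discrete)
    have hexp : ((k : ℝ) ^ (1 - γ)) ^ 2 / (4 * ((k : ℝ≥0) : ℝ)) =
        1 / 4 * (k : ℝ) ^ (1 - 2 * γ) := by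
      rw [← Real.rpow_natCast, ← Real.rpow_mul hk0.le, NNReal.coe_natCast,
        show (1 - 2 * γ) = (1 - γ) * ((2 : ℕ) : ℝ) - 1 by push_cast; ring,
        Real.rpow_sub_one hk0.ne']
      ring
    rw [hexp] at h
    rw [← hmeas] at h
    simpa using h
  have hsum : Summable fun k : ℕ => P.real {ω | (k : ℝ) ^ (1 - γ) ≤ |(N k ω : ℝ) - k|} := by
    refine Summable.of_norm_bounded_eventually_nat
      ((summable_exp_neg_rpow (1 / 4) (1 - 2 * γ) (by norm_num) (by linarith)).mul_left 2) ?_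
    filter_upwards [eventually_ge_atTop 1] with k hk
    rw [Real.norm_of_nonneg measureReal_nonneg]
    exact hbound k hk
  have hfin : ∑' k : ℕ, P {ω | (k : ℝ) ^ (1 - γ) ≤ |(N k ω : ℝ) - k|} ≠ ⊤ := by
    have := hsum.tsum_ofReal_ne_top
    rwa [tsum_congr fun k => ofReal_measureReal (measure_ne_top P _)] at this
  filter_upwards [ae_eventually_notMem hfin] with ω hω
  filter_upwards [hω] with k hk
  simpa using hk

/-- A counting path obeys the law of large numbers with rate `γ₀`, uniformly on compact sets. -/
def HasUniformRate (γ₀ : ℝ) (N : ℝ≥0 → ℕ) : Prop :=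
  ∀ X ε : ℝ, 0 < ε → ∀ᶠ n : ℕ in atTop, ∀ x ∈ Icc 0 X,
    |(N (Real.toNNReal (n * x)) : ℝ) / n - x| ≤ ε * (n : ℝ) ^ (-γ₀)

/-- Monotonicity sandwiches `N y` between its values at neighbouring integers, and the finitely many
exceptional integers go into the constant `C`. The gap `γ₀ < γ` turns an error of order `n ^ (-γ)`
into `ε n ^ (-γ₀)` for every `ε`. -/
theorem hasUniformRate_of_eventually {N : ℝ≥0 → ℕ} (hmono : Monotone N) {γ₀ γ : ℝ}
    (hγ : γ₀ < γ) (hγ1 : γ < 1)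
    (h : ∀ᶠ k : ℕ in atTop, |(N k : ℝ) - k| < (k : ℝ) ^ (1 - γ)) : HasUniformRate γ₀ N := by
  obtain ⟨k₀, hk₀⟩ := eventually_atTop.1 h
  set C : ℝ := ∑ k ∈ Finset.range k₀, |(N k : ℝ) - k| with hC
  have hC0 : 0 ≤ C := Finset.sum_nonneg fun _ _ => abs_nonneg _
  have hint : ∀ k : ℕ, |(N k : ℝ) - k| ≤ C + (k : ℝ) ^ (1 - γ) := by
    intro k
    have hp : 0 ≤ (k : ℝ) ^ (1 - γ) := by positivity
    rcases lt_or_ge k k₀ with hk | hk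
    · have := Finset.single_le_sum (f := fun k : ℕ => |(N k : ℝ) - k|)
        (fun _ _ => abs_nonneg _) (Finset.mem_range.2 hk)
      linarith
    · linarith [hk₀ k hk]
  have hreal : ∀ y : ℝ, 0 ≤ y →
      |(N (Real.toNNReal y) : ℝ) - y| ≤ C + 1 + (y + 1) ^ (1 - γ) := by
    intro y hy
    have hfl := Nat.floor_le hy
    have hfl' := Nat.lt_floor_add_one y
    set k := ⌊y⌋₊
    have h1 : N k ≤ N (Real.toNNReal y) := hmono (by
      rw [← NNReal.coe_le_coe, Real.coe_toNNReal y hy]; simpa using hfl)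
    have h2 : N (Real.toNNReal y) ≤ N ((k + 1 : ℕ) : ℝ≥0) := hmono (by
      rw [← NNReal.coe_le_coe, Real.coe_toNNReal y hy]; push_cast; exact hfl'.le)
    have h1' : (N k : ℝ) ≤ N (Real.toNNReal y) := by exact_mod_cast h1
    have h2' : (N (Real.toNNReal y) : ℝ) ≤ N ((k + 1 : ℕ) : ℝ≥0) := by exact_mod_cast h2
    have e1 := abs_le.1 (hint k)
    have e2 := abs_le.1 (hint (k + 1))
    have p1 : (k : ℝ) ^ (1 - γ) ≤ (y + 1) ^ (1 - γ) :=
      Real.rpow_le_rpow (by positivity) (by linarith) (by linarith)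
    have p2 : ((k + 1 : ℕ) : ℝ) ^ (1 - γ) ≤ (y + 1) ^ (1 - γ) :=
      Real.rpow_le_rpow (by positivity) (by push_cast; linarith) (by linarith)
    rw [abs_le]
    push_cast at e2 h2' p2
    constructor <;> linarith [e1.1, e2.2]
  intro X ε hε
  rcases lt_or_ge X 0 with hX | hX
  · exact Eventually.of_forall fun n x hx => absurd (hx.1.trans hx.2) (not_le.2 hX)
  have t1 : Tendsto (fun n : ℕ => (C + 1) * (n : ℝ) ^ (-(1 - γ₀)) +
      (X + 1) ^ (1 - γ) * (n : ℝ) ^ (-(γ - γ₀))) atTop (𝓝 0) := by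
    have a1 := ((tendsto_rpow_neg_atTop (show 0 < 1 - γ₀ by linarith)).comp
      tendsto_natCast_atTop_atTop).const_mul (C + 1)
    have a2 := ((tendsto_rpow_neg_atTop (show 0 < γ - γ₀ by linarith)).comp
      tendsto_natCast_atTop_atTop).const_mul ((X + 1) ^ (1 - γ))
    simpa using a1.add a2
  filter_upwards [t1.eventually (gt_mem_nhds hε), eventually_ge_atTop 1] with n hn hn1 x hx
  have hn0 : (0 : ℝ) < n := by exact_mod_cast hn1
  have hn1' : (1 : ℝ) ≤ n := by exact_mod_cast hn1
  have hb := hreal (n * x) (mul_nonneg hn0.le hx.1)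
  have hpow : (n * x + 1) ^ (1 - γ) ≤ (n : ℝ) ^ (1 - γ) * (X + 1) ^ (1 - γ) := by
    rw [← Real.mul_rpow hn0.le (by linarith)]
    refine Real.rpow_le_rpow (by have := mul_nonneg hn0.le hx.1; linarith) ?_ (by linarith)
    nlinarith [hx.2]
  have heq : (N (Real.toNNReal (n * x)) : ℝ) / n - x = (N (Real.toNNReal (n * x)) - n * x) / n := by
    field_simp
  rw [heq, abs_div, abs_of_pos hn0, div_le_iff₀ hn0]
  refine hb.trans ?_
  have hprod : ε * (n : ℝ) ^ (-γ₀) * n = ε * (n : ℝ) ^ (1 - γ₀) := by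
    rw [mul_assoc, ← Real.rpow_add_one hn0.ne']; congr 2; ring
  rw [hprod]
  have hnn : 0 < (n : ℝ) ^ (1 - γ₀) := by positivity
  have hm := mul_le_mul_of_nonneg_right hn.le hnn.le
  have r1 : (n : ℝ) ^ (-(1 - γ₀)) * (n : ℝ) ^ (1 - γ₀) = 1 := by
    rw [← Real.rpow_add hn0]; simp
  have r2 : (n : ℝ) ^ (-(γ - γ₀)) * (n : ℝ) ^ (1 - γ₀) = (n : ℝ) ^ (1 - γ) := by
    rw [← Real.rpow_add hn0]; congr 1; ring
  rw [add_mul, mul_assoc, mul_assoc, r1, r2] at hm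
  linarith

theorem IsUnitPoissonProcess.ae_hasUniformRate [IsProbabilityMeasure P]
    {N : ℝ≥0 → Ω → ℕ} (hN : IsUnitPoissonProcess N P) {γ₀ : ℝ} (hγ₀ : γ₀ ∈ Ioo (0 : ℝ) (1 / 2)) :
    ∀ᵐ ω ∂P, HasUniformRate γ₀ fun t => N t ω := by
  obtain ⟨γ, h1, h2⟩ := exists_between hγ₀.2
  have h0 := hγ₀.1
  filter_upwards [hN.ae_eventually_deviation_lt γ (by linarith) h2] with ω hω
  exact hasUniformRate_of_eventually (hN.mono ω) h1 (by linarith) hω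

/-- A counting path has only jumps of size one. -/
def HasUnitJumps (N : ℝ≥0 → ℕ) : Prop :=
  ∀ x : ℝ≥0, 0 < x → ∃ y < x, N x ≤ N y + 1

theorem poissonMeasure_two_le (r : ℝ≥0) :
    (poissonMeasure r).real {n : ℕ | 2 ≤ n} ≤ (r : ℝ) ^ 2 := by
  have hc : {n : ℕ | 2 ≤ n} = ((({0, 1} : Finset ℕ) : Set ℕ))ᶜ := by
    ext n
    simp only [mem_ofPred_eq, mem_compl_iff, Finset.mem_coe, Finset.mem_insert,
      Finset.mem_singleton]
    omega
  rw [hc, probReal_compl_eq_one_sub (Finset.measurableSet _)]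
  rw [← sum_measureReal_singleton, Finset.sum_pair (by norm_num), poissonMeasure_real_singleton,
    poissonMeasure_real_singleton]
  have := Real.add_one_le_exp (-(r : ℝ))
  have hr : (0 : ℝ) ≤ r := r.2
  simp
  nlinarith

/-- A jump of size two in `(0, X]` forces an increment of at least two over one of the `X K` cells
of mesh `1 / K`. Each cell has probability at most `1 / K ^ 2`, so the union bound is `X / K → 0`.
Monotonicity of the outer measure suffices, so `bad` need not be measurable. -/
theorem IsUnitPoissonProcess.ae_hasUnitJumps [IsProbabilityMeasure P]
    {N : ℝ≥0 → Ω → ℕ} (hN : IsUnitPoissonProcess N P) :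
    ∀ᵐ ω ∂P, HasUnitJumps fun t => N t ω := by
  have key : ∀ X : ℕ, ∀ᵐ ω ∂P, ∀ x : ℝ≥0, 0 < x → x ≤ X → ∃ y < x, N x ω ≤ N y ω + 1 := by
    intro X
    set bad : Set Ω := {ω | ¬ ∀ x : ℝ≥0, 0 < x → x ≤ X → ∃ y < x, N x ω ≤ N y ω + 1} with hbad
    have hle : ∀ K : ℕ, 1 ≤ K → P.real bad ≤ X / K := by
      intro K hK
      have hK0 : (0 : ℝ≥0) < K := by exact_mod_cast hK
      have hK0' : (0 : ℝ) < K := by exact_mod_cast hK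
      have hsub : bad ⊆ ⋃ j ∈ Finset.range (X * K),
          {ω | 2 ≤ N ((j + 1 : ℕ) / (K : ℝ≥0)) ω - N ((j : ℕ) / (K : ℝ≥0)) ω} := by
        intro ω hω
        simp only [hbad, mem_ofPred_eq] at hω
        push Not at hω
        obtain ⟨x, hx0, hxX, hx⟩ := hω
        have hxK : 0 < x * K := mul_pos hx0 hK0
        -- The ceiling selects the cell with `j / K < x ≤ (j + 1) / K`.
        have hc : 0 < ⌈x * K⌉₊ := Nat.ceil_pos.2 hxK
        obtain ⟨j, hj⟩ := Nat.exists_eq_succ_of_ne_zero hc.ne'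
        have h1 : x ≤ (j + 1 : ℕ) / (K : ℝ≥0) := by
          rw [le_div_iff₀ hK0]
          have := Nat.le_ceil (x * (K : ℝ≥0))
          rwa [hj] at this
        have h2 : (j : ℕ) / (K : ℝ≥0) < x := by
          rw [div_lt_iff₀ hK0]
          exact Nat.lt_ceil.1 (by omega)
        have hjX : j < X * K := by
          have : ⌈x * (K : ℝ≥0)⌉₊ ≤ X * K := Nat.ceil_le.2 (by push_cast; gcongr)
          omega
        simp only [mem_iUnion, Finset.mem_range, mem_ofPred_eq]
        refine ⟨j, hjX, ?_⟩
        have := hx _ h2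
        have hm : N x ω ≤ N ((j + 1 : ℕ) / (K : ℝ≥0)) ω := hN.mono ω h1
        omega
      have hone : ∀ j : ℕ,
          P.real {ω | 2 ≤ N ((j + 1 : ℕ) / (K : ℝ≥0)) ω - N ((j : ℕ) / (K : ℝ≥0)) ω} ≤
            1 / (K : ℝ) ^ 2 := by
        intro j
        have hlaw := hN.law ((j : ℕ) / (K : ℝ≥0)) ((j + 1 : ℕ) / (K : ℝ≥0))
          (by gcongr; simp)
        have heq := hlaw.measureReal_eq (p := fun n : ℕ => 2 ≤ n) MeasurableSet.of_discrete
        rw [heq]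
        refine (poissonMeasure_two_le _).trans (le_of_eq ?_)
        have : ((j + 1 : ℕ) / (K : ℝ≥0)) - (j : ℕ) / (K : ℝ≥0) = 1 / K := by
          rw [← NNReal.sub_div]; simp
        rw [this]; simp
      calc P.real bad ≤ _ := measureReal_mono hsub (measure_ne_top _ _)
        _ ≤ ∑ j ∈ Finset.range (X * K), _ := measureReal_biUnion_finset_le _ _
        _ ≤ ∑ j ∈ Finset.range (X * K), 1 / (K : ℝ) ^ 2 := Finset.sum_le_sum fun j _ => hone j
        _ = X / K := by simp; field_simp
    have hz : P.real bad ≤ 0 := by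
      refine ge_of_tendsto (tendsto_const_div_atTop_nhds_zero_nat (X : ℝ)) ?_
      filter_upwards [eventually_ge_atTop 1] with K hK using hle K hK
    rw [ae_iff]
    exact (measureReal_eq_zero_iff (measure_ne_top _ _)).1 (le_antisymm hz measureReal_nonneg)
  filter_upwards [ae_all_iff.2 key] with ω hω x hx
  obtain ⟨X, hX⟩ := exists_nat_ge x
  exact hω X x hx hX

end LoadBalancing

/-! ### Comparison principle and the integral equation of the fluid mass -/

namespace LoadBalancing

/-- Comparison principle for integral inequalities with exponential decay. -/
theorem le_max_add_of_sub_le_integral {y : ℝ → ℝ} {s₀ s₁ κ δ : ℝ} (hκ : 0 ≤ κ) (hδ : 0 ≤ δ)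
    (hy : IntervalIntegrable y volume s₀ s₁)
    (h : ∀ s t, s₀ ≤ s → s ≤ t → t ≤ s₁ → y t - y s ≤ δ - κ * ∫ x in s..t, y x) :
    ∀ t ∈ Icc s₀ s₁, y t ≤ max (y s₀) 0 + δ := by
  intro t ht
  by_cases hyt : y t ≤ 0
  · exact hyt.trans (add_nonneg (le_max_right _ _) hδ)
  -- After the last time at which `y ≤ 0`, the integral of `y` is nonnegative, so from there `y` can
  -- only gain `δ`. If there is no such time, the same argument starts at `s₀`.
  set S : Set ℝ := {s | s ∈ Icc s₀ t ∧ y s ≤ 0} with hS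
  have hint : IntegrableOn y (uIcc s₀ t) := by
    rw [uIcc_of_le ht.1, integrableOn_Icc_iff_integrableOn_Ioc]
    exact (intervalIntegrable_iff_integrableOn_Ioc_of_le (ht.1.trans ht.2)).1 hy |>.mono_set
      (Ioc_subset_Ioc_right ht.2)
  rcases S.eq_empty_or_nonempty with hemp | hne
  · have hpos : 0 ≤ ∫ x in s₀..t, y x := by
      refine intervalIntegral.integral_nonneg ht.1 fun x hx => ?_
      by_contra hc
      exact (eq_empty_iff_forall_notMem.1 hemp x) ⟨hx, (not_le.1 hc).le⟩
    have := h s₀ t le_rfl ht.1 ht.2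
    have := mul_nonneg hκ hpos
    linarith [le_max_left (y s₀) 0]
  · have hbdd : BddAbove S := ⟨t, fun s hs => hs.1.2⟩
    -- `y` may jump, so the supremum need not belong to `S`; the inequality started at `v k` passes
    -- to the limit because the integral is continuous in its lower endpoint.
    obtain ⟨v, -, hv, hvS⟩ := exists_seq_tendsto_sSup hne hbdd
    set σ := sSup S
    have hσ : σ ∈ Icc s₀ t := ⟨(hvS 0).1.1.trans (le_csSup hbdd (hvS 0)),
      csSup_le hne fun s hs => hs.1.2⟩
    have hcont := intervalIntegral.continuousOn_primitive_interval_left hint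
    have hlim : Tendsto (fun k => ∫ x in v k..t, y x) atTop (𝓝 (∫ x in σ..t, y x)) := by
      have := hcont σ (by rw [uIcc_of_le ht.1]; exact hσ)
      refine this.tendsto.comp (tendsto_nhdsWithin_iff.2 ⟨hv, Eventually.of_forall fun k => ?_⟩)
      rw [uIcc_of_le ht.1]; exact (hvS k).1
    have hle : y t ≤ δ - κ * ∫ x in σ..t, y x := by
      refine ge_of_tendsto' (tendsto_const_nhds.sub (hlim.const_mul κ)) fun k => ?_
      have := h (v k) t (hvS k).1.1 (hvS k).1.2 ht.2
      linarith [(hvS k).2]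
    have hpos : 0 ≤ ∫ x in σ..t, y x := by
      rw [intervalIntegral.integral_of_le hσ.2]
      refine setIntegral_nonneg measurableSet_Ioc fun x hx => ?_
      by_contra hc
      exact absurd (le_csSup hbdd (show x ∈ S from
        ⟨⟨hσ.1.trans hx.1.le, hx.2⟩, (not_le.1 hc).le⟩)) (not_le.2 hx.1)
    have := mul_nonneg hκ hpos
    linarith [le_max_right (y s₀) 0]

/-- A right-continuous function that is bounded on `[0, T]` is integrable there. -/
theorem intervalIntegrable_of_rightCts {f : ℝ → ℝ} {T C : ℝ} (hT : 0 ≤ T)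
    (hf : ∀ t ∈ Ico 0 T, ContinuousWithinAt f (Ici t) t) (hC : ∀ t ∈ Icc 0 T, |f t| ≤ C) :
    IntervalIntegrable f volume 0 T := by
  rw [intervalIntegrable_iff_integrableOn_Ico_of_le hT]
  -- Measurability: `f` is the pointwise limit of step functions that sample it at grid points to
  -- the right of `x`, as right-continuity allows.
  have hlim : ∀ x ∈ Ico 0 T,
      Tendsto (fun k : ℕ => f ((⌊(k : ℝ) * x⌋₊ + 1 : ℕ) / (k : ℝ))) atTop (𝓝 (f x)) := by
    intro x hx
    refine (hf x hx).tendsto.comp (tendsto_nhdsWithin_iff.2 ⟨?_, ?_⟩)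
    · have h1 : Tendsto (fun k : ℕ => x + 1 / (k : ℝ)) atTop (𝓝 x) := by
        simpa using tendsto_const_nhds.add (tendsto_const_div_atTop_nhds_zero_nat (1 : ℝ))
      refine tendsto_of_tendsto_of_tendsto_of_le_of_le' tendsto_const_nhds h1 ?_ ?_
      · filter_upwards [eventually_ge_atTop 1] with k hk
        have hk0 : (0 : ℝ) < k := by exact_mod_cast hk
        rw [le_div_iff₀ hk0, mul_comm]
        push_cast
        exact (Nat.lt_floor_add_one _).le
      · filter_upwards [eventually_ge_atTop 1] with k hk
        have hk0 : (0 : ℝ) < k := by exact_mod_cast hk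
        rw [div_le_iff₀ hk0, add_mul, div_mul_cancel₀ _ hk0.ne']
        push_cast
        have := Nat.floor_le (mul_nonneg hk0.le hx.1)
        linarith
    · filter_upwards [eventually_ge_atTop 1] with k hk
      have hk0 : (0 : ℝ) < k := by exact_mod_cast hk
      rw [mem_Ici, le_div_iff₀ hk0, mul_comm]
      push_cast
      exact (Nat.lt_floor_add_one _).le
  have hmeas : AEStronglyMeasurable f (volume.restrict (Ico 0 T)) := by
    refine aestronglyMeasurable_of_tendsto_ae atTop
      (f := fun (k : ℕ) x => f ((⌊(k : ℝ) * x⌋₊ + 1 : ℕ) / (k : ℝ))) (fun k => ?_) ?_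
    · have h1 : Measurable fun x : ℝ => ⌊(k : ℝ) * x⌋₊ :=
        Nat.measurable_floor.comp (measurable_const_mul _)
      have h2 : Measurable fun j : ℕ => f ((j + 1 : ℕ) / (k : ℝ)) := measurable_of_countable _
      exact (h2.comp h1).aestronglyMeasurable
    · filter_upwards [ae_restrict_mem measurableSet_Ico] with x hx using hlim x hx
  refine Integrable.of_bound hmeas C ?_
  filter_upwards [ae_restrict_mem measurableSet_Ico] with x hx
  exact hC x ⟨hx.1, hx.2.le⟩

theorem totalMass_eq (μ : ℝ) (hμ : μ ≠ 0) (lam : ℝ → ℝ) (q₀ : ℕ → ℝ) (t : ℝ) :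
    totalMass μ lam q₀ t = Real.exp (-μ * t) *
      ((∑' i : ℕ, q₀ (i + 1)) + ∫ s in (0 : ℝ)..t, lam s * Real.exp (μ * s)) := by
  rw [totalMass, mul_add, mul_comm]
  congr 1
  rw [← intervalIntegral.integral_const_mul]
  refine intervalIntegral.integral_congr fun s _ => ?_
  rw [div_mul_cancel₀ _ hμ, show -μ * (t - s) = -μ * t + μ * s by ring, Real.exp_add]
  ring

theorem continuousOn_totalMass {μ T : ℝ} (hμ : μ ≠ 0) (hT : 0 ≤ T) {lam : ℝ → ℝ} (q₀ : ℕ → ℝ)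
    (hlam : IntervalIntegrable lam volume 0 T) : ContinuousOn (totalMass μ lam q₀) (Icc 0 T) := by
  have hg : IntervalIntegrable (fun s => lam s * Real.exp (μ * s)) volume 0 T :=
    hlam.mul_continuousOn (by fun_prop)
  have hc := intervalIntegral.continuousOn_primitive_interval' hg (a := 0) (by simp)
  rw [uIcc_of_le hT] at hc
  rw [funext (totalMass_eq μ hμ lam q₀)]
  exact ContinuousOn.mul (by fun_prop) (continuousOn_const.add hc)

/-- Integrated form of `u' = lam - μ u`. As `lam` is only integrable, `u` is written as a smooth
factor times an absolutely continuous one, and the product rule is applied almost everywhere. -/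
theorem totalMass_sub {μ T : ℝ} (hμ : μ ≠ 0) (hT : 0 ≤ T) {lam : ℝ → ℝ} (q₀ : ℕ → ℝ)
    (hlam : IntervalIntegrable lam volume 0 T) {s t : ℝ} (hs : 0 ≤ s) (hst : s ≤ t) (ht : t ≤ T) :
    totalMass μ lam q₀ t - totalMass μ lam q₀ s =
      (∫ x in s..t, lam x) - μ * ∫ x in s..t, totalMass μ lam q₀ x := by
  have hg : IntervalIntegrable (fun s => lam s * Real.exp (μ * s)) volume 0 T :=
    hlam.mul_continuousOn (by fun_prop)
  set G : ℝ → ℝ := fun t =>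
    (∑' i : ℕ, q₀ (i + 1)) + ∫ s in (0 : ℝ)..t, lam s * Real.exp (μ * s) with hG
  set E : ℝ → ℝ := fun t => Real.exp (-μ * t) with hE
  have hsub : uIcc s t ⊆ uIcc 0 T := by
    rw [uIcc_of_le hst, uIcc_of_le hT]; exact Icc_subset_Icc hs ht
  have hEac : AbsolutelyContinuousOnInterval E s t :=
    ContDiffOn.absolutelyContinuousOnInterval (ContDiff.contDiffOn (by fun_prop))
  have hGac : AbsolutelyContinuousOnInterval G s t := by
    have h1 : AbsolutelyContinuousOnInterval (fun _ : ℝ => ∑' i : ℕ, q₀ (i + 1)) s t :=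
      ContDiffOn.absolutelyContinuousOnInterval contDiffOn_const
    have h2 := (hg.absolutelyContinuousOnInterval_intervalIntegral (c := 0) (by simp)).mono hsub
    exact h1.add h2
  have key := hEac.integral_deriv_mul_eq_sub hGac
  have hder : ∀ᵐ x, x ∈ uIoc s t → deriv E x * G x + E x * deriv G x =
      lam x - μ * totalMass μ lam q₀ x := by
    filter_upwards [hg.ae_hasDerivAt_integral] with x hx hxs
    have hx' := hx (hsub (uIoc_subset_uIcc hxs)) 0 (by simp)
    have hdG : deriv G x = lam x * Real.exp (μ * x) := (hx'.const_add _).deriv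
    have hdE : deriv E x = Real.exp (-μ * x) * -μ := by
      have := ((hasDerivAt_id x).const_mul (-μ)).exp
      simpa [hE] using this.deriv
    rw [hdG, hdE, totalMass_eq μ hμ]
    have he : Real.exp (-μ * x) * Real.exp (μ * x) = 1 := by
      rw [← Real.exp_add]; simp
    simp only [hE, hG]
    linear_combination (lam x) * he
  rw [intervalIntegral.integral_congr_ae hder] at key
  have hu : IntervalIntegrable (totalMass μ lam q₀) volume s t :=
    ((continuousOn_totalMass hμ hT q₀ hlam).mono
      (by rw [uIcc_of_le hst]; exact Icc_subset_Icc hs ht)).intervalIntegrable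
  rw [intervalIntegral.integral_sub (hlam.mono_set hsub) (hu.const_mul μ),
    intervalIntegral.integral_const_mul] at key
  rw [key, totalMass_eq μ hμ, totalMass_eq μ hμ]

theorem totalMass_nonneg {μ T : ℝ} (hμ : 0 < μ) {lam : ℝ → ℝ} {q₀ : ℕ → ℝ}
    (hq₀ : q₀ ∈ occupancyStates) (hlam : ∀ t ∈ Icc 0 T, 0 ≤ lam t) {t : ℝ} (ht : t ∈ Icc 0 T) :
    0 ≤ totalMass μ lam q₀ t := by
  rw [totalMass_eq μ hμ.ne']
  refine mul_nonneg (Real.exp_pos _).le (add_nonneg (tsum_nonneg fun i => (hq₀.2 _).2.1) ?_)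
  exact intervalIntegral.integral_nonneg ht.1 fun x hx =>
    mul_nonneg (hlam x ⟨hx.1, hx.2.trans ht.2⟩) (Real.exp_pos _).le

/-- Solution of `x' = μ (r - x)` started from `r + d` at time `a`, in integrated form. -/
theorem relaxation_sub (μ r d a s t : ℝ) :
    (r + d * Real.exp (-μ * (t - a))) - (r + d * Real.exp (-μ * (s - a))) =
      μ * r * (t - s) - μ * ∫ x in s..t, (r + d * Real.exp (-μ * (x - a))) := by
  have h : ∀ x ∈ uIcc s t, HasDerivAt (fun x => r + d * Real.exp (-μ * (x - a)))
      (μ * r - μ * (r + d * Real.exp (-μ * (x - a)))) x := by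
    intro x _
    have h1 := (((hasDerivAt_id x).sub_const a).const_mul (-μ)).exp
    have h2 := (h1.const_mul d).const_add r
    convert! h2 using 1
    simp; ring
  have := intervalIntegral.integral_eq_sub_of_hasDerivAt h
    (Continuous.intervalIntegrable (by fun_prop) _ _)
  rw [intervalIntegral.integral_sub (by simp) (Continuous.intervalIntegrable (by fun_prop) _ _),
    intervalIntegral.integral_const, intervalIntegral.integral_const_mul, smul_eq_mul] at this
  linarith

end LoadBalancing

/-! ### The dispatching rule and sums over occupancy levels -/

noncomputable section

namespace LoadBalancing

/-- Occupancy state right before the arrival number `k + 1`. -/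
def preOccupancy (n : ℕ) (lam : ℝ → ℝ) (N₀ : ℝ≥0 → ℕ) (q : ℝ → ℕ → ℝ) (k : ℕ) : ℕ → ℝ :=
  Function.leftLim q (arrivalTime n lam N₀ (k + 1))

/-- Threshold right before the arrival number `k + 1`. -/
def preThreshold (n : ℕ) (lam : ℝ → ℝ) (N₀ : ℝ≥0 → ℕ) (ℓ : ℝ → ℕ) (k : ℕ) : ℕ :=
  Function.leftLim ℓ (arrivalTime n lam N₀ (k + 1))

/-- Direction in which an arrival moves the threshold. -/
def thresholdStep (n Δ : ℕ) (α : ℝ) (Q : ℕ → ℝ) (L : ℕ) : ℤ :=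
  (if Q (L + Δ) ≥ 1 - 1 / (n : ℝ) then 1 else 0) - (if Q L ≤ α then 1 else 0)

/-- Threshold after the first `k` arrivals. -/
def thresholdAfter (n Δ : ℕ) (α : ℝ) (lam : ℝ → ℝ) (N₀ : ℝ≥0 → ℕ) (q : ℝ → ℕ → ℝ) (ℓ : ℝ → ℕ)
    (k : ℕ) : ℤ :=
  ℓ 0 + ∑ j ∈ Finset.range k, (Δ : ℤ) *
    thresholdStep n Δ α (preOccupancy n lam N₀ q j) (preThreshold n lam N₀ ℓ j)

/-- Total weight of the levels to which a task with selection variable `x` is dispatched. -/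
def dispatchWeight (Δ : ℕ) (Q : ℕ → ℝ) (L : ℕ) (x : ℝ) (c : ℕ → ℝ) (K : ℕ) : ℝ :=
  ∑ i ∈ Finset.range K, c i * (dispatchSet Δ Q L i).indicator (fun _ => (1 : ℝ)) x

/-- Weighted sum of the first `K` positive coordinates of an occupancy state. -/
def weightedMass (c : ℕ → ℝ) (K : ℕ) (q : ℕ → ℝ) : ℝ :=
  ∑ i ∈ Finset.range K, c i * q (i + 1)

/-- A sample path driven by deterministic data with the regularity that holds almost surely. -/
structure RegularPath (n Δ : ℕ) (μ α T : ℝ) (lam : ℝ → ℝ) (N : ℕ → ℝ≥0 → ℕ) (U : ℕ → ℝ)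
    (q : ℝ → ℕ → ℝ) (ℓ : ℝ → ℕ) : Prop where
  path : IsSamplePath n Δ μ α T lam N U q ℓ
  one_le : 1 ≤ n
  μ_pos : 0 < μ
  T_nonneg : 0 ≤ T
  lam_int : IntervalIntegrable lam volume 0 T
  lam_nonneg : ∀ t ∈ Icc 0 T, 0 ≤ lam t
  zero : N 0 0 = 0
  mono : Monotone (N 0)
  rightCts : ∀ t, ContinuousWithinAt (N 0) (Ici t) t
  jumps : HasUnitJumps (N 0)
  selection_mem : ∀ k, U k ∈ Ico (0 : ℝ) 1

section States

variable {q : ℕ → ℝ}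

theorem occupancyStates_antitone (hq : q ∈ occupancyStates) : Antitone q :=
  antitone_nat_of_succ_le fun i => (hq.2 i).1

theorem occupancyStates_nonneg (hq : q ∈ occupancyStates) (i : ℕ) : 0 ≤ q i := (hq.2 i).2.1

theorem occupancyStates_le_one (hq : q ∈ occupancyStates) (i : ℕ) : q i ≤ 1 := (hq.2 i).2.2

/-- Ensures that left limits of the path, hence the states seen by arrivals, are again occupancy
states. -/
theorem isClosed_occupancyStates : IsClosed occupancyStates := by
  have h1 : IsClosed {q : ℕ → ℝ | q 0 = 1} := isClosed_eq (continuous_apply 0) continuous_const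
  have h2 : IsClosed {q : ℕ → ℝ | ∀ i, q (i + 1) ≤ q i ∧ 0 ≤ q i ∧ q i ≤ 1} := by
    have : {q : ℕ → ℝ | ∀ i, q (i + 1) ≤ q i ∧ 0 ≤ q i ∧ q i ≤ 1} =
        ⋂ i, {q : ℕ → ℝ | q (i + 1) ≤ q i ∧ 0 ≤ q i ∧ q i ≤ 1} := by
      ext q; simp
    rw [this]
    refine isClosed_iInter fun i => ?_
    exact (isClosed_le (continuous_apply (i + 1)) (continuous_apply i)).inter
      ((isClosed_le continuous_const (continuous_apply i)).inter
        (isClosed_le (continuous_apply i) continuous_const))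
  exact h1.inter h2

theorem sum_range_indicator_Ico {v : ℕ → ℝ} (hv : Monotone v) (K : ℕ) (x : ℝ) :
    ∑ i ∈ Finset.range K, (Ico (v i) (v (i + 1))).indicator (fun _ => (1 : ℝ)) x =
      (Ico (v 0) (v K)).indicator (fun _ => (1 : ℝ)) x := by
  induction K with
  | zero => simp
  | succ K ih =>
    rw [Finset.sum_range_succ, ih]
    have h0 : v 0 ≤ v K := hv (Nat.zero_le _)
    have h1 : v K ≤ v (K + 1) := hv (Nat.le_succ _)
    simp only [indicator, mem_Ico]
    split_ifs <;> first | (norm_num; done) | (exfalso; grind)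

/-- When fewer than all pools have at least `j` tasks, exactly one level below `j` is chosen. -/
theorem sum_indicator_poolIntervalBelow (hq : q ∈ occupancyStates) {j : ℕ} (hj : q j < 1) {x : ℝ}
    (hx : x ∈ Ico (0 : ℝ) 1) :
    ∑ i ∈ Finset.range j, (poolIntervalBelow q j i).indicator (fun _ => (1 : ℝ)) x = 1 := by
  have hpos : 0 < 1 - q j := by linarith
  have hv : Monotone fun i => (1 - q i) / (1 - q j) := fun i k hik => by
    have := occupancyStates_antitone hq hik
    dsimp only
    gcongr
  have h := sum_range_indicator_Ico hv j x
  simp only [hq.1, sub_self, zero_div, div_self hpos.ne'] at h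
  rw [indicator_of_mem hx] at h
  refine Eq.trans (Finset.sum_congr rfl fun i _ => ?_) h
  simp [poolIntervalBelow, hj, indicator]

/-- With constant weight `1`, `dispatchWeight` counts whether the task lands below level `K`. Here
the intervals for levels below `L` partition `[0, 1)`, while the other branches require `q L = 1` or
`q (L + Δ) = 1`. -/
theorem dispatchWeight_one_of_lt (hq : q ∈ occupancyStates) {Δ L K : ℕ} (hL : q L < 1) (hLK : L ≤ K)
    {x : ℝ} (hx : x ∈ Ico (0 : ℝ) 1) : dispatchWeight Δ q L x 1 K = 1 := by
  rw [dispatchWeight, ← Finset.sum_range_add_sum_Ico _ hLK]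
  have h2 : ∑ i ∈ Finset.Ico L K, (1 : ℕ → ℝ) i *
      (dispatchSet Δ q L i).indicator (fun _ => (1 : ℝ)) x = 0 := by
    refine Finset.sum_eq_zero fun i hi => ?_
    have hi' := (Finset.mem_Ico.1 hi).1
    have hnot : x ∉ dispatchSet Δ q L i := by
      have := occupancyStates_antitone hq (Nat.le_add_right L Δ)
      rw [dispatchSet, if_neg (by omega)]
      split_ifs
      · exact fun h => hL.ne h.1
      · exact fun h => (this.trans_lt hL).ne h.1
    rw [indicator_of_notMem hnot, mul_zero]
  rw [h2, add_zero]
  refine Eq.trans (Finset.sum_congr rfl fun i hi => ?_) (sum_indicator_poolIntervalBelow hq hL hx)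
  rw [dispatchSet, if_pos (Finset.mem_range.1 hi), Pi.one_apply, one_mul]

theorem dispatchWeight_one_of_eq (hq : q ∈ occupancyStates) {Δ L K : ℕ} (hL : q L = 1)
    (hLΔ : q (L + Δ) < 1) (hLK : L + Δ ≤ K)
    {x : ℝ} (hx : x ∈ Ico (0 : ℝ) 1) : dispatchWeight Δ q L x 1 K = 1 := by
  rw [dispatchWeight, ← Finset.sum_range_add_sum_Ico _ hLK]
  have h2 : ∑ i ∈ Finset.Ico (L + Δ) K, (1 : ℕ → ℝ) i *
      (dispatchSet Δ q L i).indicator (fun _ => (1 : ℝ)) x = 0 := by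
    refine Finset.sum_eq_zero fun i hi => ?_
    have hi' := (Finset.mem_Ico.1 hi).1
    have hnot : x ∉ dispatchSet Δ q L i := by
      rw [dispatchSet, if_neg (by omega), if_neg (by omega)]
      exact fun h => hLΔ.ne h.1
    rw [indicator_of_notMem hnot, mul_zero]
  rw [h2, add_zero]
  refine Eq.trans (Finset.sum_congr rfl fun i hi => ?_) (sum_indicator_poolIntervalBelow hq hLΔ hx)
  have hi' := Finset.mem_range.1 hi
  rw [Pi.one_apply, one_mul]
  -- Levels below `L` are empty of pools: the rule's own branch needs `q L < 1`, and the
  -- corresponding interval relative to `L + Δ` is degenerate. So the partition relative to `L + Δ`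
  -- describes the rule.
  by_cases hiL : i < L
  · have h1 : ∀ k ≤ L, q k = 1 := fun k hk =>
      le_antisymm (occupancyStates_le_one hq k) (hL ▸ occupancyStates_antitone hq hk)
    rw [dispatchSet, if_pos hiL, indicator_of_notMem (fun h => h.1.ne hL), indicator_of_notMem]
    rintro ⟨-, h⟩
    rw [h1 i hiL.le, h1 (i + 1) hiL] at h
    simp at h
  · rw [dispatchSet, if_neg hiL, if_pos hi']
    congr 1
    ext y
    simp [hL]

/-- Only an inequality holds: `K` may cut off the level chosen, and when all pools hold `L + Δ`
tasks the first `K` intervals cover only `[0, 1 - q K)`. -/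
theorem dispatchWeight_one_le (hq : q ∈ occupancyStates) {Δ L : ℕ} (K : ℕ)
    {x : ℝ} (hx : x ∈ Ico (0 : ℝ) 1) : dispatchWeight Δ q L x 1 K ≤ 1 := by
  have hmono : dispatchWeight Δ q L x 1 K ≤ dispatchWeight Δ q L x 1 (K + (L + Δ)) := by
    refine Finset.sum_le_sum_of_subset_of_nonneg
      (Finset.range_subset_range.2 (Nat.le_add_right _ _)) fun i _ _ => ?_
    exact mul_nonneg zero_le_one (indicator_nonneg (fun _ _ => zero_le_one) _)
  by_cases h1 : q L < 1
  · exact hmono.trans (dispatchWeight_one_of_lt hq h1 (by omega) hx).le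
  by_cases h2 : q (L + Δ) < 1
  · exact hmono.trans (dispatchWeight_one_of_eq hq
      (le_antisymm (occupancyStates_le_one hq _) (not_lt.1 h1)) h2 (by omega) hx).le
  have hv : Monotone fun i => 1 - q i := fun i k hik => by
    have := occupancyStates_antitone hq hik
    dsimp only
    linarith
  have h1' : q L = 1 := le_antisymm (occupancyStates_le_one hq _) (not_lt.1 h1)
  have h2' : q (L + Δ) = 1 := le_antisymm (occupancyStates_le_one hq _) (not_lt.1 h2)
  have hle : dispatchWeight Δ q L x 1 K ≤
      ∑ i ∈ Finset.range K, (Ico (1 - q i) (1 - q (i + 1))).indicator (fun _ => (1 : ℝ)) x := by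
    refine Finset.sum_le_sum fun i _ => ?_
    rw [Pi.one_apply, one_mul]
    refine indicator_le_indicator_of_subset ?_ (fun _ => zero_le_one) _
    intro y hy
    rw [dispatchSet] at hy
    split_ifs at hy
    · exact absurd h1' hy.1.ne
    · exact absurd h2' hy.2.1.ne
    · exact hy.2
  refine hle.trans ?_
  rw [sum_range_indicator_Ico hv]
  exact indicator_le_self' (fun _ _ => zero_le_one) _ |>.trans le_rfl

theorem dispatchWeight_le (hq : q ∈ occupancyStates) {Δ L : ℕ} (K : ℕ) {c : ℕ → ℝ}
    (hc : ∀ i, c i ≤ 1) {x : ℝ} (hx : x ∈ Ico (0 : ℝ) 1) : dispatchWeight Δ q L x c K ≤ 1 := by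
  refine le_trans (Finset.sum_le_sum fun i _ => ?_) (dispatchWeight_one_le hq (Δ := Δ) (L := L) K hx)
  exact mul_le_mul_of_nonneg_right (hc i) (indicator_nonneg (fun _ _ => zero_le_one) _)

theorem dispatchWeight_nonneg {Δ L K : ℕ} {c : ℕ → ℝ} (hc : ∀ i, 0 ≤ c i) (x : ℝ) :
    0 ≤ dispatchWeight Δ q L x c K :=
  Finset.sum_nonneg fun i _ => mul_nonneg (hc i) (indicator_nonneg (fun _ _ => zero_le_one) _)

/-- No task is dispatched to levels above `L + Δ` unless all pools have `L + Δ` tasks. -/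
theorem dispatchWeight_eq_zero {Δ L K : ℕ} (hLΔ : q (L + Δ) < 1)
    {c : ℕ → ℝ} (hc : ∀ i < L + Δ, c i = 0) (x : ℝ) : dispatchWeight Δ q L x c K = 0 := by
  refine Finset.sum_eq_zero fun i _ => ?_
  by_cases hi : i < L + Δ
  · rw [hc i hi, zero_mul]
  · have hnot : x ∉ dispatchSet Δ q L i := by
      rw [dispatchSet, if_neg (by omega), if_neg hi]
      exact fun h => hLΔ.ne h.1
    rw [indicator_of_notMem hnot, mul_zero]

/-- Summation by parts for the weighted total departure rate. -/
theorem sum_departure_rate (c : ℕ → ℝ) (K : ℕ) (q : ℕ → ℝ) :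
    ∑ i ∈ Finset.range K, c i * ((i + 1) * (q (i + 1) - q (i + 2))) =
      weightedMass c K q - ∑ i ∈ Finset.range K, (i + 1) * (c i - c (i + 1)) * q (i + 2)
        - K * c K * q (K + 1) := by
  unfold weightedMass
  induction K with
  | zero => simp
  | succ K ih =>
    rw [Finset.sum_range_succ, ih, Finset.sum_range_succ, Finset.sum_range_succ]
    push_cast
    ring

theorem sum_departure_rate_one_le (hq : q ∈ occupancyStates) (K : ℕ) :
    ∑ i ∈ Finset.range K, (1 : ℕ → ℝ) i * ((i + 1) * (q (i + 1) - q (i + 2))) ≤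
      weightedMass 1 K q := by
  rw [sum_departure_rate]
  have := mul_nonneg (Nat.cast_nonneg (α := ℝ) K) (occupancyStates_nonneg hq (K + 1))
  simp
  linarith

/-- Summation by parts leaves the decrements of `c`, scaled by `i + 1`, as the only loss; `c K = 0`
removes the boundary term `K q (K + 1)`, which need not be small. Thus slowly decreasing weights
lose mass at essentially the rate of the mass itself. -/
theorem le_sum_departure_rate (hq : q ∈ occupancyStates) {c : ℕ → ℝ} {K : ℕ} {ε M : ℝ}
    (hε : 0 ≤ ε) (hcK : c K = 0) (hc : ∀ i : ℕ, (i + 1) * (c i - c (i + 1)) ≤ ε)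
    (hM : weightedMass 1 (K + 1) q ≤ M) :
    weightedMass c K q - ε * M ≤
      ∑ i ∈ Finset.range K, c i * ((i + 1) * (q (i + 1) - q (i + 2))) := by
  rw [sum_departure_rate, hcK]
  have h1 : ∑ i ∈ Finset.range K, (i + 1) * (c i - c (i + 1)) * q (i + 2) ≤
      ∑ i ∈ Finset.range K, ε * q (i + 2) :=
    Finset.sum_le_sum fun i _ => mul_le_mul_of_nonneg_right (hc i) (occupancyStates_nonneg hq _)
  have h2 : ∑ i ∈ Finset.range K, ε * q (i + 2) ≤ ε * M := by
    rw [← Finset.mul_sum]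
    refine mul_le_mul_of_nonneg_left (le_trans ?_ hM) hε
    rw [weightedMass, Finset.sum_range_succ']
    have := occupancyStates_nonneg hq 1
    simp
    linarith
  simp
  linarith

theorem weightedMass_nonneg (hq : q ∈ occupancyStates) {c : ℕ → ℝ} (hc : ∀ i, 0 ≤ c i) (K : ℕ) :
    0 ≤ weightedMass c K q :=
  Finset.sum_nonneg fun i _ => mul_nonneg (hc i) (occupancyStates_nonneg hq _)

theorem weightedMass_one_le (hq : q ∈ occupancyStates) (K : ℕ) : weightedMass 1 K q ≤ K := by
  rw [weightedMass]
  refine (Finset.sum_le_sum (g := fun _ => (1 : ℝ)) fun i _ => ?_).trans (by simp)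
  simpa using occupancyStates_le_one hq (i + 1)

/-- Markov's inequality for the number of tasks in a pool. -/
theorem mul_le_weightedMass_one (hq : q ∈ occupancyStates) {j K : ℕ} (hj : j ≤ K) :
    j * q j ≤ weightedMass 1 K q := by
  have h1 : ∑ i ∈ Finset.range j, q j ≤ ∑ i ∈ Finset.range j, (1 : ℕ → ℝ) i * q (i + 1) :=
    Finset.sum_le_sum fun i hi => by
      rw [Pi.one_apply, one_mul]
      exact occupancyStates_antitone hq (Finset.mem_range.1 hi)
  have h2 : ∑ i ∈ Finset.range j, (1 : ℕ → ℝ) i * q (i + 1) ≤ weightedMass 1 K q :=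
    Finset.sum_le_sum_of_subset_of_nonneg (Finset.range_subset_range.2 hj) fun i _ _ => by
      simpa using occupancyStates_nonneg hq (i + 1)
  rw [Finset.sum_const, Finset.card_range, nsmul_eq_mul] at h1
  linarith

/-- Read backwards: if the first `K` levels are nearly full in total, then level `K` is nearly full.
The case `K = 0` uses `q 0 = 1`. -/
theorem weightedMass_one_le_sub (hq : q ∈ occupancyStates) (K : ℕ) :
    weightedMass 1 K q ≤ K - 1 + q K := by
  cases K with
  | zero => simp [weightedMass, hq.1]
  | succ K =>
    have := weightedMass_one_le hq K
    rw [weightedMass, Finset.sum_range_succ]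
    rw [weightedMass] at this
    push_cast
    simp only [Pi.one_apply, one_mul] at *
    linarith

theorem continuous_weightedMass (c : ℕ → ℝ) (K : ℕ) : Continuous (weightedMass c K) := by
  unfold weightedMass
  fun_prop

end States

/-! ### Arrival epochs and mass balance along a path -/

namespace RegularPath

variable {n Δ : ℕ} {μ α T : ℝ} {lam : ℝ → ℝ} {N : ℕ → ℝ≥0 → ℕ} {U : ℕ → ℝ}
  {q : ℝ → ℕ → ℝ} {ℓ : ℝ → ℕ}

theorem lam_intervalIntegrable (h : RegularPath n Δ μ α T lam N U q ℓ) {s t : ℝ} (hs : 0 ≤ s)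
    (hst : s ≤ t) (ht : t ≤ T) : IntervalIntegrable lam volume s t :=
  h.lam_int.mono_set (by
    rw [uIcc_of_le hst, uIcc_of_le h.T_nonneg]; exact Icc_subset_Icc hs ht)

theorem integral_lam_mono (h : RegularPath n Δ μ α T lam N U q ℓ) {s t : ℝ} (hs : 0 ≤ s)
    (hst : s ≤ t) (ht : t ≤ T) : ∫ x in (0 : ℝ)..s, lam x ≤ ∫ x in (0 : ℝ)..t, lam x := by
  rw [← intervalIntegral.integral_add_adjacent_intervals
    (h.lam_intervalIntegrable le_rfl hs (hst.trans ht)) (h.lam_intervalIntegrable hs hst ht)]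
  have : 0 ≤ ∫ x in s..t, lam x := intervalIntegral.integral_nonneg hst fun x hx =>
    h.lam_nonneg x ⟨hs.trans hx.1, hx.2.trans ht⟩
  linarith

theorem continuousOn_integral_lam (h : RegularPath n Δ μ α T lam N U q ℓ) :
    ContinuousOn (fun t => Real.toNNReal (n * ∫ x in (0 : ℝ)..t, lam x)) (Icc 0 T) := by
  have hc := intervalIntegral.continuousOn_primitive_interval' h.lam_int (a := 0) (by simp)
  rw [uIcc_of_le h.T_nonneg] at hc
  exact continuous_real_toNNReal.comp_continuousOn (continuousOn_const.mul hc)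

theorem count_mono (h : RegularPath n Δ μ α T lam N U q ℓ) {s t : ℝ} (hs : 0 ≤ s)
    (hst : s ≤ t) (ht : t ≤ T) : arrivalCount n lam (N 0) s ≤ arrivalCount n lam (N 0) t :=
  h.mono (Real.toNNReal_le_toNNReal
    (mul_le_mul_of_nonneg_left (h.integral_lam_mono hs hst ht) (Nat.cast_nonneg _)))

theorem count_zero (h : RegularPath n Δ μ α T lam N U q ℓ) : arrivalCount n lam (N 0) 0 = 0 := by
  simp [arrivalCount, h.zero]

theorem arrivalTime_le (_h : RegularPath n Δ μ α T lam N U q ℓ) {k : ℕ} {t : ℝ}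
    (ht : 0 ≤ t) (hk : k < arrivalCount n lam (N 0) t) : arrivalTime n lam (N 0) (k + 1) ≤ t :=
  csInf_le ⟨0, fun _ hs => hs.1⟩ ⟨ht, hk⟩

theorem arrivalTime_nonneg (_h : RegularPath n Δ μ α T lam N U q ℓ) (k : ℕ) :
    0 ≤ arrivalTime n lam (N 0) k :=
  Real.sInf_nonneg fun _ hs => hs.1

/-- The infimum defining the arrival time is attained: the count is right-continuous and integer
valued, hence constant immediately to the right of `τ`. At `τ = T` the claim is the hypothesis
itself. -/
theorem lt_count_arrivalTime (h : RegularPath n Δ μ α T lam N U q ℓ) {k : ℕ}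
    (hk : k < arrivalCount n lam (N 0) T) :
    k < arrivalCount n lam (N 0) (arrivalTime n lam (N 0) (k + 1)) := by
  set τ := arrivalTime n lam (N 0) (k + 1) with hτ
  have h0 : 0 ≤ τ := h.arrivalTime_nonneg _
  have hT : τ ≤ T := h.arrivalTime_le h.T_nonneg hk
  rcases hT.eq_or_lt with heq | hlt
  · rwa [heq]
  have hcont : ContinuousWithinAt (fun t => arrivalCount n lam (N 0) t) (Icc τ T) τ := by
    have h1 := (h.continuousOn_integral_lam τ ⟨h0, hT⟩).mono (Icc_subset_Icc_left h0)
    refine ContinuousWithinAt.comp (t := Ici (Real.toNNReal (n * ∫ x in (0 : ℝ)..τ, lam x)))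
      (h.rightCts _) h1 fun t ht => ?_
    exact Real.toNNReal_le_toNNReal (mul_le_mul_of_nonneg_left
      (h.integral_lam_mono h0 ht.1 ht.2) (Nat.cast_nonneg _))
  have hev : ∀ᶠ t in 𝓝[Icc τ T] τ, arrivalCount n lam (N 0) t = arrivalCount n lam (N 0) τ := by
    rwa [ContinuousWithinAt, nhds_discrete, tendsto_pure] at hcont
  obtain ⟨r, hr, hr2⟩ := Metric.eventually_nhds_iff.1 (eventually_nhdsWithin_iff.1 hev)
  have hne : {t : ℝ | 0 ≤ t ∧ k + 1 ≤ arrivalCount n lam (N 0) t}.Nonempty := ⟨T, h.T_nonneg, hk⟩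
  obtain ⟨t, ht, htlt⟩ := exists_lt_of_csInf_lt hne
    (show sInf _ < min (τ + r) T from lt_min (by
      change τ < τ + r
      linarith) hlt)
  have hτt : τ ≤ t := csInf_le ⟨0, fun _ hs => hs.1⟩ ht
  have := hr2 (y := t) (by
    rw [Real.dist_eq, abs_of_nonneg (by linarith)]
    linarith [htlt.trans_le (min_le_left _ _)]) ⟨hτt, (htlt.trans_le (min_le_right _ _)).le⟩
  rw [← this]
  exact ht.2

theorem arrivalTime_mem (h : RegularPath n Δ μ α T lam N U q ℓ) {k : ℕ}
    (hk : k < arrivalCount n lam (N 0) T) : arrivalTime n lam (N 0) (k + 1) ∈ Ioc 0 T := by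
  refine ⟨lt_of_le_of_ne (h.arrivalTime_nonneg _) fun h0 => ?_, h.arrivalTime_le h.T_nonneg hk⟩
  have := h.lt_count_arrivalTime hk
  rw [← h0, h.count_zero] at this
  omega

theorem lt_arrivalTime (h : RegularPath n Δ μ α T lam N U q ℓ) {k : ℕ}
    (hk : k < arrivalCount n lam (N 0) T) {s : ℝ} (hsT : s ≤ T)
    (hs : arrivalCount n lam (N 0) s ≤ k) : s < arrivalTime n lam (N 0) (k + 1) := by
  by_contra hc
  have := h.count_mono (h.arrivalTime_mem hk).1.le (not_lt.1 hc) hsT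
  have := h.lt_count_arrivalTime hk
  omega

/-- Unit jumps are essential here: they exclude simultaneous arrivals, so that exactly `k` arrivals
precede the arrival time number `k + 1`. -/
theorem eventually_count_eq (h : RegularPath n Δ μ α T lam N U q ℓ) {k : ℕ}
    (hk : k < arrivalCount n lam (N 0) T) :
    ∀ᶠ s in 𝓝[<] (arrivalTime n lam (N 0) (k + 1)), arrivalCount n lam (N 0) s = k := by
  set τ := arrivalTime n lam (N 0) (k + 1) with hτ
  have hτmem := h.arrivalTime_mem hk
  have hlt : k < arrivalCount n lam (N 0) τ := h.lt_count_arrivalTime hk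
  have hx : 0 < Real.toNNReal (n * ∫ x in (0 : ℝ)..τ, lam x) := by
    rw [pos_iff_ne_zero]
    intro h0
    rw [arrivalCount, h0, h.zero] at hlt
    omega
  obtain ⟨y, hy, hNy⟩ := h.jumps _ hx
  have hcont := (h.continuousOn_integral_lam τ ⟨hτmem.1.le, hτmem.2⟩)
  have hev := hcont.tendsto.eventually (lt_mem_nhds hy)
  rw [eventually_nhdsWithin_iff] at hev ⊢
  filter_upwards [hev, lt_mem_nhds hτmem.1] with s hs hs0 hsτ
  have hsτ' : s < τ := hsτ
  have h1 : y < Real.toNNReal (n * ∫ x in (0 : ℝ)..s, lam x) :=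
    hs ⟨hs0.le, (hsτ'.trans_le hτmem.2).le⟩
  have h2 : N 0 y ≤ arrivalCount n lam (N 0) s := h.mono h1.le
  have h3 : ¬ k < arrivalCount n lam (N 0) s := fun hc =>
    absurd (h.arrivalTime_le hs0.le hc) (not_le.2 hsτ')
  have h4 : arrivalCount n lam (N 0) τ ≤ N 0 y + 1 := hNy
  omega

theorem tendsto_preOccupancy (h : RegularPath n Δ μ α T lam N U q ℓ) {k : ℕ}
    (hk : k < arrivalCount n lam (N 0) T) :
    Tendsto q (𝓝[<] (arrivalTime n lam (N 0) (k + 1))) (𝓝 (preOccupancy n lam (N 0) q k)) :=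
  tendsto_leftLim_of_tendsto (h.path.cadlag_occupancy.2 _ (h.arrivalTime_mem hk))

theorem eventually_threshold_eq (h : RegularPath n Δ μ α T lam N U q ℓ) {k : ℕ}
    (hk : k < arrivalCount n lam (N 0) T) :
    ∀ᶠ s in 𝓝[<] (arrivalTime n lam (N 0) (k + 1)), ℓ s = preThreshold n lam (N 0) ℓ k := by
  have := tendsto_leftLim_of_tendsto (h.path.cadlag_threshold.2 _ (h.arrivalTime_mem hk))
  rw [nhds_discrete, tendsto_pure] at this
  exact this

theorem eventually_mem_Ico (h : RegularPath n Δ μ α T lam N U q ℓ) {k : ℕ}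
    (hk : k < arrivalCount n lam (N 0) T) {s₀ : ℝ} (hs₀T : s₀ ≤ T)
    (hs₀ : arrivalCount n lam (N 0) s₀ ≤ k) :
    ∀ᶠ s in 𝓝[<] (arrivalTime n lam (N 0) (k + 1)), s₀ ≤ s ∧ s < T := by
  have hmem := h.arrivalTime_mem hk
  filter_upwards [Ico_mem_nhdsLT (h.lt_arrivalTime hk hs₀T hs₀)] with s hs
  exact ⟨hs.1, hs.2.trans_le hmem.2⟩

theorem preOccupancy_mem (h : RegularPath n Δ μ α T lam N U q ℓ) {k : ℕ}
    (hk : k < arrivalCount n lam (N 0) T) : preOccupancy n lam (N 0) q k ∈ occupancyStates := by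
  refine isClosed_occupancyStates.mem_of_tendsto (h.tendsto_preOccupancy hk) ?_
  filter_upwards [h.eventually_mem_Ico hk h.T_nonneg (by rw [h.count_zero]; omega)] with s hs
  exact h.path.mem_states s ⟨hs.1, hs.2.le⟩

theorem threshold_eq (h : RegularPath n Δ μ α T lam N U q ℓ) {t : ℝ} (ht : t ∈ Icc 0 T) :
    (ℓ t : ℤ) = thresholdAfter n Δ α lam (N 0) q ℓ (arrivalCount n lam (N 0) t) :=
  h.path.threshold_eq t ht

/-- Just before an arrival there are times at which the threshold has reached its left limit and the
count is `k`. This reduces the threshold dynamics to a recursion indexed by arrivals. -/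
theorem preThreshold_eq (h : RegularPath n Δ μ α T lam N U q ℓ) {k : ℕ}
    (hk : k < arrivalCount n lam (N 0) T) :
    (preThreshold n lam (N 0) ℓ k : ℤ) = thresholdAfter n Δ α lam (N 0) q ℓ k := by
  obtain ⟨s, ⟨h1, h2⟩, h3⟩ := ((h.eventually_mem_Ico hk h.T_nonneg
    (by rw [h.count_zero]; omega)).and (h.eventually_threshold_eq hk) |>.and
      (h.eventually_count_eq hk)).exists
  rw [← h2, ← h3]
  exact h.threshold_eq ⟨h1.1, h1.2.le⟩

theorem _root_.LoadBalancing.thresholdAfter_succ (n Δ : ℕ) (α : ℝ) (lam : ℝ → ℝ) (N₀ : ℝ≥0 → ℕ)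
    (q : ℝ → ℕ → ℝ) (ℓ : ℝ → ℕ) (k : ℕ) :
    thresholdAfter n Δ α lam N₀ q ℓ (k + 1) = thresholdAfter n Δ α lam N₀ q ℓ k + Δ *
      thresholdStep n Δ α (preOccupancy n lam N₀ q k) (preThreshold n lam N₀ ℓ k) := by
  rw [thresholdAfter, Finset.sum_range_succ, thresholdAfter, add_assoc]

theorem intervalIntegrable_occupancy (h : RegularPath n Δ μ α T lam N U q ℓ) (i : ℕ) {s t : ℝ}
    (hs : 0 ≤ s) (hst : s ≤ t) (ht : t ≤ T) :
    IntervalIntegrable (fun x => q x i) volume s t := by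
  have h0 : IntervalIntegrable (fun x => q x i) volume 0 T := by
    refine intervalIntegrable_of_rightCts (C := 1) h.T_nonneg (fun x hx => ?_) fun x hx => ?_
    · exact (continuous_apply i).continuousAt.comp_continuousWithinAt
        (h.path.cadlag_occupancy.1 x hx)
    · have := h.path.mem_states x hx
      rw [abs_of_nonneg (occupancyStates_nonneg this i)]
      exact occupancyStates_le_one this i
  exact h0.mono_set (by rw [uIcc_of_le hst, uIcc_of_le h.T_nonneg]; exact Icc_subset_Icc hs ht)

theorem intervalIntegrable_weightedMass (h : RegularPath n Δ μ α T lam N U q ℓ) (c : ℕ → ℝ)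
    (K : ℕ) {s t : ℝ} (hs : 0 ≤ s) (hst : s ≤ t) (ht : t ≤ T) :
    IntervalIntegrable (fun x => weightedMass c K (q x)) volume s t := by
  unfold weightedMass
  have := IntervalIntegrable.sum (Finset.range K) (f := fun i x => c i * q x (i + 1))
    fun i _ => (h.intervalIntegrable_occupancy (i + 1) hs hst ht).const_mul (c i)
  convert! this using 1
  ext x; simp

theorem intervalIntegrable_rate (h : RegularPath n Δ μ α T lam N U q ℓ) (i : ℕ)
    {s t : ℝ} (hs : 0 ≤ s) (hst : s ≤ t) (ht : t ≤ T) :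
    IntervalIntegrable (fun x => μ * (i + 1) * (q x (i + 1) - q x (i + 2))) volume s t :=
  ((h.intervalIntegrable_occupancy (i + 1) hs hst ht).sub
    (h.intervalIntegrable_occupancy (i + 2) hs hst ht)).const_mul _

/-- The departure rate at a level below `K` is at most `μ K`, so the time change stays within the
window `[0, μ K T]` on which the driving path is controlled. -/
theorem abs_departures_sub_le (h : RegularPath n Δ μ α T lam N U q ℓ) {i K : ℕ} (hi : i < K)
    {e : ℝ} (he : ∀ x ∈ Icc 0 (μ * K * T),
      |(N (i + 1) (Real.toNNReal (n * x)) : ℝ) / n - x| ≤ e) {t : ℝ} (ht : t ∈ Icc 0 T) :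
    abs (departureProcess n μ (N (i + 1)) q t (i + 1) -
      ∫ x in (0 : ℝ)..t, μ * (i + 1) * (q x (i + 1) - q x (i + 2))) ≤ e := by
  have hb : ∀ x ∈ Icc 0 t, 0 ≤ μ * (i + 1) * (q x (i + 1) - q x (i + 2)) ∧
      μ * (i + 1) * (q x (i + 1) - q x (i + 2)) ≤ μ * K := by
    intro x hx
    have hq := h.path.mem_states x ⟨hx.1, hx.2.trans ht.2⟩
    have h1 := (hq.2 (i + 1)).1
    have h2 := occupancyStates_le_one hq (i + 1)
    have h3 := occupancyStates_nonneg hq (i + 2)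
    have hμi : 0 ≤ μ * (i + 1) := by have := h.μ_pos; positivity
    have hiK : (i : ℝ) + 1 ≤ K := by exact_mod_cast hi
    have hle : μ * (i + 1) ≤ μ * K := mul_le_mul_of_nonneg_left hiK h.μ_pos.le
    refine ⟨mul_nonneg hμi (sub_nonneg.2 h1), ?_⟩
    calc _ ≤ μ * (i + 1) * 1 := mul_le_mul_of_nonneg_left (by linarith) hμi
      _ ≤ _ := by linarith
  have hmem : ∫ x in (0 : ℝ)..t, μ * (i + 1) * (q x (i + 1) - q x (i + 2)) ∈
      Icc 0 (μ * K * T) := by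
    refine ⟨intervalIntegral.integral_nonneg ht.1 fun x hx => (hb x hx).1, ?_⟩
    have := intervalIntegral.integral_mono_on ht.1 (h.intervalIntegrable_rate i le_rfl ht.1 ht.2)
      (g := fun _ => μ * K) (by simp) fun x hx => (hb x hx).2
    rw [intervalIntegral.integral_const, smul_eq_mul, sub_zero] at this
    have hm : 0 ≤ μ * K := by have := h.μ_pos; positivity
    nlinarith [ht.2]
  have := he _ hmem
  rw [departureProcess]
  push_cast
  rwa [one_div, inv_mul_eq_div]

/-- Evolution of a weighted sum of occupancies, up to fluctuations of the departures. -/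
theorem weightedMass_increment (h : RegularPath n Δ μ α T lam N U q ℓ) {c : ℕ → ℝ} {K : ℕ} {e : ℝ}
    (hc : ∀ i, |c i| ≤ 1)
    (he : ∀ i < K, ∀ x ∈ Icc 0 (μ * K * T),
      |(N (i + 1) (Real.toNNReal (n * x)) : ℝ) / n - x| ≤ e)
    {s t : ℝ} (hs : 0 ≤ s) (hst : s ≤ t) (ht : t ≤ T) :
    |(weightedMass c K (q t) - weightedMass c K (q s)) -
      (∑ k ∈ Finset.Ico (arrivalCount n lam (N 0) s) (arrivalCount n lam (N 0) t),
        dispatchWeight Δ (preOccupancy n lam (N 0) q k) (preThreshold n lam (N 0) ℓ k) (U k) c K) / n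
      + μ * ∫ x in s..t, ∑ i ∈ Finset.range K, c i * ((i + 1) * (q x (i + 1) - q x (i + 2)))| ≤
      2 * K * e := by
  have hsT : s ∈ Icc 0 T := ⟨hs, hst.trans ht⟩
  have htT : t ∈ Icc 0 T := ⟨hs.trans hst, ht⟩
  set A : ℝ → ℕ → ℝ := fun r i => arrivalProcess n Δ lam (N 0) U q ℓ r i with hA
  set D : ℝ → ℕ → ℝ := fun r i => departureProcess n μ (N (i + 1)) q r (i + 1) with hD
  set R : ℝ → ℕ → ℝ := fun r i =>
    ∫ x in (0 : ℝ)..r, μ * (i + 1) * (q x (i + 1) - q x (i + 2)) with hR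
  have hF : weightedMass c K (q t) - weightedMass c K (q s) =
      ∑ i ∈ Finset.range K, c i * (A t i - A s i) - ∑ i ∈ Finset.range K, c i * (D t i - D s i) := by
    rw [weightedMass, weightedMass, ← Finset.sum_sub_distrib, ← Finset.sum_sub_distrib]
    refine Finset.sum_congr rfl fun i _ => ?_
    rw [h.path.occupancy_eq t htT i, h.path.occupancy_eq s hsT i]
    ring
  have hAsum : ∑ i ∈ Finset.range K, c i * (A t i - A s i) =
      (∑ k ∈ Finset.Ico (arrivalCount n lam (N 0) s) (arrivalCount n lam (N 0) t),
        dispatchWeight Δ (preOccupancy n lam (N 0) q k) (preThreshold n lam (N 0) ℓ k) (U k) c K) /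
          n := by
    simp only [dispatchWeight]
    rw [Finset.sum_comm, Finset.sum_div]
    refine Finset.sum_congr rfl fun i _ => ?_
    rw [← Finset.mul_sum, Finset.sum_Ico_eq_sub _ (h.count_mono hs hst ht)]
    simp only [hA, arrivalProcess, preOccupancy, preThreshold]
    ring
  have hRsum : μ * ∫ x in s..t, ∑ i ∈ Finset.range K, c i * ((i + 1) * (q x (i + 1) - q x (i + 2)))
      = ∑ i ∈ Finset.range K, c i * (R t i - R s i) := by
    rw [← intervalIntegral.integral_const_mul]
    have hi : ∀ i : ℕ, R t i - R s i = ∫ x in s..t, μ * (i + 1) * (q x (i + 1) - q x (i + 2)) :=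
      fun i => intervalIntegral.integral_interval_sub_left
        (h.intervalIntegrable_rate i le_rfl htT.1 ht)
        (h.intervalIntegrable_rate i le_rfl hs hsT.2)
    simp only [hi]
    simp only [← intervalIntegral.integral_const_mul]
    rw [← intervalIntegral.integral_finsetSum]
    · refine intervalIntegral.integral_congr fun x _ => ?_
      simp only [Finset.mul_sum]
      exact Finset.sum_congr rfl fun i _ => by ring
    · exact fun i _ => (h.intervalIntegrable_rate i hs hst ht).const_mul _
  rw [hF, hAsum, hRsum]
  have hrew : ∀ a b r : ℝ, a - b - a + r = -(b - r) := by intros; ring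
  rw [hrew, abs_neg, ← Finset.sum_sub_distrib]
  calc _ ≤ ∑ i ∈ Finset.range K, |c i * (D t i - D s i) - c i * (R t i - R s i)| :=
        Finset.abs_sum_le_sum_abs _ _
    _ ≤ ∑ i ∈ Finset.range K, 2 * e := by
        refine Finset.sum_le_sum fun i hi => ?_
        have hiK := Finset.mem_range.1 hi
        have h1 := h.abs_departures_sub_le hiK (he i hiK) htT
        have h2 := h.abs_departures_sub_le hiK (he i hiK) hsT
        have h3 : c i * (D t i - D s i) - c i * (R t i - R s i) =
            c i * ((D t i - R t i) - (D s i - R s i)) := by ring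
        rw [h3, abs_mul]
        have h4 : |(D t i - R t i) - (D s i - R s i)| ≤ 2 * e :=
          (abs_sub _ _).trans (by linarith)
        calc _ ≤ 1 * |(D t i - R t i) - (D s i - R s i)| :=
              mul_le_mul_of_nonneg_right (hc i) (abs_nonneg _)
          _ ≤ _ := by linarith
    _ = 2 * K * e := by simp; ring

end RegularPath

end LoadBalancing

end

/-! ### Growth bounds and an a priori bound on the threshold -/

noncomputable section

namespace LoadBalancing

/-- The first driving paths are uniformly `e`-close to their means on the relevant time scale. -/
def DriverClose (n : ℕ) (μ T : ℝ) (lam : ℝ → ℝ) (N : ℕ → ℝ≥0 → ℕ) (K : ℕ) (e : ℝ) : Prop :=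
  ∀ i ≤ K, ∀ x ∈ Icc 0 (max (∫ s in (0 : ℝ)..T, lam s) (μ * K * T)),
    |(N i (Real.toNNReal (n * x)) : ℝ) / n - x| ≤ e

theorem thresholdStep_le_one (n Δ : ℕ) (α : ℝ) (Q : ℕ → ℝ) (L : ℕ) :
    thresholdStep n Δ α Q L ≤ 1 := by
  unfold thresholdStep; split_ifs <;> norm_num

theorem le_of_thresholdStep_eq_one {n Δ : ℕ} {α : ℝ} {Q : ℕ → ℝ} {L : ℕ}
    (h : thresholdStep n Δ α Q L = 1) : 1 - 1 / (n : ℝ) ≤ Q (L + Δ) := by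
  unfold thresholdStep at h
  split_ifs at h with h1 <;> first | exact h1 | (exfalso; revert h; norm_num)

theorem thresholdStep_nonneg {n Δ : ℕ} {α : ℝ} {Q : ℕ → ℝ} {L : ℕ} (h : α < Q L) :
    0 ≤ thresholdStep n Δ α Q L := by
  unfold thresholdStep
  rw [if_neg (not_le.2 h)]
  split_ifs <;> norm_num

theorem thresholdStep_nonpos {n Δ : ℕ} {α : ℝ} {Q : ℕ → ℝ} {L : ℕ}
    (h : Q (L + Δ) < 1 - 1 / (n : ℝ)) : thresholdStep n Δ α Q L ≤ 0 := by
  unfold thresholdStep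
  rw [if_neg (not_le.2 h)]
  split_ifs <;> norm_num

theorem thresholdStep_eq_one {n Δ : ℕ} {α : ℝ} {Q : ℕ → ℝ} {L : ℕ}
    (h : 1 - 1 / (n : ℝ) ≤ Q (L + Δ)) (h' : α < Q L) : thresholdStep n Δ α Q L = 1 := by
  unfold thresholdStep
  rw [if_neg (not_le.2 h'), if_pos h]
  norm_num

namespace RegularPath

variable {n Δ : ℕ} {μ α T : ℝ} {lam : ℝ → ℝ} {N : ℕ → ℝ≥0 → ℕ} {U : ℕ → ℝ}
  {q : ℝ → ℕ → ℝ} {ℓ : ℝ → ℕ}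

theorem driverClose_mono (h : RegularPath n Δ μ α T lam N U q ℓ) {K K' : ℕ} (hK : K' ≤ K) {e : ℝ}
    (he : DriverClose n μ T lam N K e) : DriverClose n μ T lam N K' e := by
  intro i hi x hx
  refine he i (hi.trans hK) x ⟨hx.1, hx.2.trans (max_le_max le_rfl ?_)⟩
  have hK' : (K' : ℝ) ≤ K := by exact_mod_cast hK
  have := h.μ_pos
  have := h.T_nonneg
  gcongr

theorem driverClose_nonneg (h : RegularPath n Δ μ α T lam N U q ℓ) {K : ℕ} {e : ℝ}
    (he : DriverClose n μ T lam N K e) : 0 ≤ e := by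
  have := h.μ_pos
  have := h.T_nonneg
  exact (abs_nonneg _).trans (he 0 (Nat.zero_le _) 0 ⟨le_rfl, le_max_of_le_right (by positivity)⟩)

theorem abs_weightedMass_increment_le (h : RegularPath n Δ μ α T lam N U q ℓ) {c : ℕ → ℝ} {K : ℕ}
    {e : ℝ} (hc : ∀ i, |c i| ≤ 1) (he : DriverClose n μ T lam N K e)
    {s t : ℝ} (hs : 0 ≤ s) (hst : s ≤ t) (ht : t ≤ T) :
    |(weightedMass c K (q t) - weightedMass c K (q s)) -
      (∑ k ∈ Finset.Ico (arrivalCount n lam (N 0) s) (arrivalCount n lam (N 0) t),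
        dispatchWeight Δ (preOccupancy n lam (N 0) q k) (preThreshold n lam (N 0) ℓ k) (U k) c K) / n
      + μ * ∫ x in s..t, ∑ i ∈ Finset.range K, c i * ((i + 1) * (q x (i + 1) - q x (i + 2)))| ≤
      2 * K * e :=
  h.weightedMass_increment hc
    (fun i hi x hx => he (i + 1) hi x ⟨hx.1, hx.2.trans (le_max_right _ _)⟩) hs hst ht

theorem intervalIntegrable_sum_rate (h : RegularPath n Δ μ α T lam N U q ℓ) (c : ℕ → ℝ)
    (K : ℕ) {s t : ℝ} (hs : 0 ≤ s) (hst : s ≤ t) (ht : t ≤ T) :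
    IntervalIntegrable (fun x => ∑ i ∈ Finset.range K,
      c i * ((i + 1) * (q x (i + 1) - q x (i + 2)))) volume s t := by
  have := IntervalIntegrable.sum (Finset.range K)
    (f := fun (i : ℕ) x => c i * ((i + 1) * (q x (i + 1) - q x (i + 2))))
    fun i _ => (((h.intervalIntegrable_occupancy (i + 1) hs hst ht).sub
      (h.intervalIntegrable_occupancy (i + 2) hs hst ht)).const_mul _).const_mul (c i)
  convert! this using 1
  ext x; simp

/-- Upper bound for the growth of a weighted mass. -/
theorem weightedMass_sub_le (h : RegularPath n Δ μ α T lam N U q ℓ) {c : ℕ → ℝ} {K : ℕ}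
    {e ε M : ℝ} (hc0 : ∀ i, 0 ≤ c i) (hc1 : ∀ i, c i ≤ 1) (hcK : c K = 0) (hε : 0 ≤ ε)
    (hcε : ∀ i : ℕ, (i + 1) * (c i - c (i + 1)) ≤ ε)
    (hM : ∀ t ∈ Icc 0 T, weightedMass 1 (K + 1) (q t) ≤ M)
    (he : DriverClose n μ T lam N K e)
    {s t : ℝ} (hs : 0 ≤ s) (hst : s ≤ t) (ht : t ≤ T) :
    weightedMass c K (q t) - weightedMass c K (q s) ≤
      (∑ k ∈ Finset.Ico (arrivalCount n lam (N 0) s) (arrivalCount n lam (N 0) t),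
        dispatchWeight Δ (preOccupancy n lam (N 0) q k) (preThreshold n lam (N 0) ℓ k) (U k) c K) / n
      + 2 * K * e + μ * (ε * M) * T - μ * ∫ x in s..t, weightedMass c K (q x) := by
  have h1 := (abs_le.1 (h.abs_weightedMass_increment_le
    (fun i => abs_le.2 ⟨by linarith [hc0 i], hc1 i⟩) he hs hst ht)).2
  have h2 := intervalIntegral.integral_mono_on hst
    ((h.intervalIntegrable_weightedMass c K hs hst ht).sub
      (intervalIntegrable_const (c := ε * M)))
    (h.intervalIntegrable_sum_rate c K hs hst ht) fun x hx => by
      have hx' : x ∈ Icc 0 T := ⟨hs.trans hx.1, hx.2.trans ht⟩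
      exact le_sum_departure_rate (h.path.mem_states x hx') hε hcK hcε (hM x hx')
  rw [intervalIntegral.integral_sub (h.intervalIntegrable_weightedMass c K hs hst ht)
    intervalIntegrable_const, intervalIntegral.integral_const, smul_eq_mul] at h2
  have h3 := mul_le_mul_of_nonneg_left h2 h.μ_pos.le
  have hM0 : 0 ≤ M := (weightedMass_nonneg (h.path.mem_states s ⟨hs, hst.trans ht⟩)
    (fun _ => zero_le_one) _).trans (hM s ⟨hs, hst.trans ht⟩)
  have h4 : μ * ((t - s) * (ε * M)) ≤ μ * (ε * M) * T := by
    have : (t - s) * (μ * (ε * M)) ≤ T * (μ * (ε * M)) :=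
      mul_le_mul_of_nonneg_right (by linarith)
        (mul_nonneg h.μ_pos.le (mul_nonneg hε hM0))
    linarith
  linarith

/-- Lower bound for the growth of the number of tasks in the first `K` levels. -/
theorem le_weightedMass_one_sub (h : RegularPath n Δ μ α T lam N U q ℓ) {K : ℕ} {e : ℝ}
    (he : DriverClose n μ T lam N K e) {s t : ℝ} (hs : 0 ≤ s) (hst : s ≤ t) (ht : t ≤ T) :
    (∑ k ∈ Finset.Ico (arrivalCount n lam (N 0) s) (arrivalCount n lam (N 0) t),
        dispatchWeight Δ (preOccupancy n lam (N 0) q k) (preThreshold n lam (N 0) ℓ k) (U k) 1 K) / n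
      - 2 * K * e - μ * ∫ x in s..t, weightedMass 1 K (q x) ≤
      weightedMass 1 K (q t) - weightedMass 1 K (q s) := by
  have h1 := (abs_le.1 (h.abs_weightedMass_increment_le (c := 1) (by simp) he hs hst ht)).1
  have h2 := intervalIntegral.integral_mono_on hst
    (h.intervalIntegrable_sum_rate 1 K hs hst ht)
    (h.intervalIntegrable_weightedMass 1 K hs hst ht) fun x hx =>
      sum_departure_rate_one_le (h.path.mem_states x ⟨hs.trans hx.1, hx.2.trans ht⟩) K
  have h3 := mul_le_mul_of_nonneg_left h2 h.μ_pos.le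
  linarith

theorem abs_count_sub_le (h : RegularPath n Δ μ α T lam N U q ℓ) {K : ℕ} {e : ℝ}
    (he : DriverClose n μ T lam N K e) {s t : ℝ} (hs : 0 ≤ s) (hst : s ≤ t) (ht : t ≤ T) :
    |((arrivalCount n lam (N 0) t : ℝ) - arrivalCount n lam (N 0) s) / n - ∫ x in s..t, lam x| ≤
      2 * e := by
  have hb : ∀ r ∈ Icc 0 T, |(arrivalCount n lam (N 0) r : ℝ) / n - ∫ x in (0 : ℝ)..r, lam x| ≤ e :=
    fun r hr => he 0 (Nat.zero_le _) _
      ⟨intervalIntegral.integral_nonneg hr.1 fun x hx => h.lam_nonneg x ⟨hx.1, hx.2.trans hr.2⟩,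
        (h.integral_lam_mono hr.1 hr.2 le_rfl).trans (le_max_left _ _)⟩
  have h1 := hb t ⟨hs.trans hst, ht⟩
  have h2 := hb s ⟨hs, hst.trans ht⟩
  rw [← intervalIntegral.integral_interval_sub_left
    (h.lam_intervalIntegrable le_rfl (hs.trans hst) ht)
    (h.lam_intervalIntegrable le_rfl hs (hst.trans ht)), sub_div]
  rw [abs_le] at *
  constructor <;> linarith [h1.1, h1.2, h2.1, h2.2]

/-- The total number of tasks is bounded by the initial tasks plus the arrivals. -/
theorem weightedMass_one_le_add (h : RegularPath n Δ μ α T lam N U q ℓ) {B : ℕ}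
    (hB : q 0 (B + 1) = 0) (K : ℕ) {t : ℝ} (ht : t ∈ Icc 0 T) :
    weightedMass 1 K (q t) ≤ B + (arrivalCount n lam (N 0) t : ℝ) / n := by
  have hn : (0 : ℝ) < n := by exact_mod_cast h.one_le
  have h0T : (0 : ℝ) ∈ Icc 0 T := ⟨le_rfl, h.T_nonneg⟩
  have hq0 := h.path.mem_states 0 h0T
  have hinit : weightedMass 1 K (q 0) ≤ B := by
    have hz : ∀ i ∈ Finset.Ico B (B + K), (1 : ℕ → ℝ) i * q 0 (i + 1) = 0 := fun i hi => by
      have h1 := occupancyStates_antitone hq0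
        (show B + 1 ≤ i + 1 by have := (Finset.mem_Ico.1 hi).1; omega)
      have h2 := occupancyStates_nonneg hq0 (i + 1)
      rw [hB] at h1
      rw [le_antisymm h1 h2, mul_zero]
    calc weightedMass 1 K (q 0) ≤ weightedMass 1 (B + K) (q 0) :=
          Finset.sum_le_sum_of_subset_of_nonneg (Finset.range_subset_range.2 (by omega))
            fun i _ _ => by simpa using occupancyStates_nonneg hq0 (i + 1)
      _ = weightedMass 1 B (q 0) := by
          rw [weightedMass, ← Finset.sum_range_add_sum_Ico _ (Nat.le_add_right B K),
            Finset.sum_eq_zero hz, add_zero, weightedMass]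
      _ ≤ B := weightedMass_one_le hq0 B
  have harr : ∑ i ∈ Finset.range K, arrivalProcess n Δ lam (N 0) U q ℓ t i =
      (∑ k ∈ Finset.range (arrivalCount n lam (N 0) t), dispatchWeight Δ
        (preOccupancy n lam (N 0) q k) (preThreshold n lam (N 0) ℓ k) (U k) 1 K) / n := by
    simp only [dispatchWeight]
    rw [Finset.sum_comm, Finset.sum_div]
    refine Finset.sum_congr rfl fun i _ => ?_
    rw [← Finset.mul_sum]
    simp only [arrivalProcess, preOccupancy, preThreshold, Pi.one_apply]
    ring
  have hle : weightedMass 1 K (q t) ≤ weightedMass 1 K (q 0) +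
      ∑ i ∈ Finset.range K, arrivalProcess n Δ lam (N 0) U q ℓ t i := by
    rw [weightedMass, weightedMass, ← Finset.sum_add_distrib]
    refine Finset.sum_le_sum fun i _ => ?_
    rw [h.path.occupancy_eq t ht i]
    have : 0 ≤ departureProcess n μ (N (i + 1)) q t (i + 1) := by
      unfold departureProcess; positivity
    simp only [Pi.one_apply, one_mul]
    linarith
  rw [harr] at hle
  have hsum : ∑ k ∈ Finset.range (arrivalCount n lam (N 0) t), dispatchWeight Δ
        (preOccupancy n lam (N 0) q k) (preThreshold n lam (N 0) ℓ k) (U k) 1 K ≤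
        arrivalCount n lam (N 0) t := by
    refine (Finset.sum_le_sum (g := fun _ => (1 : ℝ)) fun k hk => ?_).trans (by simp)
    exact dispatchWeight_one_le (h.preOccupancy_mem ((Finset.mem_range.1 hk).trans_le
      (h.count_mono ht.1 ht.2 le_rfl))) K (h.selection_mem k)
  have := div_le_div_of_nonneg_right hsum hn.le
  linarith

/-- The bound does not depend on `n` or `K`; the final `1` absorbs the arrival fluctuation `2 e`. -/
theorem weightedMass_one_le_const (h : RegularPath n Δ μ α T lam N U q ℓ) {B : ℕ}
    (hB : q 0 (B + 1) = 0) {K' : ℕ} {e : ℝ} (he : DriverClose n μ T lam N K' e) (he1 : e ≤ 1 / 2)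
    (K : ℕ) {t : ℝ} (ht : t ∈ Icc 0 T) :
    weightedMass 1 K (q t) ≤ B + (∫ x in (0 : ℝ)..T, lam x) + 1 := by
  have h1 := h.weightedMass_one_le_add hB K ht
  have h2 := (abs_le.1 (h.abs_count_sub_le he le_rfl ht.1 ht.2)).2
  rw [h.count_zero] at h2
  have h3 := h.integral_lam_mono ht.1 ht.2 le_rfl
  norm_num at h2
  linarith

/-- Transfers closed conditions known along the path to the states seen by arrivals. -/
theorem preOccupancy_mem_of_isClosed (h : RegularPath n Δ μ α T lam N U q ℓ) {A : Set (ℕ → ℝ)}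
    (hA : IsClosed A) {s₀ t₁ : ℝ} (hs₀ : 0 ≤ s₀) (ht₁ : t₁ ≤ T) (hst : s₀ ≤ t₁)
    (hq : ∀ t ∈ Icc s₀ t₁, q t ∈ A) {k : ℕ} (hk : arrivalCount n lam (N 0) s₀ ≤ k)
    (hk' : k < arrivalCount n lam (N 0) t₁) : preOccupancy n lam (N 0) q k ∈ A := by
  have hkT := hk'.trans_le (h.count_mono (hs₀.trans hst) ht₁ le_rfl)
  refine hA.mem_of_tendsto (h.tendsto_preOccupancy hkT) ?_
  have hτ : arrivalTime n lam (N 0) (k + 1) ≤ t₁ := h.arrivalTime_le (hs₀.trans hst) hk'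
  filter_upwards [Ico_mem_nhdsLT (h.lt_arrivalTime hkT (hst.trans ht₁) hk)] with s hs
  exact hq s ⟨hs.1, (hs.2.trans_le hτ).le⟩

theorem dvd_thresholdAfter (_h : RegularPath n Δ μ α T lam N U q ℓ) (hd : Δ ∣ ℓ 0) (k : ℕ) :
    (Δ : ℤ) ∣ thresholdAfter n Δ α lam (N 0) q ℓ k :=
  dvd_add (Int.natCast_dvd_natCast.2 hd) (Finset.dvd_sum fun _ _ => dvd_mul_right _ _)

/-- The threshold is bounded in terms of the total number of tasks. -/
theorem thresholdAfter_le (h : RegularPath n Δ μ α T lam N U q ℓ) (hn : 2 ≤ n) {M : ℝ} {L₀ : ℕ}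
    (hℓ : ℓ 0 ≤ L₀) (hM : ∀ K, ∀ t ∈ Icc 0 T, weightedMass 1 K (q t) ≤ M) (hML : 2 * M ≤ L₀) :
    ∀ k ≤ arrivalCount n lam (N 0) T, thresholdAfter n Δ α lam (N 0) q ℓ k ≤ L₀ := by
  intro k
  induction k with
  | zero => intro _; simpa [thresholdAfter] using hℓ
  | succ k ih =>
    intro hk
    have hprev := ih (by omega)
    rw [thresholdAfter_succ]
    have hL := h.preThreshold_eq (k := k) hk
    set Q := preOccupancy n lam (N 0) q k
    set L := preThreshold n lam (N 0) ℓ k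
    rcases (thresholdStep_le_one n Δ α Q L).eq_or_lt with h1 | h1
    -- A rise to `L + Δ` requires occupancy at least `1 - 1/n ≥ 1/2` there, so Markov's inequality
    -- gives `L + Δ ≤ 2 M ≤ L₀`.
    · have hQ := le_of_thresholdStep_eq_one h1
      have hQm : Q ∈ occupancyStates := h.preOccupancy_mem hk
      have hMQ : weightedMass 1 (L + Δ) Q ≤ M :=
        h.preOccupancy_mem_of_isClosed (A := {p | weightedMass 1 (L + Δ) p ≤ M})
          (isClosed_le (continuous_weightedMass _ _) continuous_const) le_rfl le_rfl h.T_nonneg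
          (fun t ht => hM _ t ht) (by rw [h.count_zero]; omega) hk
      have hle := mul_le_weightedMass_one hQm (le_refl (L + Δ))
      have hn2 : 1 / (n : ℝ) ≤ 1 / 2 :=
        one_div_le_one_div_of_le (by norm_num) (by exact_mod_cast hn)
      have hhalf : (1 : ℝ) / 2 ≤ Q (L + Δ) := by linarith
      have hm := mul_le_mul_of_nonneg_left hhalf (Nat.cast_nonneg (α := ℝ) (L + Δ))
      have hfin : ((L + Δ : ℕ) : ℝ) ≤ L₀ := by linarith
      have hfin' : L + Δ ≤ L₀ := by exact_mod_cast hfin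
      rw [h1, ← hL]
      omega
    · have : (Δ : ℤ) * thresholdStep n Δ α Q L ≤ 0 :=
        mul_nonpos_of_nonneg_of_nonpos (Int.natCast_nonneg _) (by omega)
      omega

/-! ### Descent of the threshold to `m Δ` -/

section Capped

variable {m k₁ k₂ : ℕ} {ε₁ : ℝ}

/-- Once the pools cannot all have `(m + 1) Δ` tasks, the threshold does not exceed `m Δ` anew. -/
theorem thresholdAfter_succ_le (h : RegularPath n Δ μ α T lam N U q ℓ) (hΔ : 1 ≤ Δ)
    (hd : Δ ∣ ℓ 0) (hk₂ : k₂ ≤ arrivalCount n lam (N 0) T)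
    (hcap : ∀ k, k₁ ≤ k → k < k₂ → preOccupancy n lam (N 0) q k ((m + 1) * Δ) ≤ 1 - ε₁)
    (hε₁ : 1 / (n : ℝ) < ε₁) {k : ℕ} (hk1 : k₁ ≤ k) (hk2 : k < k₂)
    (hle : thresholdAfter n Δ α lam (N 0) q ℓ k ≤ m * Δ) :
    thresholdAfter n Δ α lam (N 0) q ℓ (k + 1) ≤ m * Δ := by
  rw [thresholdAfter_succ]
  have hL := h.preThreshold_eq (hk2.trans_le hk₂)
  set Q := preOccupancy n lam (N 0) q k with hQ
  set L := preThreshold n lam (N 0) ℓ k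
  have hstep := thresholdStep_le_one n Δ α Q L
  obtain ⟨j, hj⟩ := h.dvd_thresholdAfter hd k
  have hΔ0 : (0 : ℤ) < Δ := by exact_mod_cast hΔ
  -- The threshold is a multiple of `Δ`: at `m Δ` the cap forbids a rise, and from below one step
  -- reaches at most `m Δ`.
  rcases hle.eq_or_lt with heq | hlt
  · have hLm : L = m * Δ := by
      have : (L : ℤ) = m * Δ := hL.trans heq
      exact_mod_cast this
    have h0 : thresholdStep n Δ α Q L ≤ 0 := by
      refine thresholdStep_nonpos ?_
      have := hcap k hk1 hk2
      rw [show L + Δ = (m + 1) * Δ by rw [hLm]; ring]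
      linarith
    rw [heq]
    have := mul_nonpos_of_nonneg_of_nonpos hΔ0.le h0
    linarith
  · rw [hj] at hlt ⊢
    have hjm : j < m := by
      by_contra hc
      have := mul_le_mul_of_nonneg_left (not_lt.1 hc) hΔ0.le
      linarith
    have h1 : (Δ : ℤ) * (j + thresholdStep n Δ α Q L) ≤ Δ * m :=
      mul_le_mul_of_nonneg_left (by omega) hΔ0.le
    linarith

/-- By divisibility a threshold above `m Δ` is at least `(m + 1) Δ`, where the occupancy is at most
`1 - ε₁ ≤ α`. So the rule for a decrease applies, and the one for an increase does not. -/
theorem thresholdAfter_succ_of_lt (h : RegularPath n Δ μ α T lam N U q ℓ) (hΔ : 1 ≤ Δ)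
    (hd : Δ ∣ ℓ 0) (hk₂ : k₂ ≤ arrivalCount n lam (N 0) T)
    (hcap : ∀ k, k₁ ≤ k → k < k₂ → preOccupancy n lam (N 0) q k ((m + 1) * Δ) ≤ 1 - ε₁)
    (hε₁ : 1 / (n : ℝ) < ε₁) (hα : 1 - ε₁ ≤ α) {k : ℕ} (hk1 : k₁ ≤ k) (hk2 : k < k₂)
    (hlt : (m * Δ : ℤ) < thresholdAfter n Δ α lam (N 0) q ℓ k) :
    thresholdAfter n Δ α lam (N 0) q ℓ (k + 1) = thresholdAfter n Δ α lam (N 0) q ℓ k - Δ := by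
  rw [thresholdAfter_succ]
  have hL := h.preThreshold_eq (hk2.trans_le hk₂)
  have hQm := h.preOccupancy_mem (hk2.trans_le hk₂)
  have hcapk := hcap k hk1 hk2
  set Q := preOccupancy n lam (N 0) q k with hQ
  set L := preThreshold n lam (N 0) ℓ k
  obtain ⟨j, hj⟩ := h.dvd_thresholdAfter hd k
  have hΔ0 : (0 : ℤ) < Δ := by exact_mod_cast hΔ
  have hLm : (m + 1) * Δ ≤ L := by
    have h1 : (m : ℤ) < j := by
      by_contra hc
      have := mul_le_mul_of_nonneg_left (not_lt.1 hc) hΔ0.le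
      linarith
    have h2 : (Δ : ℤ) * (m + 1) ≤ Δ * j := mul_le_mul_of_nonneg_left (by omega) hΔ0.le
    have h3 : ((m + 1) * Δ : ℤ) ≤ L := by rw [hL, hj]; linarith
    exact_mod_cast h3
  have hQL : Q L ≤ α := (occupancyStates_antitone hQm hLm).trans (hcapk.trans hα)
  have hQL' : ¬ Q (L + Δ) ≥ 1 - 1 / (n : ℝ) := by
    have := occupancyStates_antitone hQm (hLm.trans (Nat.le_add_right L Δ))
    intro hc
    linarith
  rw [thresholdStep, if_neg hQL', if_pos hQL]
  ring

/-- Above `m Δ` every arrival lowers the threshold by at least one, so `L₀` arrivals suffice to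
bring it down from at most `L₀`. -/
theorem thresholdAfter_le_of_capped (h : RegularPath n Δ μ α T lam N U q ℓ) (hΔ : 1 ≤ Δ)
    (hd : Δ ∣ ℓ 0) (hk₂ : k₂ ≤ arrivalCount n lam (N 0) T)
    (hcap : ∀ k, k₁ ≤ k → k < k₂ → preOccupancy n lam (N 0) q k ((m + 1) * Δ) ≤ 1 - ε₁)
    (hε₁ : 1 / (n : ℝ) < ε₁) (hα : 1 - ε₁ ≤ α) {L₀ : ℕ}
    (hL₀ : ∀ k ≤ k₂, thresholdAfter n Δ α lam (N 0) q ℓ k ≤ L₀) {k : ℕ} (hk : k₁ + L₀ ≤ k)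
    (hk' : k ≤ k₂) : thresholdAfter n Δ α lam (N 0) q ℓ k ≤ m * Δ := by
  have key : ∀ j, k₁ + j ≤ k₂ → thresholdAfter n Δ α lam (N 0) q ℓ (k₁ + j) ≤ m * Δ ∨
      thresholdAfter n Δ α lam (N 0) q ℓ (k₁ + j) ≤ L₀ - j := by
    intro j
    induction j with
    | zero => intro hj; right; simpa using hL₀ k₁ hj
    | succ j ih =>
      intro hj
      by_cases hle : thresholdAfter n Δ α lam (N 0) q ℓ (k₁ + j) ≤ m * Δ
      · left
        exact h.thresholdAfter_succ_le hΔ hd hk₂ hcap hε₁ (Nat.le_add_right _ _) hj hle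
      · right
        have h1 := (ih (by omega)).resolve_left hle
        have h2 := h.thresholdAfter_succ_of_lt hΔ hd hk₂ hcap hε₁ hα (Nat.le_add_right _ _) hj
          (not_le.1 hle)
        rw [← add_assoc, h2]
        push_cast
        omega
  obtain ⟨j, rfl⟩ := Nat.exists_eq_add_of_le (show k₁ ≤ k by omega)
  rcases key j hk' with h1 | h1
  · exact h1
  · refine h1.trans ?_
    have h2 : (0 : ℤ) ≤ m * Δ := by positivity
    omega

end Capped

end RegularPath

end LoadBalancing

end

/-! ### Filling the first `m Δ` levels and locking the threshold -/

noncomputable section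

namespace LoadBalancing

namespace RegularPath

variable {n Δ : ℕ} {μ α T : ℝ} {lam : ℝ → ℝ} {N : ℕ → ℝ≥0 → ℕ} {U : ℕ → ℝ}
  {q : ℝ → ℕ → ℝ} {ℓ : ℝ → ℕ}

theorem mul_le_integral_lam (h : RegularPath n Δ μ α T lam N U q ℓ) {t₂ b r : ℝ} (ht₂ : 0 ≤ t₂)
    (hb : b ≤ T) (hlam : ∀ x ∈ Icc t₂ b, μ * r ≤ lam x) {s t : ℝ} (hs : t₂ ≤ s) (hst : s ≤ t)
    (ht : t ≤ b) : μ * r * (t - s) ≤ ∫ x in s..t, lam x := by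
  have := intervalIntegral.integral_mono_on hst (f := fun _ => μ * r) (by simp)
    (h.lam_intervalIntegrable (ht₂.trans hs) hst (ht.trans hb))
    fun x hx => hlam x ⟨hs.trans hx.1, hx.2.trans ht⟩
  rw [intervalIntegral.integral_const, smul_eq_mul] at this
  linarith

/-- As long as the threshold stays at `L` and the load exceeds `L`, almost all pools keep at least
`L` tasks once this has been the case. -/
theorem le_occupancy_of_full (h : RegularPath n Δ μ α T lam N U q ℓ) {K L : ℕ} {e : ℝ} (hL : L ≤ K)
    (he : DriverClose n μ T lam N K e) {t₂ b r : ℝ} (ht₂ : 0 ≤ t₂)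
    (hb : b ≤ T) (hlam : ∀ x ∈ Icc t₂ b, μ * r ≤ lam x) (hr : L ≤ r) {j : ℕ}
    (hj : arrivalCount n lam (N 0) t₂ ≤ j) {t : ℝ} (ht : t ∈ Icc t₂ b)
    (hjt : j < arrivalCount n lam (N 0) t)
    (hfull : 1 - 1 / (n : ℝ) ≤ preOccupancy n lam (N 0) q j L)
    (hpre : ∀ i, j < i → i < arrivalCount n lam (N 0) t → preThreshold n lam (N 0) ℓ i = L) :
    1 - (K + 1) * (1 / n + 2 * e) ≤ q t L := by
  have hn : (0 : ℝ) < n := by exact_mod_cast h.one_le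
  have he0 := h.driverClose_nonneg he
  have htT : t ≤ T := ht.2.trans hb
  have ht0 : 0 ≤ t := ht₂.trans ht.1
  -- Restart from the last arrival `j'` that saw level `L` full up to `1 / n`. Every later arrival
  -- sees a pool below `L` and is sent below `L`.
  obtain ⟨j', hjj', hj't, hfull', hlast⟩ : ∃ j', j ≤ j' ∧ j' < arrivalCount n lam (N 0) t ∧
      1 - 1 / (n : ℝ) ≤ preOccupancy n lam (N 0) q j' L ∧
      ∀ i, j' < i → i < arrivalCount n lam (N 0) t → preOccupancy n lam (N 0) q i L < 1 := by
    set S := (Finset.range (arrivalCount n lam (N 0) t)).filter fun i =>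
      j ≤ i ∧ 1 - 1 / (n : ℝ) ≤ preOccupancy n lam (N 0) q i L
    have hne : S.Nonempty := ⟨j, Finset.mem_filter.2 ⟨Finset.mem_range.2 hjt, le_rfl, hfull⟩⟩
    obtain ⟨h1, h2, h3⟩ := Finset.mem_filter.1 (S.max'_mem hne)
    refine ⟨S.max' hne, h2, Finset.mem_range.1 h1, h3, fun i hi hit => ?_⟩
    by_contra hc
    have hpos : 0 < 1 / (n : ℝ) := by positivity
    have : i ∈ S := Finset.mem_filter.2 ⟨Finset.mem_range.2 hit, by omega, by linarith⟩
    exact absurd (S.le_max' i this) (not_le.2 hi)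
  have hj'T := hj't.trans_le (h.count_mono ht0 htT le_rfl)
  -- Arrival `j'` itself may land elsewhere (for `j' = j` the threshold may still differ from `L`),
  -- which costs one task, that is `1 / n`.
  have hsum : ((arrivalCount n lam (N 0) t : ℝ) - j' - 1) ≤
      ∑ k ∈ Finset.Ico j' (arrivalCount n lam (N 0) t),
        dispatchWeight Δ (preOccupancy n lam (N 0) q k) (preThreshold n lam (N 0) ℓ k) (U k) 1 L := by
    rw [Finset.sum_eq_sum_Ico_succ_bot hj't]
    have h0 : 0 ≤ dispatchWeight Δ (preOccupancy n lam (N 0) q j')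
        (preThreshold n lam (N 0) ℓ j') (U j') 1 L := dispatchWeight_nonneg (fun _ => zero_le_one) _
    have h1 : ∑ k ∈ Finset.Ico (j' + 1) (arrivalCount n lam (N 0) t),
        dispatchWeight Δ (preOccupancy n lam (N 0) q k) (preThreshold n lam (N 0) ℓ k) (U k) 1 L =
        ∑ k ∈ Finset.Ico (j' + 1) (arrivalCount n lam (N 0) t), 1 := by
      refine Finset.sum_congr rfl fun k hk => ?_
      obtain ⟨hk1, hk2⟩ := Finset.mem_Ico.1 hk
      rw [hpre k (by omega) hk2]
      exact dispatchWeight_one_of_lt (h.preOccupancy_mem (hk2.trans_le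
        (h.count_mono ht0 htT le_rfl))) (hlast k hk1 hk2) le_rfl (h.selection_mem k)
    rw [h1, Finset.sum_const, Nat.card_Ico, nsmul_eq_mul, mul_one, Nat.cast_sub hj't]
    push_cast
    linarith
  have hmass : L * (1 - 1 / (n : ℝ)) - 1 / n - 2 * (L + 1) * e ≤ weightedMass 1 L (q t) := by
    have hlim : Tendsto (fun s => weightedMass 1 L (q s) - 1 / n - 2 * (L + 1) * e)
        (𝓝[<] (arrivalTime n lam (N 0) (j' + 1)))
        (𝓝 (weightedMass 1 L (preOccupancy n lam (N 0) q j') - 1 / n - 2 * (L + 1) * e)) :=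
      ((((continuous_weightedMass 1 L).tendsto _).comp
        (h.tendsto_preOccupancy hj'T)).sub_const _).sub_const _
    have hle : weightedMass 1 L (preOccupancy n lam (N 0) q j') - 1 / n - 2 * (L + 1) * e ≤
        weightedMass 1 L (q t) := by
      refine le_of_tendsto hlim ?_
      have hτ := h.arrivalTime_le ht0 hj't
      filter_upwards [Ico_mem_nhdsLT (h.lt_arrivalTime hj'T (ht.1.trans htT) (hj.trans hjj')),
        h.eventually_count_eq hj'T] with s hs hcs
      have hs0 := ht₂.trans hs.1
      have hst : s ≤ t := (hs.2.trans_le hτ).le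
      have h1 := h.le_weightedMass_one_sub (h.driverClose_mono hL he) hs0 hst htT
      -- Inflow is at least `μ r (t - s)` and outflow at most `μ L (t - s)`, so `L ≤ r` leaves only
      -- the error terms.
      have h2 := (abs_le.1 (h.abs_count_sub_le he hs0 hst htT)).1
      have h3 := h.mul_le_integral_lam ht₂ hb hlam hs.1 hst ht.2
      have h4 := intervalIntegral.integral_mono_on hst
        (h.intervalIntegrable_weightedMass 1 L hs0 hst htT) (g := fun _ => (L : ℝ)) (by simp)
        fun x hx => weightedMass_one_le
          (h.path.mem_states x ⟨hs0.trans hx.1, hx.2.trans htT⟩) L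
      rw [intervalIntegral.integral_const, smul_eq_mul] at h4
      rw [hcs] at h1 h2
      have h5 := div_le_div_of_nonneg_right hsum hn.le
      rw [sub_div] at h5
      have h6 := mul_le_mul_of_nonneg_left h4 h.μ_pos.le
      have h7 : μ * ((t - s) * L) ≤ μ * r * (t - s) := by
        have := mul_le_mul_of_nonneg_left hr (mul_nonneg h.μ_pos.le (sub_nonneg.2 hst))
        linarith
      linarith
    have h1 := mul_le_weightedMass_one (h.preOccupancy_mem hj'T) (le_refl L)
    have h2 := mul_le_mul_of_nonneg_left hfull' (Nat.cast_nonneg (α := ℝ) L)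
    linarith
  have h1 := weightedMass_one_le_sub (h.path.mem_states t ⟨ht0, htT⟩) L
  have hLK : (L : ℝ) ≤ K := by exact_mod_cast hL
  have hx : 0 ≤ 1 / (n : ℝ) + 2 * e := by positivity
  have h2 := mul_le_mul_of_nonneg_right hLK hx
  linarith

theorem le_preOccupancy_of_full (h : RegularPath n Δ μ α T lam N U q ℓ) {K L : ℕ} {e : ℝ}
    (hL : L ≤ K) (he : DriverClose n μ T lam N K e) {t₂ b r : ℝ} (ht₂ : 0 ≤ t₂) (htb : t₂ ≤ b)
    (hb : b ≤ T) (hlam : ∀ x ∈ Icc t₂ b, μ * r ≤ lam x) (hr : L ≤ r) {j k : ℕ}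
    (hj : arrivalCount n lam (N 0) t₂ ≤ j) (hjk : j < k)
    (hk : k < arrivalCount n lam (N 0) b)
    (hfull : 1 - 1 / (n : ℝ) ≤ preOccupancy n lam (N 0) q j L)
    (hpre : ∀ i, j < i → i < k → preThreshold n lam (N 0) ℓ i = L) :
    1 - (K + 1) * (1 / n + 2 * e) ≤ preOccupancy n lam (N 0) q k L := by
  have hkT := hk.trans_le (h.count_mono (ht₂.trans htb) hb le_rfl)
  refine ge_of_tendsto (((continuous_apply L).tendsto _).comp (h.tendsto_preOccupancy hkT)) ?_
  have hτ := h.arrivalTime_le (ht₂.trans htb) hk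
  filter_upwards [Ico_mem_nhdsLT (h.lt_arrivalTime hkT (htb.trans hb) (hj.trans hjk.le)),
    h.eventually_count_eq hkT] with s hs hcs
  exact h.le_occupancy_of_full hL he ht₂ hb hlam hr hj ⟨hs.1, (hs.2.trans_le hτ).le⟩
    (by rw [hcs]; exact hjk) hfull (by rw [hcs]; exact hpre)

section Settled

variable {m k₁ k₂ : ℕ}

/-- If the threshold cannot decrease while the pools stay full, it increases at most `m` times. -/
theorem sum_increase_le (h : RegularPath n Δ μ α T lam N U q ℓ) (hΔ : 1 ≤ Δ)
    (hk₂ : k₂ ≤ arrivalCount n lam (N 0) T)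
    (hS : ∀ k, k₁ ≤ k → k ≤ k₂ → thresholdAfter n Δ α lam (N 0) q ℓ k ≤ m * Δ)
    (hfull : ∀ j k L, k₁ ≤ j → j < k → k < k₂ → L ≤ m * Δ →
      1 - 1 / (n : ℝ) ≤ preOccupancy n lam (N 0) q j L →
      (∀ i, j < i → i < k → preThreshold n lam (N 0) ℓ i = L) →
      α < preOccupancy n lam (N 0) q k L) {k : ℕ} (hk₁ : k₁ ≤ k) (hk : k ≤ k₂) :
    ∑ i ∈ Finset.Ico k₁ k, (if thresholdStep n Δ α (preOccupancy n lam (N 0) q i)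
      (preThreshold n lam (N 0) ℓ i) = 1 then (1 : ℤ) else 0) ≤ m := by
  set x : ℕ → ℤ := fun i => thresholdStep n Δ α (preOccupancy n lam (N 0) q i)
      (preThreshold n lam (N 0) ℓ i) with hx
  set S : ℕ → ℤ := thresholdAfter n Δ α lam (N 0) q ℓ with hSdef
  have hsucc : ∀ k, S (k + 1) = S k + Δ * x k := fun k => thresholdAfter_succ ..
  -- Invariant: once a rise has occurred, the current threshold is a level that was full at an
  -- arrival `j` and has not changed since. By `hfull` its occupancy exceeds `α`, so no decrease
  -- follows and the threshold is at least `Δ` times the number of rises. Decreases before the first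
  -- rise are harmless.
  have key : ∀ k, k₁ ≤ k → k ≤ k₂ → (∑ i ∈ Finset.Ico k₁ k, (if x i = 1 then (1 : ℤ) else 0) = 0) ∨
      ((∃ j L : ℕ, k₁ ≤ j ∧ j < k ∧ (L : ℤ) = S k ∧
        1 - 1 / (n : ℝ) ≤ preOccupancy n lam (N 0) q j L ∧
        ∀ i, j < i → i < k → preThreshold n lam (N 0) ℓ i = L) ∧
      Δ * ∑ i ∈ Finset.Ico k₁ k, (if x i = 1 then (1 : ℤ) else 0) ≤ S k) := by
    intro k hk
    induction k, hk using Nat.le_induction with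
    | base => intro _; left; simp
    | succ k hk ih =>
      intro hkk
      have hpre : (preThreshold n lam (N 0) ℓ k : ℤ) = S k :=
        h.preThreshold_eq (Nat.lt_of_succ_le (hkk.trans hk₂))
      rw [Finset.sum_Ico_succ_top hk]
      have hup : x k = 1 → ∃ j L : ℕ, k₁ ≤ j ∧ j < k + 1 ∧ (L : ℤ) = S (k + 1) ∧
          1 - 1 / (n : ℝ) ≤ preOccupancy n lam (N 0) q j L ∧
          ∀ i, j < i → i < k + 1 → preThreshold n lam (N 0) ℓ i = L := fun h1 =>
        ⟨k, preThreshold n lam (N 0) ℓ k + Δ, hk, by omega, by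
          rw [hsucc, h1]; push_cast; omega, le_of_thresholdStep_eq_one h1, by omega⟩
      have hSk := hS k hk (by omega)
      rcases ih (by omega) with h0 | ⟨⟨j, L, hj, hjk, hLS, hQ, hi⟩, hsum⟩
      · by_cases h1 : x k = 1
        · right
          refine ⟨hup h1, ?_⟩
          rw [h0, hsucc, h1, if_pos rfl]
          omega
        · left
          rw [h0, if_neg h1, add_zero]
      · right
        have hLm : L ≤ m * Δ := by
          have : (L : ℤ) ≤ m * Δ := by rw [hLS]; exact hSk
          exact_mod_cast this
        have hα := hfull j k L hj hjk (by omega) hLm hQ hi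
        have hpk : preThreshold n lam (N 0) ℓ k = L := by
          have : (preThreshold n lam (N 0) ℓ k : ℤ) = L := by rw [hpre, hLS]
          exact_mod_cast this
        have hx0 : 0 ≤ x k := by
          simp only [hx]
          rw [hpk]
          exact thresholdStep_nonneg hα
        have hx1 : x k ≤ 1 := thresholdStep_le_one ..
        by_cases h1 : x k = 1
        · refine ⟨hup h1, ?_⟩
          rw [hsucc, h1, if_pos rfl, mul_add]
          omega
        · have h00 : x k = 0 := by omega
          have hS1 : S (k + 1) = S k := by rw [hsucc, h00, mul_zero, add_zero]
          refine ⟨⟨j, L, hj, by omega, by rw [hS1, hLS], hQ, fun i hji hik => ?_⟩, ?_⟩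
          · rcases (Nat.lt_succ_iff.1 hik).eq_or_lt with rfl | hlt
            · exact hpk
            · exact hi i hji hlt
          · rw [if_neg h1, add_zero, hS1]
            exact hsum
  rcases key k hk₁ hk with h0 | ⟨-, h1⟩
  · rw [h0]; exact Int.natCast_nonneg _
  · have h2 := h1.trans (hS k hk₁ hk)
    rw [mul_comm (m : ℤ)] at h2
    exact le_of_mul_le_mul_left h2 (by exact_mod_cast hΔ)

/-- The threshold reaches `m Δ` at a time when all pools have at least `m Δ` tasks. -/
theorem exists_full (h : RegularPath n Δ μ α T lam N U q ℓ) (hΔ : 1 ≤ Δ) (hd : Δ ∣ ℓ 0) (hα : α < 1)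
    {e : ℝ} (he : DriverClose n μ T lam N (m * Δ) e) {t₂ t₃ r : ℝ} (ht₂ : 0 ≤ t₂) (ht₂₃ : t₂ ≤ t₃)
    (ht₃ : t₃ ≤ T) (hlam : ∀ x ∈ Icc t₂ t₃, μ * r ≤ lam x)
    (hS : ∀ k, arrivalCount n lam (N 0) t₂ ≤ k → k < arrivalCount n lam (N 0) t₃ →
      thresholdAfter n Δ α lam (N 0) q ℓ k ≤ m * Δ)
    (hup : ∑ i ∈ Finset.Ico (arrivalCount n lam (N 0) t₂) (arrivalCount n lam (N 0) t₃),
      (if thresholdStep n Δ α (preOccupancy n lam (N 0) q i)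
        (preThreshold n lam (N 0) ℓ i) = 1 then (1 : ℤ) else 0) ≤ m)
    (hr : m * Δ + (m / n + 2 * (m * Δ + 1) * e) < r * (1 - Real.exp (-μ * (t₃ - t₂)))) :
    ∃ j, arrivalCount n lam (N 0) t₂ ≤ j ∧ j < arrivalCount n lam (N 0) t₃ ∧
      preThreshold n lam (N 0) ℓ j = m * Δ ∧ preOccupancy n lam (N 0) q j (m * Δ) = 1 := by
  by_contra hcon
  push Not at hcon
  have hn : (0 : ℝ) < n := by exact_mod_cast h.one_le
  have he0 := h.driverClose_nonneg he
  set w : ℕ → ℝ := fun k => dispatchWeight Δ (preOccupancy n lam (N 0) q k)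
    (preThreshold n lam (N 0) ℓ k) (U k) 1 (m * Δ) with hw
  set v : ℕ → ℝ := fun i => if thresholdStep n Δ α (preOccupancy n lam (N 0) q i)
        (preThreshold n lam (N 0) ℓ i) = 1 then (1 : ℝ) else 0 with hv
  -- Each arrival lands below `m Δ` or raises the threshold. If level `L` is not full the task goes
  -- below `L`. Otherwise `L ≠ m Δ` by the assumption to be refuted, so `L + Δ ≤ m Δ`; then the task
  -- goes below `L + Δ`, unless that level is full too and the threshold rises.
  have hwv : ∀ k, arrivalCount n lam (N 0) t₂ ≤ k → k < arrivalCount n lam (N 0) t₃ →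
      1 ≤ w k + v k := by
    intro k hk2 hk3
    have hkT := hk3.trans_le (h.count_mono (ht₂.trans ht₂₃) ht₃ le_rfl)
    have hQm := h.preOccupancy_mem hkT
    have hpre := h.preThreshold_eq hkT
    have hSk := hS k hk2 hk3
    have hne := hcon k hk2 hk3
    simp only [hw, hv]
    set Q := preOccupancy n lam (N 0) q k
    set L := preThreshold n lam (N 0) ℓ k
    have hv0 : (0 : ℝ) ≤ if thresholdStep n Δ α Q L = 1 then (1 : ℝ) else 0 := by
      split_ifs <;> norm_num
    have hw0 : 0 ≤ dispatchWeight Δ Q L (U k) 1 (m * Δ) :=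
      dispatchWeight_nonneg (fun _ => zero_le_one) _
    have hLm : L ≤ m * Δ := by
      have : (L : ℤ) ≤ m * Δ := by rw [hpre]; exact hSk
      exact_mod_cast this
    by_cases h1 : Q L < 1
    · rw [dispatchWeight_one_of_lt hQm h1 hLm (h.selection_mem k)]
      linarith
    have h1' : Q L = 1 := le_antisymm (occupancyStates_le_one hQm _) (not_lt.1 h1)
    have hLne : L ≠ m * Δ := fun hc => hne hc (hc ▸ h1')
    have hLΔ : L + Δ ≤ m * Δ := by
      have hdv : Δ ∣ L := by
        have := h.dvd_thresholdAfter hd k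
        rw [← hpre] at this
        exact_mod_cast this
      obtain ⟨j, hj⟩ := hdv
      have hjm : j < m := by
        have : Δ * j < Δ * m := by rw [← hj, mul_comm Δ m]; omega
        exact lt_of_mul_lt_mul_left this (Nat.zero_le _)
      calc L + Δ = Δ * (j + 1) := by rw [hj]; ring
        _ ≤ Δ * m := Nat.mul_le_mul_left _ hjm
        _ = m * Δ := mul_comm _ _
    by_cases h2 : Q (L + Δ) < 1
    · rw [dispatchWeight_one_of_eq hQm h1' h2 hLΔ (h.selection_mem k)]
      linarith
    have h2' : Q (L + Δ) = 1 := le_antisymm (occupancyStates_le_one hQm _) (not_lt.1 h2)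
    have hpos : 0 < 1 / (n : ℝ) := by positivity
    rw [if_pos (thresholdStep_eq_one (by rw [h2']; linarith) (by rw [h1']; exact hα))]
    linarith
  have hv0 : ∀ i, 0 ≤ v i := fun i => by
    simp only [hv]; split_ifs <;> norm_num
  have hupR : ∑ i ∈ Finset.Ico (arrivalCount n lam (N 0) t₂) (arrivalCount n lam (N 0) t₃), v i ≤
      m := by
    have : (((∑ i ∈ Finset.Ico (arrivalCount n lam (N 0) t₂) (arrivalCount n lam (N 0) t₃),
      (if thresholdStep n Δ α (preOccupancy n lam (N 0) q i)
        (preThreshold n lam (N 0) ℓ i) = 1 then (1 : ℤ) else 0) : ℤ)) : ℝ) ≤ ((m : ℤ) : ℝ) := by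
      exact_mod_cast hup
    push_cast at this
    exact this
  set δ : ℝ := m / n + 2 * (m * Δ + 1) * e with hδ
  have hδ0 : 0 ≤ δ := by positivity
  -- The mass lags the solution of `x' = μ (r - x)`, `x (t₂) = 0`, by at most `δ`: `m / n` for the
  -- arrivals that raise the threshold, the rest for Poisson fluctuations. At `t₃` that solution
  -- exceeds `m Δ + δ`, although the mass cannot exceed `m Δ`.
  have hcmp := le_max_add_of_sub_le_integral (s₀ := t₂) (s₁ := t₃) (κ := μ) (δ := δ)
    (y := fun t => (r + (-r) * Real.exp (-μ * (t - t₂))) - weightedMass 1 (m * Δ) (q t))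
    h.μ_pos.le hδ0
    ((Continuous.intervalIntegrable (by fun_prop) _ _).sub
      (h.intervalIntegrable_weightedMass 1 (m * Δ) ht₂ ht₂₃ ht₃))
    (fun s t hs hst ht => by
      have hs0 := ht₂.trans hs
      have htT := ht.trans ht₃
      have h1 := h.le_weightedMass_one_sub he hs0 hst htT
      have h2 := (abs_le.1 (h.abs_count_sub_le he hs0 hst htT)).1
      have h3 := h.mul_le_integral_lam ht₂ ht₃ hlam hs hst ht
      have h4 := relaxation_sub μ r (-r) t₂ s t
      have hcs : arrivalCount n lam (N 0) t₂ ≤ arrivalCount n lam (N 0) s :=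
        h.count_mono ht₂ hs (hst.trans htT)
      have hct : arrivalCount n lam (N 0) t ≤ arrivalCount n lam (N 0) t₃ :=
        h.count_mono (hs0.trans hst) ht ht₃
      have hcst : arrivalCount n lam (N 0) s ≤ arrivalCount n lam (N 0) t :=
        h.count_mono hs0 hst htT
      have h5 : ((arrivalCount n lam (N 0) t : ℝ) - arrivalCount n lam (N 0) s) - m ≤
          ∑ k ∈ Finset.Ico (arrivalCount n lam (N 0) s) (arrivalCount n lam (N 0) t), w k := by
        have hA : ∑ k ∈ Finset.Ico (arrivalCount n lam (N 0) s) (arrivalCount n lam (N 0) t),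
            (1 : ℝ) ≤ ∑ k ∈ Finset.Ico (arrivalCount n lam (N 0) s)
              (arrivalCount n lam (N 0) t), (w k + v k) :=
          Finset.sum_le_sum fun k hk => hwv k (hcs.trans (Finset.mem_Ico.1 hk).1)
            ((Finset.mem_Ico.1 hk).2.trans_le hct)
        have hB : ∑ k ∈ Finset.Ico (arrivalCount n lam (N 0) s) (arrivalCount n lam (N 0) t), v k ≤
            m := (Finset.sum_le_sum_of_subset_of_nonneg (Finset.Ico_subset_Ico hcs hct)
              fun i _ _ => hv0 i).trans hupR
        rw [Finset.sum_add_distrib, Finset.sum_const, Nat.card_Ico, nsmul_eq_mul, mul_one,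
          Nat.cast_sub hcst] at hA
        linarith
      have h6 := div_le_div_of_nonneg_right h5 hn.le
      rw [sub_div] at h6
      rw [intervalIntegral.integral_sub (Continuous.intervalIntegrable (by fun_prop) _ _)
        (h.intervalIntegrable_weightedMass 1 (m * Δ) hs0 hst htT)]
      push_cast at h1
      change (∑ k ∈ Finset.Ico (arrivalCount n lam (N 0) s) (arrivalCount n lam (N 0) t), w k) / n
        - _ - _ ≤ _ at h1
      linarith) t₃ ⟨ht₂₃, le_rfl⟩
  have hm0 := weightedMass_nonneg (h.path.mem_states t₂ ⟨ht₂, ht₂₃.trans ht₃⟩)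
    (c := 1) (fun _ => zero_le_one) (m * Δ)
  have hm1 := weightedMass_one_le (h.path.mem_states t₃ ⟨ht₂.trans ht₂₃, ht₃⟩) (m * Δ)
  simp only [sub_self, mul_zero, Real.exp_zero, mul_one, add_neg_cancel] at hcmp
  rw [max_eq_right (by linarith)] at hcmp
  push_cast at hm1
  linarith

/-- After all pools have `m Δ` tasks at threshold `m Δ`, the threshold does not move any more. -/
theorem thresholdAfter_eq_of_full (h : RegularPath n Δ μ α T lam N U q ℓ)
    (hk₂ : k₂ ≤ arrivalCount n lam (N 0) T)
    (hcap : ∀ k, k₁ ≤ k → k < k₂ →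
      preOccupancy n lam (N 0) q k ((m + 1) * Δ) < 1 - 1 / (n : ℝ))
    (hfull : ∀ j k L, k₁ ≤ j → j < k → k < k₂ → L ≤ m * Δ →
      1 - 1 / (n : ℝ) ≤ preOccupancy n lam (N 0) q j L →
      (∀ i, j < i → i < k → preThreshold n lam (N 0) ℓ i = L) →
      α < preOccupancy n lam (N 0) q k L) (hα : α < 1) {j : ℕ} (hj₁ : k₁ ≤ j) (hj₂ : j < k₂)
    (hjL : preThreshold n lam (N 0) ℓ j = m * Δ)
    (hjQ : preOccupancy n lam (N 0) q j (m * Δ) = 1) :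
    ∀ k, j ≤ k → k ≤ k₂ → thresholdAfter n Δ α lam (N 0) q ℓ k = m * Δ := by
  intro k
  induction k using Nat.strong_induction_on with
  | _ k ih =>
    intro hjk hkk
    rcases hjk.eq_or_lt with rfl | hlt
    · rw [← h.preThreshold_eq (hj₂.trans_le hk₂), hjL]
      push_cast
      rfl
    obtain ⟨p, rfl⟩ : ∃ p, k = p + 1 := ⟨k - 1, by omega⟩
    have hpre : ∀ i, j ≤ i → i < p + 1 → preThreshold n lam (N 0) ℓ i = m * Δ := by
      intro i hji hip
      have h1 := ih i hip hji (by omega)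
      rw [← h.preThreshold_eq (by omega)] at h1
      exact_mod_cast h1
    have hpL := hpre p (by omega) (by omega)
    have hpQ : α < preOccupancy n lam (N 0) q p (m * Δ) := by
      rcases (Nat.lt_succ_iff.1 hlt).eq_or_lt with rfl | hjp
      · rw [hjQ]; exact hα
      · refine hfull j p (m * Δ) hj₁ hjp (by omega) le_rfl ?_ fun i hi hip =>
          hpre i hi.le (by omega)
        rw [hjQ]
        have : (0 : ℝ) ≤ 1 / n := by positivity
        linarith
    have h1 : thresholdStep n Δ α (preOccupancy n lam (N 0) q p)
        (preThreshold n lam (N 0) ℓ p) = 0 := by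
      rw [hpL]
      refine le_antisymm (thresholdStep_nonpos ?_) (thresholdStep_nonneg hpQ)
      rw [show m * Δ + Δ = (m + 1) * Δ by ring]
      exact hcap p (by omega) (by omega)
    rw [thresholdAfter_succ, h1, mul_zero, add_zero]
    exact ih p (by omega) (by omega) (by omega)

end Settled

end RegularPath

end LoadBalancing

end

/-! ### Slowly decreasing weights and comparison with the fluid mass -/

noncomputable section

namespace LoadBalancing

/-- Slowly decreasing weights, vanishing below the level `p`. -/
def decayWeight (ε : ℝ) (p i : ℕ) : ℝ :=
  if i < p then 0 else max 0 (1 - ε * ∑ j ∈ Finset.range i, 1 / ((j : ℝ) + 1))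

theorem decayWeight_nonneg (ε : ℝ) (p i : ℕ) : 0 ≤ decayWeight ε p i := by
  unfold decayWeight
  split_ifs
  · exact le_rfl
  · exact le_max_left _ _

theorem decayWeight_le_one {ε : ℝ} (hε : 0 ≤ ε) (p i : ℕ) : decayWeight ε p i ≤ 1 := by
  unfold decayWeight
  split_ifs
  · exact zero_le_one
  · refine max_le zero_le_one ?_
    have : 0 ≤ ε * ∑ j ∈ Finset.range i, 1 / ((j : ℝ) + 1) := by positivity
    linarith

theorem le_decayWeight (ε : ℝ) {p i : ℕ} (h : p ≤ i) :
    1 - ε * ∑ j ∈ Finset.range i, 1 / ((j : ℝ) + 1) ≤ decayWeight ε p i := by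
  rw [decayWeight, if_neg (not_lt.2 h)]
  exact le_max_right _ _

/-- Harmonic decrements `ε / (i + 1)` cancel the factor `i + 1` of the departure rates. The upward
jump of the weights at level `p` has the favourable sign. -/
theorem decayWeight_sub_le {ε : ℝ} (hε : 0 ≤ ε) (p i : ℕ) :
    (i + 1) * (decayWeight ε p i - decayWeight ε p (i + 1)) ≤ ε := by
  have hi : (0 : ℝ) < i + 1 := by positivity
  by_cases h : i < p
  · have h1 := decayWeight_nonneg ε p (i + 1)
    have h2 : decayWeight ε p i = 0 := by rw [decayWeight, if_pos h]
    rw [h2]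
    nlinarith
  · have hle : decayWeight ε p i - decayWeight ε p (i + 1) ≤ ε / (i + 1) := by
      rw [decayWeight, decayWeight, if_neg h, if_neg (by omega), Finset.sum_range_succ]
      have h0 : 0 ≤ ε / ((i : ℝ) + 1) := by positivity
      rw [sub_le_iff_le_add]
      refine max_le (add_nonneg h0 (le_max_left _ _)) ?_
      have := le_max_right 0
        (1 - ε * (∑ j ∈ Finset.range i, 1 / ((j : ℝ) + 1) + 1 / ((i : ℝ) + 1)))
      rw [mul_add, mul_one_div] at this
      rw [mul_add, mul_one_div]
      linarith
    calc _ ≤ ((i : ℝ) + 1) * (ε / (i + 1)) := mul_le_mul_of_nonneg_left hle hi.le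
      _ = ε := by field_simp

/-- Divergence of the harmonic series: the weights reach zero at a finite level, so finitely many
driving paths suffice. -/
theorem eventually_decayWeight_eq_zero {ε : ℝ} (hε : 0 < ε) (p : ℕ) :
    ∀ᶠ K in atTop, decayWeight ε p K = 0 := by
  have h := Real.tendsto_sum_range_one_div_nat_succ_atTop
  filter_upwards [h.eventually_ge_atTop (1 / ε)] with K hK
  unfold decayWeight
  split_ifs
  · rfl
  · refine max_eq_left ?_
    rw [div_le_iff₀ hε, mul_comm] at hK
    linarith

/-- The first `k` levels carry almost the same mass with weights `decayWeight ε 0` as without. -/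
theorem weightedMass_one_le_decayWeight {q : ℕ → ℝ} (hq : q ∈ occupancyStates) {ε M : ℝ}
    (hε : 0 ≤ ε) {k K : ℕ} (hk : k ≤ K) (hM : weightedMass 1 k q ≤ M) :
    weightedMass 1 k q ≤ weightedMass (decayWeight ε 0) K q +
      ε * (∑ j ∈ Finset.range k, 1 / ((j : ℝ) + 1)) * M := by
  set H := ∑ j ∈ Finset.range k, 1 / ((j : ℝ) + 1)
  have hH : 0 ≤ H := by positivity
  have h1 : weightedMass (decayWeight ε 0) k q ≤ weightedMass (decayWeight ε 0) K q :=
    Finset.sum_le_sum_of_subset_of_nonneg (Finset.range_subset_range.2 hk) fun i _ _ =>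
      mul_nonneg (decayWeight_nonneg _ _ _) (occupancyStates_nonneg hq _)
  have h2 : weightedMass 1 k q - weightedMass (decayWeight ε 0) k q ≤ ε * H * weightedMass 1 k q := by
    rw [weightedMass, weightedMass, ← Finset.sum_sub_distrib, Finset.mul_sum]
    refine Finset.sum_le_sum fun i hi => ?_
    have hle : ∑ j ∈ Finset.range i, 1 / ((j : ℝ) + 1) ≤ H :=
      Finset.sum_le_sum_of_subset_of_nonneg
        (Finset.range_subset_range.2 (Finset.mem_range.1 hi).le) fun _ _ _ => by positivity
    have h3 := le_decayWeight ε (Nat.zero_le i)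
    have h4 := mul_le_mul_of_nonneg_left hle hε
    rw [← sub_mul, Pi.one_apply, one_mul]
    exact mul_le_mul_of_nonneg_right (by linarith) (occupancyStates_nonneg hq _)
  have h5 := mul_le_mul_of_nonneg_left hM (mul_nonneg hε hH)
  linarith

namespace RegularPath

variable {n Δ : ℕ} {μ α T : ℝ} {lam : ℝ → ℝ} {N : ℕ → ℝ≥0 → ℕ} {U : ℕ → ℝ}
  {q : ℝ → ℕ → ℝ} {ℓ : ℝ → ℕ}

/-- The weighted number of tasks is asymptotically at most the fluid total mass. -/
theorem weightedMass_le_totalMass (h : RegularPath n Δ μ α T lam N U q ℓ) {K : ℕ}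
    {e ε M : ℝ} (q₀ : ℕ → ℝ) (hε : 0 ≤ ε) (hK : decayWeight ε 0 K = 0)
    (hM : ∀ t ∈ Icc 0 T, weightedMass 1 (K + 1) (q t) ≤ M)
    (he : DriverClose n μ T lam N K e) {t : ℝ} (ht : t ∈ Icc 0 T) :
    weightedMass (decayWeight ε 0) K (q t) ≤ totalMass μ lam q₀ t +
      max (weightedMass (decayWeight ε 0) K (q 0) - totalMass μ lam q₀ 0) 0 +
      (2 * (K + 1) * e + μ * (ε * M) * T) := by
  have hn : (0 : ℝ) < n := by exact_mod_cast h.one_le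
  have hT := h.T_nonneg
  have h0T : (0 : ℝ) ∈ Icc 0 T := ⟨le_rfl, hT⟩
  have he0 := h.driverClose_nonneg he
  have hM0 : 0 ≤ M := (weightedMass_nonneg (h.path.mem_states 0 h0T)
    (fun _ => zero_le_one) _).trans (hM 0 h0T)
  have hδ : 0 ≤ 2 * (K + 1) * e + μ * (ε * M) * T := by
    have := h.μ_pos
    positivity
  have hu := continuousOn_totalMass h.μ_pos.ne' hT q₀ h.lam_int
  have hui : ∀ s t, 0 ≤ s → s ≤ t → t ≤ T → IntervalIntegrable (totalMass μ lam q₀) volume s t :=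
    fun s t hs hst ht => (hu.mono (by
      rw [uIcc_of_le hst]; exact Icc_subset_Icc hs ht)).intervalIntegrable
  -- Each arrival adds weight at most one and the weighted departure rate is at least `μ` times the
  -- mass up to `μ ε M`, so the difference to `u` satisfies the comparison inequality.
  have hcmp := le_max_add_of_sub_le_integral (s₀ := 0) (s₁ := T) (κ := μ)
    (y := fun t => weightedMass (decayWeight ε 0) K (q t) - totalMass μ lam q₀ t)
    h.μ_pos.le hδ
    ((h.intervalIntegrable_weightedMass _ K le_rfl hT le_rfl).sub (hui 0 T le_rfl hT le_rfl))
    (fun s t hs hst ht => by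
      have h1 := h.weightedMass_sub_le (decayWeight_nonneg ε 0) (decayWeight_le_one hε 0) hK hε
        (decayWeight_sub_le hε 0) hM he hs hst ht
      have h2 := (abs_le.1 (h.abs_count_sub_le he hs hst ht)).2
      have h3 := totalMass_sub h.μ_pos.ne' hT q₀ h.lam_int hs hst ht
      have h4 : ∑ k ∈ Finset.Ico (arrivalCount n lam (N 0) s) (arrivalCount n lam (N 0) t),
          dispatchWeight Δ (preOccupancy n lam (N 0) q k) (preThreshold n lam (N 0) ℓ k) (U k)
            (decayWeight ε 0) K ≤
          (arrivalCount n lam (N 0) t : ℝ) - arrivalCount n lam (N 0) s := by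
        refine (Finset.sum_le_sum (g := fun _ => (1 : ℝ)) fun k hk => ?_).trans ?_
        · exact dispatchWeight_le (h.preOccupancy_mem ((Finset.mem_Ico.1 hk).2.trans_le
            (h.count_mono (hs.trans hst) ht le_rfl))) K (decayWeight_le_one hε 0)
            (h.selection_mem k)
        · rw [Finset.sum_const, Nat.card_Ico, nsmul_eq_mul, mul_one,
            Nat.cast_sub (h.count_mono hs hst ht)]
      have h5 := div_le_div_of_nonneg_right h4 hn.le
      rw [intervalIntegral.integral_sub (h.intervalIntegrable_weightedMass _ K hs hst ht)
        (hui s t hs hst ht)]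
      linarith) t ht
  linarith

/-- If no tasks are sent to the levels from `p` on, their occupancy decays exponentially. -/
theorem weightedMass_le_exp_decay (h : RegularPath n Δ μ α T lam N U q ℓ) {K p : ℕ}
    {e ε M C : ℝ} (hε : 0 ≤ ε) (hK : decayWeight ε p K = 0)
    (hM : ∀ t ∈ Icc 0 T, weightedMass 1 (K + 1) (q t) ≤ M)
    (he : DriverClose n μ T lam N K e) {t₃ b : ℝ} (ht₃ : 0 ≤ t₃) (ht₃b : t₃ ≤ b) (hb : b ≤ T)
    (hdisp : ∀ k, arrivalCount n lam (N 0) t₃ ≤ k → k < arrivalCount n lam (N 0) b →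
      preOccupancy n lam (N 0) q k (preThreshold n lam (N 0) ℓ k + Δ) < 1 ∧
        preThreshold n lam (N 0) ℓ k + Δ ≤ p)
    (hC : weightedMass (decayWeight ε p) K (q t₃) ≤ C) {t : ℝ} (ht : t ∈ Icc t₃ b) :
    weightedMass (decayWeight ε p) K (q t) ≤ C * Real.exp (-μ * (t - t₃)) +
      (2 * K * e + μ * (ε * M) * T) := by
  have h0T : (0 : ℝ) ∈ Icc 0 T := ⟨le_rfl, h.T_nonneg⟩
  have he0 := h.driverClose_nonneg he
  have hM0 : 0 ≤ M := (weightedMass_nonneg (h.path.mem_states 0 h0T)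
    (fun _ => zero_le_one) _).trans (hM 0 h0T)
  have hδ : 0 ≤ 2 * K * e + μ * (ε * M) * T := by
    have := h.μ_pos
    have := h.T_nonneg
    positivity
  have hcmp := le_max_add_of_sub_le_integral (s₀ := t₃) (s₁ := b) (κ := μ)
    (y := fun t => weightedMass (decayWeight ε p) K (q t) - (0 + C * Real.exp (-μ * (t - t₃))))
    h.μ_pos.le hδ
    ((h.intervalIntegrable_weightedMass _ K ht₃ ht₃b hb).sub
      (Continuous.intervalIntegrable (by fun_prop) _ _))
    (fun s t hs hst ht => by
      have hs0 := ht₃.trans hs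
      have htT := ht.trans hb
      have h1 := h.weightedMass_sub_le (decayWeight_nonneg ε p) (decayWeight_le_one hε p) hK hε
        (decayWeight_sub_le hε p) hM he hs0 hst htT
      have h3 := relaxation_sub μ 0 C t₃ s t
      -- Arrivals contribute nothing: they land below `p`, where the weights vanish.
      rw [Finset.sum_eq_zero fun k hk => ?_] at h1
      · rw [intervalIntegral.integral_sub (h.intervalIntegrable_weightedMass _ K hs0 hst htT)
          (Continuous.intervalIntegrable (by fun_prop) _ _)]
        rw [zero_div] at h1
        linarith
      · obtain ⟨hk1, hk2⟩ := Finset.mem_Ico.1 hk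
        obtain ⟨hd1, hd2⟩ := hdisp k
          ((h.count_mono ht₃ hs (hst.trans htT)).trans hk1)
          (hk2.trans_le (h.count_mono (hs0.trans hst) ht hb))
        refine dispatchWeight_eq_zero hd1 (fun i hi => ?_) _
        rw [decayWeight, if_pos (hi.trans_le hd2)]) t ht
  simp only [sub_self, mul_zero, Real.exp_zero, mul_one, zero_add] at hcmp
  rw [max_eq_right (by linarith)] at hcmp
  linarith

end RegularPath

/-! ### Bounds for the fluid mass and splitting of the settling time -/

section Fluid

variable {T μ : ℝ} {lam : ℝ → ℝ} {q₀ : ℕ → ℝ} {a b : ℝ}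

theorem totalMass_le_relaxation (hμ : 0 < μ) (hlam : IntervalIntegrable lam volume 0 T)
    (ha : 0 ≤ a) (hab : a ≤ b) (hb : b ≤ T) {R : ℝ} (hR : ∀ x ∈ Icc a b, lam x ≤ μ * R) {t : ℝ}
    (ht : t ∈ Icc a b) :
    totalMass μ lam q₀ t ≤
      R + max (totalMass μ lam q₀ a - R) 0 * Real.exp (-μ * (t - a)) := by
  have hT : 0 ≤ T := ha.trans (hab.trans hb)
  have hu := continuousOn_totalMass hμ.ne' hT q₀ hlam
  have hui : ∀ s t, a ≤ s → s ≤ t → t ≤ b → IntervalIntegrable (totalMass μ lam q₀) volume s t :=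
    fun s t hs hst ht => (hu.mono (by
      rw [uIcc_of_le hst]; exact Icc_subset_Icc (ha.trans hs) (ht.trans hb))).intervalIntegrable
  set d := max (totalMass μ lam q₀ a - R) 0 with hd
  have hcmp := le_max_add_of_sub_le_integral (s₀ := a) (s₁ := b) (κ := μ) (δ := 0)
    (y := fun t => totalMass μ lam q₀ t - (R + d * Real.exp (-μ * (t - a))))
    hμ.le le_rfl
    ((hui a b le_rfl hab le_rfl).sub (Continuous.intervalIntegrable (by fun_prop) _ _))
    (fun s t hs hst ht => by
      have h1 := totalMass_sub hμ.ne' hT q₀ hlam (ha.trans hs) hst (ht.trans hb)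
      have h2 := relaxation_sub μ R d a s t
      have h3 := intervalIntegral.integral_mono_on hst (g := fun _ => μ * R)
        (hlam.mono_set (by
          rw [uIcc_of_le hst, uIcc_of_le hT]
          exact Icc_subset_Icc (ha.trans hs) (ht.trans hb))) (by simp)
        fun x hx => hR x ⟨hs.trans hx.1, hx.2.trans ht⟩
      rw [intervalIntegral.integral_const, smul_eq_mul] at h3
      rw [intervalIntegral.integral_sub (hui s t hs hst ht)
        (Continuous.intervalIntegrable (by fun_prop) _ _)]
      linarith) t ht
  have h0 := le_max_left (totalMass μ lam q₀ a - R) 0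
  simp only [sub_self, mul_zero, Real.exp_zero, mul_one, add_zero] at hcmp
  rw [max_eq_right (by linarith)] at hcmp
  linarith

/-- Comparison with relaxation towards `r` from zero; it supplies the positivity of `u(a + σ)`. -/
theorem relaxation_le_totalMass (hμ : 0 < μ) (hlam : IntervalIntegrable lam volume 0 T)
    (ha : 0 ≤ a) (hab : a ≤ b) (hb : b ≤ T) {r : ℝ} (hr : ∀ x ∈ Icc a b, μ * r ≤ lam x)
    (hua : 0 ≤ totalMass μ lam q₀ a) {t : ℝ} (ht : t ∈ Icc a b) :
    r * (1 - Real.exp (-μ * (t - a))) ≤ totalMass μ lam q₀ t := by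
  have hT : 0 ≤ T := ha.trans (hab.trans hb)
  have hu := continuousOn_totalMass hμ.ne' hT q₀ hlam
  have hui : ∀ s t, a ≤ s → s ≤ t → t ≤ b → IntervalIntegrable (totalMass μ lam q₀) volume s t :=
    fun s t hs hst ht => (hu.mono (by
      rw [uIcc_of_le hst]; exact Icc_subset_Icc (ha.trans hs) (ht.trans hb))).intervalIntegrable
  have hcmp := le_max_add_of_sub_le_integral (s₀ := a) (s₁ := b) (κ := μ) (δ := 0)
    (y := fun t => (r + (-r) * Real.exp (-μ * (t - a))) - totalMass μ lam q₀ t)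
    hμ.le le_rfl
    ((Continuous.intervalIntegrable (by fun_prop) _ _).sub (hui a b le_rfl hab le_rfl))
    (fun s t hs hst ht => by
      have h1 := totalMass_sub hμ.ne' hT q₀ hlam (ha.trans hs) hst (ht.trans hb)
      have h2 := relaxation_sub μ r (-r) a s t
      have h3 := intervalIntegral.integral_mono_on hst (f := fun _ => μ * r) (by simp)
        (hlam.mono_set (by
          rw [uIcc_of_le hst, uIcc_of_le hT]
          exact Icc_subset_Icc (ha.trans hs) (ht.trans hb)))
        fun x hx => hr x ⟨hs.trans hx.1, hx.2.trans ht⟩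
      rw [intervalIntegral.integral_const, smul_eq_mul] at h3
      rw [intervalIntegral.integral_sub (Continuous.intervalIntegrable (by fun_prop) _ _)
        (hui s t hs hst ht)]
      linarith) t ht
  simp only [sub_self, mul_zero, Real.exp_zero, mul_one, add_zero, add_neg_cancel] at hcmp
  rw [max_eq_right (by linarith)] at hcmp
  linarith

theorem mul_rhoMin_le (hμ : 0 < μ) (ha : 0 ≤ a) (hb : b ≤ T)
    (hlam_nonneg : ∀ t ∈ Icc 0 T, 0 ≤ lam t) {x : ℝ} (hx : x ∈ Icc a b) :
    μ * rhoMin μ lam a b ≤ lam x := by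
  have : rhoMin μ lam a b ≤ lam x / μ := by
    refine csInf_le ⟨0, ?_⟩ ⟨x, hx, rfl⟩
    rintro _ ⟨y, hy, rfl⟩
    exact div_nonneg (hlam_nonneg y ⟨ha.trans hy.1, hy.2.trans hb⟩) hμ.le
  rw [le_div_iff₀ hμ] at this
  linarith

theorem le_mul_rhoMax (hμ : 0 < μ) (ha : 0 ≤ a) (hb : b ≤ T)
    (hlam_bdd : ∃ K : ℝ, ∀ t ∈ Icc 0 T, lam t ≤ K) {x : ℝ} (hx : x ∈ Icc a b) :
    lam x ≤ μ * rhoMax μ lam a b := by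
  obtain ⟨K, hK⟩ := hlam_bdd
  have : lam x / μ ≤ rhoMax μ lam a b := by
    refine le_csSup ⟨K / μ, ?_⟩ ⟨x, hx, rfl⟩
    rintro _ ⟨y, hy, rfl⟩
    exact div_le_div_of_nonneg_right (hK y ⟨ha.trans hy.1, hy.2.trans hb⟩) hμ.le
  rw [div_le_iff₀ hμ] at this
  linarith

/-- The settling time splits into a time to get below the upper load level and a time to fill
all pools up to the lower load level. -/
theorem IsLoadBounded.exists_times (hμ : 0 < μ) {m Δ : ℕ}
    (h : IsLoadBounded T μ lam q₀ m Δ a b) (hlam : IntervalIntegrable lam volume 0 T)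
    (hlam_bdd : ∃ K : ℝ, ∀ t ∈ Icc 0 T, lam t ≤ K)
    {σ : ℝ} (hσ : settlingTime μ lam q₀ a b m Δ < σ) :
    ∃ t₁ t₂ ε₀ : ℝ, a ≤ t₁ ∧ t₁ < t₂ ∧ t₂ ≤ a + σ ∧ 0 < ε₀ ∧
      (∀ t ∈ Icc t₁ b, totalMass μ lam q₀ t ≤ (m + 1) * Δ - ε₀) ∧
      m * Δ < rhoMin μ lam a b * (1 - Real.exp (-μ * (a + σ - t₂))) := by
  set r := rhoMin μ lam a b with hr
  set R := rhoMax μ lam a b with hR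
  set ua := totalMass μ lam q₀ a with hua
  have hmr : (m : ℝ) * Δ < r := h.lt_rhoMin
  have hRm : R < ((m : ℝ) + 1) * Δ := h.rhoMax_lt
  have hmΔ : (0 : ℝ) ≤ m * Δ := by positivity
  have hr0 : 0 < r := hmΔ.trans_lt hmr
  set s₂ := 1 / μ * Real.log (r / (r - m * Δ)) with hs₂
  have hs₂0 : 0 ≤ s₂ := by
    refine mul_nonneg (by positivity) (Real.log_nonneg ?_)
    rw [le_div_iff₀ (by linarith)]
    linarith
  set d := max (ua - R) 0 with hd
  -- `s₁` is the time for the excess `d exp (-μ s)` of `u` over `R` to fall to `(m + 1) Δ - R`; the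
  -- inequality is strict only after `s₁`.
  obtain ⟨s₁, hs₁0, hs₁, hsettle⟩ : ∃ s₁, 0 ≤ s₁ ∧
      (∀ η > 0, d * Real.exp (-μ * (s₁ + η)) < (m + 1) * Δ - R) ∧
      settlingTime μ lam q₀ a b m Δ = s₂ + s₁ := by
    by_cases hc : R < ua
    · refine ⟨1 / μ * max (Real.log ((ua - R) / ((m + 1) * Δ - R))) 0,
        mul_nonneg (by positivity) (le_max_right _ _), fun η hη => ?_, ?_⟩
      · rw [hd, max_eq_left (by linarith)]
        have hx : 0 < (ua - R) / ((m + 1) * Δ - R) := div_pos (by linarith) (by linarith)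
        have hle : -μ * (1 / μ * max (Real.log ((ua - R) / ((m + 1) * Δ - R))) 0 + η) <
            -Real.log ((ua - R) / ((m + 1) * Δ - R)) := by
          have h1 := le_max_left (Real.log ((ua - R) / ((m + 1) * Δ - R))) 0
          have h2 : 0 < μ * η := by positivity
          have h3 : -μ * (1 / μ * max (Real.log ((ua - R) / ((m + 1) * Δ - R))) 0 + η) =
              -max (Real.log ((ua - R) / ((m + 1) * Δ - R))) 0 - μ * η := by
            field_simp
            ring
          rw [h3]
          linarith
        have h4 := Real.exp_lt_exp.2 hle
        rw [Real.exp_neg, Real.exp_log hx, inv_div] at h4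
        calc _ < (ua - R) * (((m + 1) * Δ - R) / (ua - R)) :=
              mul_lt_mul_of_pos_left h4 (by linarith)
          _ = _ := by
              have : ua - R ≠ 0 := by linarith
              field_simp
      · rw [settlingTime, if_pos hc]
    · refine ⟨0, le_rfl, fun η hη => ?_, ?_⟩
      · rw [hd, max_eq_right (by linarith [not_lt.1 hc]), zero_mul]
        linarith
      · rw [settlingTime, if_neg hc, add_zero]
  rw [hsettle] at hσ
  -- The slack is cut in three: one `η` after `s₁` opens the gap `ε₀`, one separates `t₁` from `t₂`
  -- so that the threshold can come down, and one makes the filling inequality strict, since `a + σ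
  -- - t₂ = s₂ + η`.
  set η := (σ - (s₂ + s₁)) / 3 with hη
  have hη0 : 0 < η := by rw [hη]; linarith
  refine ⟨a + (s₁ + η), a + (s₁ + η) + η,
    (m + 1) * Δ - R - d * Real.exp (-μ * (s₁ + η)), by linarith, by linarith, by linarith,
    by linarith [hs₁ η hη0], fun t ht => ?_, ?_⟩
  · have h1 := totalMass_le_relaxation (q₀ := q₀) hμ hlam h.nonneg_left h.le h.right_le
      (R := R) (fun x hx => le_mul_rhoMax hμ h.nonneg_left h.right_le hlam_bdd hx) (t := t)
      ⟨by linarith [ht.1], ht.2⟩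
    have h2 : d * Real.exp (-μ * (t - a)) ≤ d * Real.exp (-μ * (s₁ + η)) := by
      refine mul_le_mul_of_nonneg_left (Real.exp_le_exp.2 ?_) (le_max_right _ _)
      rw [neg_mul, neg_mul, neg_le_neg_iff]
      exact mul_le_mul_of_nonneg_left (by linarith [ht.1]) hμ.le
    linarith
  · have hlt : -μ * (a + σ - (a + (s₁ + η) + η)) < -Real.log (r / (r - m * Δ)) := by
      have h1 : a + σ - (a + (s₁ + η) + η) = s₂ + η := by rw [hη]; ring
      have h2 : -μ * (s₂ + η) = -Real.log (r / (r - m * Δ)) - μ * η := by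
        rw [hs₂]
        field_simp
        ring
      rw [h1, h2]
      have : 0 < μ * η := by positivity
      linarith
    have h3 := Real.exp_lt_exp.2 hlt
    rw [Real.exp_neg, Real.exp_log (div_pos hr0 (by linarith)), inv_div] at h3
    have h4 := mul_lt_mul_of_pos_left h3 hr0
    rw [mul_div_cancel₀ _ hr0.ne'] at h4
    linarith

end Fluid

end LoadBalancing

end

/-! ### Asymptotics as the number of pools grows -/

noncomputable section

namespace LoadBalancing

/-- A sequence of regular sample paths, one for each number of server pools, with convergent initial
conditions and control parameters that tend to one slowly. -/
structure RegularSequence (Δ : ℕ) (μ T : ℝ) (lam : ℝ → ℝ) (α : ℕ → ℝ) (N : ℕ → ℝ≥0 → ℕ)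
    (U : ℕ → ℝ) (q : ℕ → ℝ → ℕ → ℝ) (ℓ : ℕ → ℝ → ℕ) (B : ℕ) (q₀ : ℕ → ℝ) (γ₀ κ : ℝ) :
    Prop where
  path : ∀ n, 1 ≤ n → RegularPath n Δ μ (α n) T lam N U (q n) (ℓ n)
  one_le_step : 1 ≤ Δ
  dvd : ∀ n, 1 ≤ n → Δ ∣ ℓ n 0
  bounded : ∀ n, 1 ≤ n → q n 0 (B + 1) = 0 ∧ ℓ n 0 ≤ B
  mem_states : q₀ ∈ occupancyStates
  tendsto_initial : Tendsto (fun n => q n 0) atTop (𝓝 q₀)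
  rate : ∀ i, HasUniformRate γ₀ (N i)
  exponent_mem : γ₀ ∈ Ioo (0 : ℝ) 1
  lt_one : ∀ n, 1 ≤ n → α n < 1
  tendsto_control : Tendsto α atTop (𝓝 1)
  κ_pos : 0 < κ
  control_rate : ∀ᶠ n : ℕ in atTop, κ * (n : ℝ) ^ (-γ₀) ≤ 1 - α n

namespace RegularSequence

variable {Δ : ℕ} {μ T : ℝ} {lam : ℝ → ℝ} {α : ℕ → ℝ} {N : ℕ → ℝ≥0 → ℕ} {U : ℕ → ℝ}
  {q : ℕ → ℝ → ℕ → ℝ} {ℓ : ℕ → ℝ → ℕ} {B : ℕ} {q₀ : ℕ → ℝ} {γ₀ κ : ℝ}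

theorem eventually_driverClose (h : RegularSequence Δ μ T lam α N U q ℓ B q₀ γ₀ κ) (K : ℕ) {ε : ℝ}
    (hε : 0 < ε) : ∀ᶠ n : ℕ in atTop, DriverClose n μ T lam N K (ε * (n : ℝ) ^ (-γ₀)) := by
  have := (Finset.eventually_all (Finset.range (K + 1))).2 fun i _ =>
    h.rate i (max (∫ s in (0 : ℝ)..T, lam s) (μ * K * T)) ε hε
  filter_upwards [this] with n hn i hi
  exact hn i (Finset.mem_range.2 (by omega))

theorem eventually_driverClose_const (h : RegularSequence Δ μ T lam α N U q ℓ B q₀ γ₀ κ) (K : ℕ)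
    {e : ℝ} (he : 0 < e) : ∀ᶠ n : ℕ in atTop, DriverClose n μ T lam N K e := by
  filter_upwards [h.eventually_driverClose K he, eventually_ge_atTop 1] with n hn hn1 i hi x hx
  refine (hn i hi x hx).trans ?_
  have h1 : (1 : ℝ) ≤ n := by exact_mod_cast hn1
  have h2 : (n : ℝ) ^ (-γ₀) ≤ 1 := Real.rpow_le_one_of_one_le_of_nonpos h1
    (by linarith [h.exponent_mem.1])
  exact mul_le_of_le_one_right he.le h2

theorem eventually_mass_le (h : RegularSequence Δ μ T lam α N U q ℓ B q₀ γ₀ κ) :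
    ∀ᶠ n : ℕ in atTop, ∀ K, ∀ t ∈ Icc 0 T,
      weightedMass 1 K (q n t) ≤ B + (∫ x in (0 : ℝ)..T, lam x) + 1 := by
  filter_upwards [h.eventually_driverClose_const 0 (show (0 : ℝ) < 1 / 2 by norm_num),
    eventually_ge_atTop 1] with n hn hn1 K t ht
  exact (h.path n hn1).weightedMass_one_le_const (h.bounded n hn1).1 hn le_rfl K ht

theorem mass_bound_nonneg (h : RegularSequence Δ μ T lam α N U q ℓ B q₀ γ₀ κ) :
    0 ≤ B + (∫ x in (0 : ℝ)..T, lam x) + 1 := by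
  have := intervalIntegral.integral_nonneg (μ := volume) (h.path 1 le_rfl).T_nonneg
    fun x hx => (h.path 1 le_rfl).lam_nonneg x hx
  positivity

/-- The limit inherits `q₀ (B + 1) = 0`, so the series in `u(0)` is a finite sum. Summability
matters, as `tsum` would otherwise default to zero. -/
theorem eventually_initial_le (h : RegularSequence Δ μ T lam α N U q ℓ B q₀ γ₀ κ) (K : ℕ) {η : ℝ}
    (hη : 0 < η) : ∀ᶠ n : ℕ in atTop, weightedMass 1 K (q n 0) ≤ totalMass μ lam q₀ 0 + η := by
  have hzero : q₀ (B + 1) = 0 := by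
    refine tendsto_nhds_unique (((continuous_apply (B + 1)).tendsto _).comp h.tendsto_initial) ?_
    refine tendsto_const_nhds.congr' ?_
    filter_upwards [eventually_ge_atTop 1] with n hn
    exact (h.bounded n hn).1.symm
  have hsum : Summable fun i => q₀ (i + 1) := by
    refine summable_of_ne_finset_zero (s := Finset.range B) fun i hi => ?_
    have h1 := occupancyStates_antitone h.mem_states
      (show B + 1 ≤ i + 1 by have := Finset.mem_range.not.1 hi; omega)
    rw [hzero] at h1
    exact le_antisymm h1 (occupancyStates_nonneg h.mem_states _)
  have hle : weightedMass 1 K q₀ ≤ totalMass μ lam q₀ 0 := by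
    have := hsum.sum_le_tsum (Finset.range K) fun i _ => occupancyStates_nonneg h.mem_states (i + 1)
    simpa [weightedMass, totalMass] using this
  have hlim := ((continuous_weightedMass 1 K).tendsto q₀).comp h.tendsto_initial
  filter_upwards [hlim.eventually (gt_mem_nhds (show weightedMass 1 K q₀ <
    totalMass μ lam q₀ 0 + η by linarith))] with n hn
  exact le_of_lt hn

/-- The number of tasks per pool is asymptotically at most the fluid total mass. -/
theorem eventually_weightedMass_le (h : RegularSequence Δ μ T lam α N U q ℓ B q₀ γ₀ κ) (k : ℕ)
    {η : ℝ} (hη : 0 < η) : ∀ᶠ n : ℕ in atTop, ∀ t ∈ Icc 0 T,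
      weightedMass 1 k (q n t) ≤ totalMass μ lam q₀ t + η := by
  set M : ℝ := B + (∫ x in (0 : ℝ)..T, lam x) + 1 with hM
  have hM0 : 0 ≤ M := h.mass_bound_nonneg
  have hμ := (h.path 1 le_rfl).μ_pos
  have hT := (h.path 1 le_rfl).T_nonneg
  set H : ℝ := ∑ j ∈ Finset.range k, 1 / ((j : ℝ) + 1) with hH
  have hH0 : 0 ≤ H := by positivity
  -- The weights cost `ε H M` and the departure estimate `ε μ M T`; `ε = η / (4 A)` fits both into
  -- `η / 4`. The level `K` is chosen after `ε`, and the driver accuracy after `K`.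
  set A : ℝ := H * M + μ * M * T + 1 with hA
  have hA0 : 0 < A := by positivity
  set ε : ℝ := η / (4 * A) with hε
  have hε0 : 0 < ε := by positivity
  have hεA : ε * (H * M) + ε * (μ * M * T) + ε = η / 4 := by
    rw [hε]; field_simp; rw [hA]; ring
  obtain ⟨K, hK0, hkK⟩ :=
    ((eventually_decayWeight_eq_zero hε0 0).and (eventually_ge_atTop k)).exists
  have he0 : 0 < η / (8 * ((K : ℝ) + 1)) := by positivity
  filter_upwards [h.eventually_mass_le, h.eventually_driverClose_const K he0,
    h.eventually_initial_le K (show 0 < η / 4 by positivity), eventually_ge_atTop 1]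
    with n hmass hclose hinit hn t ht
  have hp := h.path n hn
  have h1 := hp.weightedMass_le_totalMass q₀ hε0.le hK0 (hmass (K + 1)) hclose ht
  have h2 := weightedMass_one_le_decayWeight (hp.path.mem_states t ht) hε0.le hkK (hmass k t ht)
  have h3 : weightedMass (decayWeight ε 0) K (q n 0) ≤ weightedMass 1 K (q n 0) :=
    Finset.sum_le_sum fun i _ => mul_le_mul_of_nonneg_right (decayWeight_le_one hε0.le 0 i)
      (occupancyStates_nonneg (hp.path.mem_states 0 ⟨le_rfl, hT⟩) _)
  have h4 : max (weightedMass (decayWeight ε 0) K (q n 0) - totalMass μ lam q₀ 0) 0 ≤ η / 4 :=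
    max_le (by linarith) (by positivity)
  have h5 : 2 * ((K : ℝ) + 1) * (η / (8 * (K + 1))) = η / 4 := by field_simp; norm_num
  rw [h5] at h1
  have h6 : ε * H * M = ε * (H * M) := by ring
  have h7 : μ * (ε * M) * T = ε * (μ * M * T) := by ring
  rw [← hH] at h2
  linarith

/-- From time `t₃` on the threshold equals `m Δ`, almost all pools have at least `m Δ` tasks and no
task is sent to a pool with at least `(m + 1) Δ` tasks. -/
theorem eventually_settled (h : RegularSequence Δ μ T lam α N U q ℓ B q₀ γ₀ κ) {m : ℕ}
    {t₁ t₂ t₃ b r ε₀ : ℝ} (ht₁ : 0 ≤ t₁) (ht₁₂ : t₁ < t₂) (ht₂₃ : t₂ ≤ t₃) (ht₃ : t₃ ≤ b)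
    (hb : b ≤ T) (hlam : ∀ x ∈ Icc t₁ b, μ * r ≤ lam x) (hmr : m * Δ < r) (hε₀ : 0 < ε₀)
    (hu : ∀ t ∈ Icc t₁ b, totalMass μ lam q₀ t ≤ (m + 1) * Δ - ε₀)
    (hfill : m * Δ < r * (1 - Real.exp (-μ * (t₃ - t₂)))) :
    ∀ᶠ n : ℕ in atTop, (∀ t ∈ Icc t₃ b, ℓ n t = m * Δ ∧ α n ≤ q n t (m * Δ)) ∧
      ∀ k, arrivalCount n lam (N 0) t₃ ≤ k → k < arrivalCount n lam (N 0) b →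
        preOccupancy n lam (N 0) (q n) k (preThreshold n lam (N 0) (ℓ n) k + Δ) < 1 ∧
          preThreshold n lam (N 0) (ℓ n) k + Δ ≤ (m + 1) * Δ := by
  have hμ := (h.path 1 le_rfl).μ_pos
  have hΔ := h.one_le_step
  have hΔ0 : (0 : ℝ) < Δ := by exact_mod_cast hΔ
  have hΔ1 : (1 : ℝ) ≤ Δ := by exact_mod_cast hΔ
  have hm0 : (0 : ℝ) ≤ m * Δ := by positivity
  have hr0 : 0 < r := hm0.trans_lt hmr
  set M : ℝ := B + (∫ x in (0 : ℝ)..T, lam x) + 1 with hM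
  obtain ⟨L₀, hL₀⟩ := exists_nat_ge (max (B : ℝ) (2 * M))
  have hBL : B ≤ L₀ := by exact_mod_cast (le_max_left _ _).trans hL₀
  have hML : 2 * M ≤ L₀ := (le_max_right _ _).trans hL₀
  set K : ℕ := m * Δ with hK
  have hKr : (K : ℝ) = m * Δ := by rw [hK]; push_cast; rfl
  have hK1 : (0 : ℝ) < K + 1 := by positivity
  set p : ℕ := (m + 1) * Δ with hp
  have hpr : (p : ℝ) = (m + 1) * Δ := by rw [hp]; push_cast; rfl
  have hp0 : (0 : ℝ) < p := by rw [hpr]; positivity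
  -- The mass is eventually at most `p - ε₀ / 2`; Markov's inequality divides this by `p`.
  set ε₁ : ℝ := ε₀ / (2 * p) with hε₁
  have hε₁0 : 0 < ε₁ := by positivity
  -- With `e = ε n ^ (-γ₀)`, the term `(K + 1) (2 e)` is half of `κ n ^ (-γ₀) ≤ 1 - α n`; the other
  -- half dominates `(K + 1) / n` because `γ₀ < 1`. So full levels stay above `α n`.
  set ε : ℝ := κ / (4 * (K + 1)) with hε
  have hκ := h.κ_pos
  have hε0 : 0 < ε := by positivity
  have hγ := h.exponent_mem
  have hsmall : ∀ᶠ n : ℕ in atTop, ((K : ℝ) + 1) / n < κ / 2 * (n : ℝ) ^ (-γ₀) := by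
    have hlim := ((tendsto_rpow_atTop (show 0 < 1 - γ₀ by linarith [hγ.2])).comp
      tendsto_natCast_atTop_atTop).eventually_gt_atTop ((K + 1) / (κ / 2))
    filter_upwards [hlim, eventually_ge_atTop 1] with n hn hn1
    have hn0 : (0 : ℝ) < n := by exact_mod_cast hn1
    rw [div_lt_iff₀ hn0, mul_assoc, ← Real.rpow_add_one hn0.ne']
    rw [div_lt_iff₀ (by positivity)] at hn
    rw [show -γ₀ + 1 = 1 - γ₀ by ring, mul_comm]
    exact hn
  set gap : ℝ := r * (1 - Real.exp (-μ * (t₃ - t₂))) - m * Δ with hgap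
  have hgap0 : 0 < gap := by rw [hgap]; linarith
  have hα1 : Tendsto (fun n => 1 - α n) atTop (𝓝 0) := by
    simpa using (tendsto_const_nhds (x := (1 : ℝ))).sub h.tendsto_control
  have hrt : 0 < μ * r * (t₂ - t₁) := mul_pos (mul_pos hμ hr0) (by linarith)
  have hn_large := tendsto_natCast_atTop_atTop (R := ℝ)
  filter_upwards [h.eventually_driverClose K hε0, hsmall, h.control_rate, h.eventually_mass_le,
    h.eventually_weightedMass_le p (show 0 < ε₀ / 2 by positivity),
    hα1.eventually (gt_mem_nhds hgap0), hα1.eventually (gt_mem_nhds hε₁0),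
    hα1.eventually (gt_mem_nhds (show 0 < μ * r * (t₂ - t₁) / 2 by positivity)),
    hn_large.eventually_gt_atTop (L₀ / (μ * r * (t₂ - t₁) / 2)),
    hn_large.eventually_gt_atTop (1 / ε₁), eventually_ge_atTop 2]
    with n hclose hsm hrate hmass hup hαgap hαε hαt hnL hnε hn2
  have hn1 : 1 ≤ n := by omega
  have hn0 : (0 : ℝ) < n := by exact_mod_cast hn1
  have hpath := h.path n hn1
  have hαlt := h.lt_one n hn1
  have hd := h.dvd n hn1
  set e : ℝ := ε * (n : ℝ) ^ (-γ₀) with he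
  have he0 : 0 ≤ e := by positivity
  have ht₂0 : 0 ≤ t₂ := ht₁.trans ht₁₂.le
  have ht₂b : t₂ ≤ b := ht₂₃.trans ht₃
  have hkey : ((K : ℝ) + 1) * (1 / n + 2 * e) < 1 - α n := by
    have h1 : ((K : ℝ) + 1) * (2 * e) = κ / 2 * (n : ℝ) ^ (-γ₀) := by
      rw [he, hε]; field_simp; norm_num
    rw [mul_add, h1, mul_one_div]
    linarith
  have hen : 2 * e ≤ 1 - α n := by
    have h1 : 0 ≤ 1 / (n : ℝ) := by positivity
    have h2 : 1 / (n : ℝ) + 2 * e ≤ ((K : ℝ) + 1) * (1 / n + 2 * e) :=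
      le_mul_of_one_le_left (by positivity) (by linarith [Nat.cast_nonneg (α := ℝ) K])
    linarith
  -- The number of arrivals between `t₁` and `t₂` is of order `n`, which exceeds the fixed bound
  -- `L₀` needed for the descent.
  have hcount : arrivalCount n lam (N 0) t₁ + L₀ ≤ arrivalCount n lam (N 0) t₂ := by
    have h1 := (abs_le.1 (hpath.abs_count_sub_le hclose ht₁ ht₁₂.le (ht₂b.trans hb))).1
    have h2 := hpath.mul_le_integral_lam ht₁ hb hlam le_rfl ht₁₂.le ht₂b
    rw [div_lt_iff₀ (by positivity)] at hnL
    have h3 : μ * r * (t₂ - t₁) / 2 ≤ ((arrivalCount n lam (N 0) t₂ : ℝ) -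
        arrivalCount n lam (N 0) t₁) / n := by linarith
    rw [le_div_iff₀ hn0] at h3
    have h4 : (arrivalCount n lam (N 0) t₁ : ℝ) + L₀ ≤ arrivalCount n lam (N 0) t₂ := by linarith
    exact_mod_cast h4
  have hnε' : 1 / (n : ℝ) < ε₁ := by
    rw [div_lt_iff₀ hε₁0] at hnε
    rw [div_lt_iff₀ hn0]
    linarith
  have hbT := hpath.count_mono (ht₂0.trans ht₂b) hb le_rfl
  have hcap : ∀ k, arrivalCount n lam (N 0) t₁ ≤ k → k < arrivalCount n lam (N 0) b →
      preOccupancy n lam (N 0) (q n) k p ≤ 1 - ε₁ := by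
    intro k hk1 hk2
    refine hpath.preOccupancy_mem_of_isClosed (A := {Q | Q p ≤ 1 - ε₁})
      (isClosed_le (continuous_apply p) continuous_const) ht₁ hb (ht₁₂.le.trans ht₂b)
      (fun t ht => ?_) hk1 hk2
    have htT : t ∈ Icc 0 T := ⟨ht₁.trans ht.1, ht.2.trans hb⟩
    have h1 := mul_le_weightedMass_one (hpath.path.mem_states t htT) (le_refl p)
    have h2 := hup t htT
    have h3 := hu t ht
    have h4 : p * ε₁ = ε₀ / 2 := by rw [hε₁]; field_simp
    have h5 : (p : ℝ) * q n t p ≤ p * (1 - ε₁) := by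
      rw [mul_sub, h4, mul_one]
      linarith
    exact le_of_mul_le_mul_left h5 hp0
  have hSle := hpath.thresholdAfter_le hn2 ((h.bounded n hn1).2.trans hBL) hmass hML
  have hS : ∀ k, arrivalCount n lam (N 0) t₂ ≤ k → k ≤ arrivalCount n lam (N 0) b →
      thresholdAfter n Δ (α n) lam (N 0) (q n) (ℓ n) k ≤ m * Δ := fun k hk1 hk2 =>
    hpath.thresholdAfter_le_of_capped hΔ hd hbT hcap hnε' (by linarith)
      (fun k hk => hSle k (hk.trans hbT)) (hcount.trans hk1) hk2
  have hlam₂ : ∀ x ∈ Icc t₂ b, μ * r ≤ lam x := fun x hx => hlam x ⟨ht₁₂.le.trans hx.1, hx.2⟩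
  have hfull : ∀ j k L, arrivalCount n lam (N 0) t₂ ≤ j → j < k → k < arrivalCount n lam (N 0) b →
      L ≤ m * Δ → 1 - 1 / (n : ℝ) ≤ preOccupancy n lam (N 0) (q n) j L →
      (∀ i, j < i → i < k → preThreshold n lam (N 0) (ℓ n) i = L) →
      α n < preOccupancy n lam (N 0) (q n) k L := by
    intro j k L hj hjk hk hL hQ hpre
    have hLr : (L : ℝ) ≤ r := by
      have : (L : ℝ) ≤ K := by exact_mod_cast hL
      linarith
    have := hpath.le_preOccupancy_of_full hL hclose ht₂0 ht₂b hb hlam₂ hLr hj hjk hk hQ hpre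
    linarith
  have h₂₃ := hpath.count_mono ht₂0 ht₂₃ (ht₃.trans hb)
  have h₃b := hpath.count_mono (ht₂0.trans ht₂₃) ht₃ hb
  have hups := hpath.sum_increase_le hΔ hbT hS hfull h₂₃ h₃b
  obtain ⟨j, hj₂, hj₃, hjL, hjQ⟩ := hpath.exists_full hΔ hd hαlt hclose ht₂0 ht₂₃ (ht₃.trans hb)
    (fun x hx => hlam₂ x ⟨hx.1, hx.2.trans ht₃⟩)
    (fun k hk1 hk2 => hS k hk1 (hk2.le.trans h₃b)) hups (by
      have h1 : (m : ℝ) / n + 2 * (m * Δ + 1) * e ≤ (K + 1) * (1 / n + 2 * e) := by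
        have h2 : (m : ℝ) ≤ K + 1 := by
          rw [hKr]
          have := le_mul_of_one_le_right (Nat.cast_nonneg (α := ℝ) m) hΔ1
          linarith
        have h3 := div_le_div_of_nonneg_right h2 hn0.le
        have h4 : ((K : ℝ) + 1) * (1 / n + 2 * e) = (K + 1) / n + 2 * (K + 1) * e := by ring
        rw [← hKr, h4]
        linarith
      linarith)
  have hcap' : ∀ k, arrivalCount n lam (N 0) t₂ ≤ k → k < arrivalCount n lam (N 0) b →
      preOccupancy n lam (N 0) (q n) k ((m + 1) * Δ) < 1 - 1 / (n : ℝ) := fun k hk1 hk2 => by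
    have := hcap k (by omega) hk2
    linarith
  have hSeq := hpath.thresholdAfter_eq_of_full hbT hcap' hfull hαlt hj₂ (hj₃.trans_le h₃b) hjL hjQ
  have hpre : ∀ k, j ≤ k → k < arrivalCount n lam (N 0) b →
      preThreshold n lam (N 0) (ℓ n) k = m * Δ := fun k hk1 hk2 => by
    have h1 := hSeq k hk1 hk2.le
    rw [← hpath.preThreshold_eq (hk2.trans_le hbT)] at h1
    exact_mod_cast h1
  refine ⟨fun t ht => ?_, fun k hk1 hk2 => ?_⟩
  · have ht0 : 0 ≤ t := ht₂0.trans (ht₂₃.trans ht.1)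
    have hct := hpath.count_mono (ht₂0.trans ht₂₃) ht.1 (ht.2.trans hb)
    have hctb := hpath.count_mono ht0 ht.2 hb
    refine ⟨?_, ?_⟩
    · have h1 := hSeq _ (hj₃.le.trans hct) hctb
      rw [← hpath.threshold_eq ⟨ht0, ht.2.trans hb⟩] at h1
      exact_mod_cast h1
    · have := hpath.le_occupancy_of_full (L := m * Δ) le_rfl hclose ht₂0 hb hlam₂
        (by rw [← hK, hKr]; exact hmr.le) hj₂ ⟨ht₂₃.trans ht.1, ht.2⟩ (hj₃.trans_le hct)
        (by rw [hjQ]; have : (0 : ℝ) ≤ 1 / n := by positivity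
            linarith)
        fun i hi hit => hpre i hi.le (hit.trans_le hctb)
      linarith
  · have hL := hpre k (hj₃.le.trans hk1) hk2
    rw [hL, show m * Δ + Δ = (m + 1) * Δ by ring]
    refine ⟨?_, le_rfl⟩
    have := hcap' k (h₂₃.trans hk1) hk2
    have h1 : (0 : ℝ) ≤ 1 / n := by positivity
    linarith

/-- Exponential decay of the occupancy of the levels that do not receive tasks. -/
theorem eventually_le_exp_decay (h : RegularSequence Δ μ T lam α N U q ℓ B q₀ γ₀ κ) {p : ℕ}
    {t₃ b : ℝ} (ht₃ : 0 ≤ t₃) (ht₃b : t₃ ≤ b) (hb : b ≤ T)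
    (hdisp : ∀ᶠ n : ℕ in atTop,
      ∀ k, arrivalCount n lam (N 0) t₃ ≤ k → k < arrivalCount n lam (N 0) b →
        preOccupancy n lam (N 0) (q n) k (preThreshold n lam (N 0) (ℓ n) k + Δ) < 1 ∧
          preThreshold n lam (N 0) (ℓ n) k + Δ ≤ p) {i : ℕ} (hi : p ≤ i) {η : ℝ} (hη : 0 < η) :
    ∀ᶠ n : ℕ in atTop, ∀ t ∈ Icc t₃ b,
      q n t (i + 1) ≤ totalMass μ lam q₀ t₃ * Real.exp (-μ * (t - t₃)) + η := by
  set M : ℝ := B + (∫ x in (0 : ℝ)..T, lam x) + 1 with hM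
  have hM0 : 0 ≤ M := h.mass_bound_nonneg
  have hμ := (h.path 1 le_rfl).μ_pos
  have hT := (h.path 1 le_rfl).T_nonneg
  set H : ℝ := ∑ j ∈ Finset.range i, 1 / ((j : ℝ) + 1) with hH
  have hH0 : 0 ≤ H := by positivity
  -- Extracting the single coordinate `i + 1` from the weighted mass costs only `ε H`, without a
  -- factor `M`, because occupancies are at most one.
  set A : ℝ := H + μ * M * T + 1 with hA
  have hA0 : 0 < A := by positivity
  set ε : ℝ := η / (4 * A) with hε
  have hε0 : 0 < ε := by positivity
  have hεA : ε * H + ε * (μ * M * T) + ε = η / 4 := by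
    rw [hε]; field_simp; rw [hA]
  obtain ⟨K, hK0, hiK⟩ :=
    ((eventually_decayWeight_eq_zero hε0 p).and (eventually_gt_atTop i)).exists
  have he0 : 0 < η / (8 * ((K : ℝ) + 1)) := by positivity
  filter_upwards [h.eventually_mass_le, h.eventually_driverClose_const K he0,
    h.eventually_weightedMass_le K (show 0 < η / 4 by positivity), hdisp, eventually_ge_atTop 1]
    with n hmass hclose hup hdn hn t ht
  have hp := h.path n hn
  have ht₃T : t₃ ∈ Icc 0 T := ⟨ht₃, ht₃b.trans hb⟩
  have htT : t ∈ Icc 0 T := ⟨ht₃.trans ht.1, ht.2.trans hb⟩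
  have hqt := hp.path.mem_states t htT
  have h3 : weightedMass (decayWeight ε p) K (q n t₃) ≤ totalMass μ lam q₀ t₃ + η / 4 :=
    (Finset.sum_le_sum fun j _ => mul_le_mul_of_nonneg_right (decayWeight_le_one hε0.le p j)
      (occupancyStates_nonneg (hp.path.mem_states t₃ ht₃T) _)).trans (hup t₃ ht₃T)
  have h1 := hp.weightedMass_le_exp_decay hε0.le hK0 (hmass (K + 1)) hclose ht₃ ht₃b hb hdn h3 ht
  have h2 : decayWeight ε p i * q n t (i + 1) ≤ weightedMass (decayWeight ε p) K (q n t) :=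
    Finset.single_le_sum (f := fun i => decayWeight ε p i * q n t (i + 1))
      (fun j _ => mul_nonneg (decayWeight_nonneg _ _ _) (occupancyStates_nonneg hqt _))
      (Finset.mem_range.2 hiK)
  have h4 : q n t (i + 1) - ε * H ≤ decayWeight ε p i * q n t (i + 1) := by
    have h5 := mul_le_mul_of_nonneg_right (le_decayWeight ε hi)
      (occupancyStates_nonneg hqt (i + 1))
    have h6 := mul_le_mul_of_nonneg_left (occupancyStates_le_one hqt (i + 1))
      (mul_nonneg hε0.le hH0)
    rw [← hH] at h5
    linarith
  have h5 : 2 * (K : ℝ) * (η / (8 * (K + 1))) ≤ η / 4 := by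
    have h6 : 2 * ((K : ℝ) + 1) * (η / (8 * (K + 1))) = η / 4 := by field_simp; norm_num
    linarith
  have h7 : μ * (ε * M) * T = ε * (μ * M * T) := by ring
  have h8 : Real.exp (-μ * (t - t₃)) ≤ 1 := by
    rw [Real.exp_le_one_iff, neg_mul, neg_nonpos]
    exact mul_nonneg hμ.le (by linarith [ht.1])
  have h9 := mul_le_mul_of_nonneg_left h8 (show 0 ≤ η / 4 by positivity)
  linarith

end RegularSequence

end LoadBalancing

end

/-! ### Assembly of the theorem -/

open LoadBalancing in
theorem theorem1
    {Ω : Type*} [MeasurableSpace Ω] (P : Measure Ω) [IsProbabilityMeasure P]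
    -- time horizon, service rate, step of the threshold, arrival rate function
    (T μ : ℝ) (hμ : 0 < μ) (Δ : ℕ) (hΔ : 1 ≤ Δ)
    (lam : ℝ → ℝ) (hlam_meas : AEStronglyMeasurable lam (volume.restrict (Set.Icc 0 T)))
    (hlam_nonneg : ∀ t ∈ Set.Icc 0 T, 0 ≤ lam t)
    (hlam_bdd : ∃ K : ℝ, ∀ t ∈ Set.Icc 0 T, lam t ≤ K)
    -- control parameters
    (α : ℕ → ℝ) (hα : ∀ n, 1 ≤ n → α n ∈ Set.Ioo (0 : ℝ) 1)
    -- driving Poisson processes and selection variables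
    (N : ℕ → ℝ≥0 → Ω → ℕ) (hN : ∀ i, IsUnitPoissonProcess (N i) P)
    (hN_indep : iIndepFun (fun i ω t => N i t ω) P)
    (U : ℕ → Ω → ℝ) (hU : ∀ k, HasLaw (U k) (volume.restrict (Set.Ico (0 : ℝ) 1)) P)
    (hU_indep : iIndepFun U P)
    -- occupancy and threshold processes of the system with `n` server pools
    (q : ℕ → Ω → ℝ → ℕ → ℝ) (ℓ : ℕ → Ω → ℝ → ℕ)
    -- the initial conditions are random elements, and the Poisson processes, the selection
    -- variables and the initial conditions are mutually independent
    (hq_meas : ∀ n, 1 ≤ n → Measurable fun ω => q n ω 0)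
    (hℓ_meas : ∀ n, 1 ≤ n → Measurable fun ω => ℓ n ω 0)
    (h_indep_driving : IndepFun (fun ω i t => N i t ω)
      (fun ω => ((fun k => U k ω), (fun n => (q (n + 1) ω 0, ℓ (n + 1) ω 0)))) P)
    (h_indep_selection : IndepFun (fun ω k => U k ω)
      (fun ω n => (q (n + 1) ω 0, ℓ (n + 1) ω 0)) P)
    -- initially `n * q n i` is a number of server pools and the threshold is a multiple of `Δ`
    (hq_count : ∀ᵐ ω ∂P, ∀ n, 1 ≤ n → ∀ i, ∃ k : ℕ, q n ω 0 i = (k : ℝ) / n)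
    (hℓ_dvd : ∀ᵐ ω ∂P, ∀ n, 1 ≤ n → Δ ∣ ℓ n ω 0)
    -- boundedness and convergence of the initial conditions
    (B : ℕ) (hB : ∀ᵐ ω ∂P, ∀ n, 1 ≤ n → q n ω 0 (B + 1) = 0 ∧ ℓ n ω 0 ≤ B)
    (q₀ : ℕ → ℝ) (hq₀ : q₀ ∈ occupancyStates)
    (hq_lim : ∀ᵐ ω ∂P, Tendsto (fun n => q n ω 0) atTop (𝓝 q₀))
    -- the processes are defined by the evolution equations of the systems
    (h_path : ∀ᵐ ω ∂P, ∀ n, 1 ≤ n →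
      IsSamplePath n Δ μ (α n) T lam (fun i t => N i t ω) (fun k => U k ω) (q n ω) (ℓ n ω))
    -- rate of convergence of the control parameters
    (γ₀ : ℝ) (hγ₀ : γ₀ ∈ Set.Ioo (0 : ℝ) (1 / 2))
    (hα_lim : Tendsto α atTop (𝓝 1))
    (hα_rate : 0 < liminf (fun n : ℕ => (((n : ℝ) ^ γ₀ * (1 - α n) : ℝ) : EReal)) atTop)
    -- the offered load is `(m, Δ)`-bounded on `[a, b]`
    (m : ℕ) (a b : ℝ) (hab : IsLoadBounded T μ lam q₀ m Δ a b)
    (σ : ℝ) (hσ : settlingTime μ lam q₀ a b m Δ < σ) (hσ' : σ < b - a) :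
    ∃ c : ℝ, 0 < c ∧ c = totalMass μ lam q₀ (a + σ) ∧
      ∀ᵐ ω ∂P,
        Tendsto (fun n => ⨆ t ∈ Set.Icc (a + σ) b,
          ENNReal.ofReal |(ℓ n ω t : ℝ) - m * Δ|) atTop (𝓝 0) ∧
        (∀ i : ℕ, i ≤ m * Δ →
          Tendsto (fun n => ⨆ t ∈ Set.Icc (a + σ) b,
            ENNReal.ofReal |1 - q n ω t i|) atTop (𝓝 0)) ∧
        (∀ i : ℕ, (m + 1) * Δ < i →
          limsup (fun n => ⨆ t ∈ Set.Icc (a + σ) b,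
            ENNReal.ofReal (|q n ω t i| * Real.exp (μ * (t - (a + σ))))) atTop
              ≤ ENNReal.ofReal c) := by
  have ha := hab.nonneg_left
  have hb := hab.right_le
  have hT : 0 ≤ T := ha.trans (hab.le.trans hb)
  have hlam_int : IntervalIntegrable lam volume 0 T := by
    rw [intervalIntegrable_iff_integrableOn_Icc_of_le hT]
    obtain ⟨C, hC⟩ := hlam_bdd
    refine Integrable.of_bound hlam_meas C ?_
    filter_upwards [ae_restrict_mem measurableSet_Icc] with x hx
    rw [Real.norm_of_nonneg (hlam_nonneg x hx)]
    exact hC x hx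
  obtain ⟨t₁, t₂, ε₀, hat₁, ht₁₂, ht₂σ, hε₀, hu, hfill⟩ :=
    hab.exists_times hμ hlam_int hlam_bdd hσ
  have haσ : a < a + σ := by linarith
  have hσb : a + σ ≤ b := by linarith
  have hlow : ∀ x ∈ Icc a b, μ * rhoMin μ lam a b ≤ lam x := fun x hx =>
    mul_rhoMin_le hμ ha hb hlam_nonneg hx
  have hr0 : 0 < rhoMin μ lam a b := lt_of_le_of_lt (by positivity) hab.lt_rhoMin
  have hc : 0 < totalMass μ lam q₀ (a + σ) := by
    have h1 := relaxation_le_totalMass (q₀ := q₀) hμ hlam_int ha hab.le hb hlow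
      (totalMass_nonneg hμ hq₀ hlam_nonneg ⟨ha, hab.le.trans hb⟩) (t := a + σ) ⟨haσ.le, hσb⟩
    refine lt_of_lt_of_le (mul_pos hr0 ?_) h1
    rw [sub_pos, Real.exp_lt_one_iff]
    have : 0 < μ * (a + σ - a) := mul_pos hμ (by linarith)
    linarith
  obtain ⟨κ, hκ0, hκ⟩ : ∃ κ : ℝ, 0 < κ ∧ ∀ᶠ n : ℕ in atTop, κ * (n : ℝ) ^ (-γ₀) ≤ 1 - α n := by
    obtain ⟨κ, h1, h2⟩ := EReal.lt_iff_exists_real_btwn.1 hα_rate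
    refine ⟨κ, by exact_mod_cast h1, ?_⟩
    filter_upwards [eventually_lt_of_lt_liminf h2, eventually_ge_atTop 1] with n hn hn1
    have hn0 : (0 : ℝ) < n := by exact_mod_cast hn1
    have h3 : κ < (n : ℝ) ^ γ₀ * (1 - α n) := EReal.coe_lt_coe_iff.1 hn
    rw [Real.rpow_neg hn0.le, ← div_eq_mul_inv, div_le_iff₀ (by positivity)]
    linarith
  refine ⟨_, hc, rfl, ?_⟩
  have hU_mem : ∀ᵐ ω ∂P, ∀ k, U k ω ∈ Ico (0 : ℝ) 1 := ae_all_iff.2 fun k => by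
    have hmeas : Measurable fun x : ℝ => x ∈ Ico (0 : ℝ) 1 := measurableSet_Ico.mem
    exact ((hU k).ae_iff hmeas).2 (ae_restrict_mem measurableSet_Ico)
  filter_upwards [hℓ_dvd, hB, hq_lim, h_path, hU_mem, (hN 0).ae_hasUnitJumps,
    ae_all_iff.2 fun i => (hN i).ae_hasUniformRate hγ₀] with ω hdvd hBω hlim hpath hUω hjumps hrate
  have hseq : RegularSequence Δ μ T lam α (fun i t => N i t ω) (fun k => U k ω)
      (fun n => q n ω) (fun n => ℓ n ω) B q₀ γ₀ κ :=
    { path := fun n hn =>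
        { path := hpath n hn
          one_le := hn
          μ_pos := hμ
          T_nonneg := hT
          lam_int := hlam_int
          lam_nonneg := hlam_nonneg
          zero := (hN 0).zero ω
          mono := (hN 0).mono ω
          rightCts := (hN 0).rightCts ω
          jumps := hjumps
          selection_mem := hUω }
      one_le_step := hΔ
      dvd := hdvd
      bounded := hBω
      mem_states := hq₀
      tendsto_initial := hlim
      rate := hrate
      exponent_mem := ⟨hγ₀.1, by linarith [hγ₀.2]⟩
      lt_one := fun n hn => (hα n hn).2
      tendsto_control := hα_lim
      κ_pos := hκ0
      control_rate := hκ }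
  have hsettled := hseq.eventually_settled (m := m) (ha.trans hat₁) ht₁₂ ht₂σ hσb hb
    (fun x hx => hlow x ⟨hat₁.trans hx.1, hx.2⟩) hab.lt_rhoMin hε₀ hu hfill
  have hstates : ∀ n, 1 ≤ n → ∀ t ∈ Icc (a + σ) b, q n ω t ∈ occupancyStates := fun n hn t ht =>
    (hpath n hn).mem_states t ⟨(ha.trans haσ.le).trans ht.1, ht.2.trans hb⟩
  refine ⟨?_, fun i hi => ?_, fun i hi => ?_⟩
  -- For large `n` the threshold equals `m Δ` throughout the interval, so the supremum is exactly
  -- zero.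
  · refine tendsto_const_nhds.congr' ?_
    filter_upwards [hsettled] with n hn
    symm
    refine le_antisymm (iSup₂_le fun t ht => ?_) zero_le
    rw [(hn.1 t ht).1]
    simp
  · have hlim' : Tendsto (fun n => ENNReal.ofReal (1 - α n)) atTop (𝓝 0) := by
      have h1 : Tendsto (fun n => 1 - α n) atTop (𝓝 0) := by
        simpa using (tendsto_const_nhds (x := (1 : ℝ))).sub hα_lim
      simpa using ENNReal.tendsto_ofReal h1
    refine tendsto_of_tendsto_of_tendsto_of_le_of_le' tendsto_const_nhds hlim'
      (Eventually.of_forall fun n => zero_le) ?_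
    filter_upwards [hsettled, eventually_ge_atTop 1] with n hn hn1
    refine iSup₂_le fun t ht => ENNReal.ofReal_le_ofReal ?_
    have h1 := hstates n hn1 t ht
    have h2 := occupancyStates_antitone h1 hi
    rw [abs_of_nonneg (sub_nonneg.2 (occupancyStates_le_one h1 i))]
    linarith [(hn.1 t ht).2]
  · refine ENNReal.le_of_forall_pos_le_add fun η hη _ => ?_
    obtain ⟨i, rfl⟩ : ∃ i', i = i' + 1 := ⟨i - 1, by omega⟩
    have hη0 : (0 : ℝ) < η := hη
    -- The extra factor offsets the growth of `exp (μ (t - (a + σ)))` up to time `b`, leaving an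
    -- error of at most `η`.
    have hη' : 0 < (η : ℝ) * Real.exp (-(μ * (b - (a + σ)))) := by positivity
    refine limsup_le_of_le (h := ?_)
    filter_upwards [hseq.eventually_le_exp_decay (p := (m + 1) * Δ) (ha.trans haσ.le) hσb hb
      (hsettled.mono fun n hn => hn.2) (Nat.lt_succ_iff.1 hi) hη', eventually_ge_atTop 1]
      with n hn hn1
    refine iSup₂_le fun t ht => ?_
    rw [← ENNReal.ofReal_coe_nnreal (p := η), ← ENNReal.ofReal_add hc.le hη0.le]
    refine ENNReal.ofReal_le_ofReal ?_
    rw [abs_of_nonneg (occupancyStates_nonneg (hstates n hn1 t ht) _)]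
    have h1 := mul_le_mul_of_nonneg_right (hn t ht) (Real.exp_pos (μ * (t - (a + σ)))).le
    have h2 : Real.exp (-μ * (t - (a + σ))) * Real.exp (μ * (t - (a + σ))) = 1 := by
      rw [← Real.exp_add]; simp
    have h3 : Real.exp (-(μ * (b - (a + σ)))) * Real.exp (μ * (t - (a + σ))) ≤ 1 := by
      rw [← Real.exp_add, Real.exp_le_one_iff]
      have := mul_le_mul_of_nonneg_left (sub_le_sub_right ht.2 (a + σ)) hμ.le
      linarith
    have h4 := mul_le_mul_of_nonneg_left h3 hη0.le
    have h5 : (totalMass μ lam q₀ (a + σ) * Real.exp (-μ * (t - (a + σ))) +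
        η * Real.exp (-(μ * (b - (a + σ))))) * Real.exp (μ * (t - (a + σ))) =
        totalMass μ lam q₀ (a + σ) *
          (Real.exp (-μ * (t - (a + σ))) * Real.exp (μ * (t - (a + σ)))) +
        η * (Real.exp (-(μ * (b - (a + σ)))) * Real.exp (μ * (t - (a + σ)))) := by ring
    rw [h5, h2] at h1
    linarith
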